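/- **Setting.** An MDP with nonnegative rewards is $\mathcal M=(S,\mathit{Act},\gamma,\lambda,\mathit{rew},\delta)$ with finite nonempty $S$, finite $\mathit{Act}$, nonempty sets $\gamma(s)\subseteq\mathit{Act}$ of enabled actions, labels $\lambda(s)\subseteq\mathrm{AP}$, rewards $\mathit{rew}(s)\in\mathbb R_{\ge 0}$, and probability distributions $\delta(s,\alpha,\cdot)$ on $S$; $|\delta|$ is the number of triples $(s,\alpha,t)$ with $\alpha\in\gamma(s)$ and $\delta(s,\alpha,t)>0$. A scheduler $\sigma$ maps every nonempty history $s_0\dots s_n$ to an action in $\gamma(s_n)$, and $\Pr_s^\sigma$ is the induced measure on paths from $s$. A path $s_0s_1\dots$ satisfies $a\,\mathsf U_{\le r}\,b$ if for some $k$: $b\in\lambda(s_k)$, $a\in\lambda(s_i)$ for all $i<k$, and $\sum_{i<k}\mathit{rew}(s_i)\le r$. For $\bowtie\,\in\{<,\le,\ge,>\}$, $s\models\forall\mathsf P_{\bowtie p}\,\psi$ (resp. $\exists\mathsf P_{\bowtie p}\,\psi$) means $\Pr_s^\sigma(\psi)\bowtie p$ for all (resp. some) schedulers $\sigma$; $=1$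 abbreviates $\ge 1$. The dual of $\forall\mathsf P_{\bowtie p}$ is $\exists\mathsf P$ with the negated comparison, and vice versa. The value of $s$ with respect to the query $Q(a\,\mathsf U_{\le ?}\,b)$ is $\mathrm{val}_Q(s)=\inf\{r\in\mathbb R: s\models Q(a\,\mathsf U_{\le r}\,b)\}$ if the comparison in $Q$ is $\ge$ or $>$, and the supremum of this set otherwise, in $[-\infty,\infty]$. The query is qualitative if $p\in\{0,1\}$. **Theorem.** (1) Qualitative queries $Q(a\,\mathsf U_{\le ?}\,b)$ can be evaluated in strongly polynomial time. Precisely: for every qualitative $Q$ (in particular $\forall\mathsf P_{>0},\exists\mathsf P_{>0},\forall\mathsf P_{=1},\exists\mathsf P_{=1}$ and their duals) there is a program for a unit-cost random access machine, whose only operations on real numbers are the constant $0$, copying, addition and comparison, and a constant $C$ such that, for every MDP (given by lists, in any order, of its states with labels $a,b$ and rewards, its pairs of a state and an enabled action, and its nontrivial transitions with their probabilities), the program halts with the correct values $\mathrm{val}_Q(s)$ of all states $s$ after at most $C\,|S|^2\,|\delta|$ steps, and after at most $C\,|S|\,|\delta|$ steps if $Q$ is neither $\exists\mathsf P_{=1}$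 nor its dual $\forall\mathsf P_{<1}$. All natural numbers (indices, counters) in its memory are at most $C\,|\delta|$ at all times, and if all rewards and probabilities are rational, then all numbers in its real memory are at all times rational with binary length polynomial in the input size, i.e. in $|S|+|\delta|$ plus the total binary length of the rewards and probabilities. (2) Let $Q\in\{\forall\mathsf P_{>0},\exists\mathsf P_{>0},\forall\mathsf P_{=1},\exists\mathsf P_{=1}\}$. Consider the following greedy algorithm. Put $v(s)=0$ if $b\in\lambda(s)$ and $v(s)=\infty$ otherwise, $X=\{s:b\in\lambda(s)\}$, $R=\{0\}$, $Z=\{s: a\in\lambda(s),\,b\notin\lambda(s),\,\mathit{rew}(s)=0\}$. While $R\neq\emptyset$: let $r=\min R$ and $Y=\{s\in X:v(s)\le r\}\setminus Z$; for every $s\in S\setminus X$ with $a\in\lambda(s)$ and $s\models Q\,\mathsf X(Z\,\mathsf U\,Y)$ set $v(s)=r+\mathit{rew}(s)$ and add $s$ to $X$ and $v(s)$ to $R$; then remove $r$ from $R$. (Here $s_0s_1\dots$ satisfies $\mathsf X(Z\,\mathsf U\,Y)$ if for some $k$, $s_{k+1}\in Y$ and $s_{i+1}\in Z$ for all $i<k$.)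 Then the algorithm terminates after at most $|S|$ iterations with $v(s)=\mathrm{val}_Q(s)=\mathrm{val}_{\overline Q}(s)$ for all $s\in S$, where $\overline Q$ is the dual of $Q$. -/

import Mathlib

open MeasureTheory ProbabilityTheory
open scoped NNReal ENNReal

universe u v w

noncomputable section

namespace QuantileMDP

/-! ### Markov decision processes, schedulers, path measures -/

/-- A Markov decision process with nonnegative state rewards. The transition function
`δ(s, α, ·)` is a probability distribution on states for every state and action. -/
structure MDP (S : Type u) (Act : Type v) (AP : Type w) where
  enabled : S → Finset Act
  enabled_nonempty : ∀ s, (enabled s).Nonempty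
  label : S → Set AP
  rew : S → ℝ≥0
  δ : S → Act → PMF S

variable {S : Type u} {Act : Type v} {AP : Type w}

/-- The nontrivial transitions: triples `(s, α, t)` with `α` enabled in `s` and
`δ(s, α, t) > 0`. -/
def MDP.Transition (M : MDP S Act AP) : Type (max u v) :=
  {τ : S × Act × S // τ.2.1 ∈ M.enabled τ.1 ∧ 0 < M.δ τ.1 τ.2.1 τ.2.2}

/-- The number `|δ|` of nontrivial transitions. -/
def MDP.numTrans (M : MDP S Act AP) : ℕ := Nat.card M.Transition

/-- The pairs `(s, α)` with `α` enabled in `s`. -/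
def MDP.Choice (M : MDP S Act AP) : Type (max u v) :=
  {c : S × Act // c.2 ∈ M.enabled c.1}

/-- A (deterministic, history-dependent) scheduler: it maps every nonempty finite history
`s₀ … sₙ` to an action enabled in `sₙ`. -/
structure MDP.Scheduler (M : MDP S Act AP) where
  choose : (n : ℕ) → ((i : Finset.Iic n) → S) → Act
  choose_mem : ∀ n h, choose n h ∈ M.enabled (h ⟨n, Finset.mem_Iic.2 le_rfl⟩)

section Paths

variable [Fintype S] [MeasurableSpace S] [DiscreteMeasurableSpace S]

/-- The distribution of the next state, given the history. -/
def MDP.Scheduler.kernel {M : MDP S Act AP} (σ : M.Scheduler) (n : ℕ) :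
    Kernel ((i : Finset.Iic n) → S) S :=
  Kernel.ofFunOfCountable fun h =>
    (M.δ (h ⟨n, Finset.mem_Iic.2 le_rfl⟩) (σ.choose n h)).toMeasure

instance MDP.Scheduler.isMarkovKernel {M : MDP S Act AP} (σ : M.Scheduler) (n : ℕ) :
    IsMarkovKernel (σ.kernel n) :=
  ⟨fun h => by
    change IsProbabilityMeasure
      (M.δ (h ⟨n, Finset.mem_Iic.2 le_rfl⟩) (σ.choose n h)).toMeasure
    infer_instance⟩

/-- The probability measure `Pr_s^σ` on infinite paths that start in `s` (obtained from the
Ionescu-Tulcea theorem). -/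
def MDP.Scheduler.pathMeasure {M : MDP S Act AP} (σ : M.Scheduler) (s : S) :
    Measure (ℕ → S) :=
  Kernel.traj (X := fun _ => S) σ.kernel 0 fun _ => s

end Paths

/-! ### Path properties -/

/-- The paths that satisfy `a U_{≤ r} b`; a reward is earned upon leaving a state. -/
def MDP.untilLE (M : MDP S Act AP) (a b : AP) (r : ℝ) : Set (ℕ → S) :=
  {ω | ∃ k, b ∈ M.label (ω k) ∧ (∀ i < k, a ∈ M.label (ω i)) ∧
    ∑ i ∈ Finset.range k, (M.rew (ω i) : ℝ) ≤ r}

/-- The paths that satisfy `X (Z U Y)`. -/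
def nextUntil (Z Y : Set S) : Set (ℕ → S) :=
  {ω | ∃ k, ω (k + 1) ∈ Y ∧ ∀ i < k, ω (i + 1) ∈ Z}

/-! ### Probabilistic quantifiers and quantile queries -/

/-- Quantification over all schedulers, or over some scheduler. -/
inductive Mode
  | all
  | ex

inductive Cmp
  | lt
  | le
  | ge
  | gt

def Cmp.holds : Cmp → ℝ → ℝ → Prop
  | .lt, x, y => x < y
  | .le, x, y => x ≤ y
  | .ge, x, y => x ≥ y
  | .gt, x, y => x > y

/-- The negation of a comparison. -/
def Cmp.neg : Cmp → Cmp
  | .lt => .ge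
  | .le => .gt
  | .ge => .lt
  | .gt => .le

/-- A probabilistic quantifier `∀P_{⋈ p}` or `∃P_{⋈ p}`. -/
structure ProbQuant where
  mode : Mode
  cmp : Cmp
  bound : ℝ

/-- The quantifiers of qualitative queries are those with bound `0` or `1`. -/
def ProbQuant.Qualitative (Q : ProbQuant) : Prop := Q.bound = 0 ∨ Q.bound = 1

def allPos : ProbQuant := ⟨.all, .gt, 0⟩
def exPos : ProbQuant := ⟨.ex, .gt, 0⟩
/-- `∀P_{=1}`, that is, `∀P_{≥ 1}`. -/
def allOne : ProbQuant := ⟨.all, .ge, 1⟩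
/-- `∃P_{=1}`, that is, `∃P_{≥ 1}`. -/
def exOne : ProbQuant := ⟨.ex, .ge, 1⟩

/-- The dual quantifier: `∀P_{⋈ p}` is exchanged with `∃P` for the negated comparison. -/
def ProbQuant.dual (Q : ProbQuant) : ProbQuant :=
  match Q.mode with
  | .all => ⟨.ex, Q.cmp.neg, Q.bound⟩
  | .ex => ⟨.all, Q.cmp.neg, Q.bound⟩

section Queries

variable [Fintype S] [MeasurableSpace S] [DiscreteMeasurableSpace S]

/-- `s ⊨ Q ψ`, where `ψ` is given as the set of the paths that satisfy it. -/
def MDP.sat (M : MDP S Act AP) (Q : ProbQuant) (s : S) (ψ : Set (ℕ → S)) : Prop :=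
  match Q.mode with
  | .all => ∀ σ : M.Scheduler, Q.cmp.holds ((σ.pathMeasure s).real ψ) Q.bound
  | .ex => ∃ σ : M.Scheduler, Q.cmp.holds ((σ.pathMeasure s).real ψ) Q.bound

/-- The value of the state `s` with respect to the quantile query `Q (a U_{≤ ?} b)`:
an infimum if the comparison is `≥` or `>`, and a supremum otherwise, taken in `[-∞, ∞]`. -/
def MDP.val (M : MDP S Act AP) (Q : ProbQuant) (a b : AP) (s : S) : EReal :=
  match Q.cmp with
  | .ge | .gt => sInf ((fun r : ℝ => (r : EReal)) '' {r | M.sat Q s (M.untilLE a b r)})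
  | .lt | .le => sSup ((fun r : ℝ => (r : EReal)) '' {r | M.sat Q s (M.untilLE a b r)})

/-! ### The greedy algorithm -/

/-- The variables `v`, `X`, `R` of the greedy algorithm. -/
structure GreedyState (S : Type u) where
  v : S → EReal
  X : Set S
  R : Finset ℝ

open Classical in
def MDP.greedyStart (M : MDP S Act AP) (b : AP) : GreedyState S where
  v s := if b ∈ M.label s then 0 else ⊤
  X := {s | b ∈ M.label s}
  R := {0}

/-- The states that satisfy `a ∧ ¬ b` and have reward `0`. -/
def MDP.zeroStates (M : MDP S Act AP) (a b : AP) : Set S :=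
  {s | a ∈ M.label s ∧ b ∉ M.label s ∧ M.rew s = 0}

/-- The states discovered in the round that processes the value `r`: the states outside `X`
that satisfy `a ∧ Q X (Z U Y)`, where `Y = {s ∈ X | v s ≤ r} \ Z`. -/
def MDP.discovered (M : MDP S Act AP) (Q : ProbQuant) (a b : AP) (g : GreedyState S)
    (r : ℝ) : Set S :=
  {s | s ∉ g.X ∧ a ∈ M.label s ∧
    M.sat Q s (nextUntil (M.zeroStates a b)
      ({t | t ∈ g.X ∧ g.v t ≤ (r : EReal)} \ M.zeroStates a b))}

open Classical in
/-- One round of the main loop (nothing happens once `R` is empty). -/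
def MDP.greedyRound (M : MDP S Act AP) (Q : ProbQuant) (a b : AP) (g : GreedyState S) :
    GreedyState S :=
  if h : g.R.Nonempty then
    let r := g.R.min' h
    let N := M.discovered Q a b g r
    { v := fun s => if s ∈ N then ((r + M.rew s : ℝ) : EReal) else g.v s
      X := g.X ∪ N
      R := (g.R ∪ (Finset.univ.filter (· ∈ N)).image fun s => r + (M.rew s : ℝ)).erase r }
  else g

end Queries

/-! ### The machine model

A random access machine with a memory for natural numbers and a memory for real numbers, each
with registers and arrays. The only operations on real numbers are the constant `0`, copying,
addition and comparison. A program is a finite while-program over elementary instructions;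
every step of the machine executes at most one elementary instruction or test. -/

structure Store where
  nreg : ℕ → ℕ
  narr : ℕ → ℕ → ℕ
  rreg : ℕ → ℝ
  rarr : ℕ → ℕ → ℝ

/-- Elementary instructions. Arguments are names of registers and arrays, except the second
argument of `const`, which is a number. -/
inductive Instr
  /-- `x := k` -/
  | const (x k : ℕ)
  /-- `x := y` -/
  | copy (x y : ℕ)
  /-- `x := y + z` -/
  | add (x y z : ℕ)
  /-- `x := max (y - z) 0` -/
  | sub (x y z : ℕ)
  /-- `x := A[i]`, with `i` a register -/
  | load (x A i : ℕ)
  /-- `A[i] := x`, with `i` a register -/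
  | store (A i x : ℕ)
  /-- `x := 0` for a real register `x` -/
  | rzero (x : ℕ)
  /-- `x := y` for real registers -/
  | rcopy (x y : ℕ)
  /-- `x := y + z` for real registers -/
  | radd (x y z : ℕ)
  /-- `x := A[i]` for a real register `x`, a real array `A`, and a natural number register `i` -/
  | rload (x A i : ℕ)
  /-- `A[i] := x` for a real register `x`, a real array `A`, and a natural number register `i` -/
  | rstore (A i x : ℕ)

def setArr {α : Type} (f : ℕ → ℕ → α) (A i : ℕ) (y : α) : ℕ → ℕ → α :=
  Function.update f A (Function.update (f A) i y)

def Instr.exec : Instr → Store → Store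
  | .const x k, m => { m with nreg := Function.update m.nreg x k }
  | .copy x y, m => { m with nreg := Function.update m.nreg x (m.nreg y) }
  | .add x y z, m => { m with nreg := Function.update m.nreg x (m.nreg y + m.nreg z) }
  | .sub x y z, m => { m with nreg := Function.update m.nreg x (m.nreg y - m.nreg z) }
  | .load x A i, m => { m with nreg := Function.update m.nreg x (m.narr A (m.nreg i)) }
  | .store A i x, m => { m with narr := setArr m.narr A (m.nreg i) (m.nreg x) }
  | .rzero x, m => { m with rreg := Function.update m.rreg x 0 }
  | .rcopy x y, m => { m with rreg := Function.update m.rreg x (m.rreg y) }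
  | .radd x y z, m => { m with rreg := Function.update m.rreg x (m.rreg y + m.rreg z) }
  | .rload x A i, m => { m with rreg := Function.update m.rreg x (m.rarr A (m.nreg i)) }
  | .rstore A i x, m => { m with rarr := setArr m.rarr A (m.nreg i) (m.rreg x) }

/-- Elementary tests; the arguments are names of registers. -/
inductive Test
  | lt (x y : ℕ)
  | eq (x y : ℕ)
  | rle (x y : ℕ)

def Test.holds : Test → Store → Prop
  | .lt x y, m => m.nreg x < m.nreg y
  | .eq x y, m => m.nreg x = m.nreg y
  | .rle x y, m => m.rreg x ≤ m.rreg y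

inductive Prog
  | skip
  | instr (i : Instr)
  | seq (c d : Prog)
  | ite (t : Test) (c d : Prog)
  | loop (t : Test) (c : Prog)

/-- A configuration: the list of programs that remain to be executed, and the memory.
The machine has halted when the list is empty. -/
abbrev Config := List Prog × Store

open Classical in
/-- One step of the machine. -/
def step : Config → Config
  | ([], m) => ([], m)
  | (.skip :: K, m) => (K, m)
  | (.instr i :: K, m) => (K, i.exec m)
  | (.seq c d :: K, m) => (c :: d :: K, m)
  | (.ite t c d :: K, m) => (if t.holds m then c :: K else d :: K, m)
  | (.loop t c :: K, m) => (if t.holds m then c :: .loop t c :: K else K, m)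

/-- The configuration after `i` steps of the program `P` on the initial memory `m`. -/
def Prog.run (P : Prog) (m : Store) (i : ℕ) : Config := step^[i] ([P], m)

/-! ### Input and output of the machine -/

/-- A numbering of the states, of the pairs of a state and an enabled action, and of the
nontrivial transitions, in an arbitrary order. -/
structure MDP.Listing [Fintype S] (M : MDP S Act AP) where
  states : Fin (Fintype.card S) ≃ S
  choices : Fin (Nat.card M.Choice) ≃ M.Choice
  transitions : Fin M.numTrans ≃ M.Transition

/-- The array of length `n` with the entries `f`, followed by zeros. -/
def arrayOf {α : Type} [Zero α] {n : ℕ} (f : Fin n → α) : ℕ → α :=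
  fun i => if h : i < n then f ⟨i, h⟩ else 0

variable [Fintype S]

/-- The probability of the `j`-th transition. -/
def MDP.Listing.prob {M : MDP S Act AP} (E : M.Listing) (j : Fin M.numTrans) : ℝ :=
  (M.δ (E.transitions j).1.1 (E.transitions j).1.2.1 (E.transitions j).1.2.2).toReal

open Classical in
/-- The initial memory for an MDP and atomic propositions `a`, `b`, with a numbering. The
registers `0`, `1`, `2` hold the numbers of states, of choices and of transitions; the arrays
hold the labels `a` and `b` of every state (`0` or `1`), the state of every choice, the choice
and the target of every transition; the real arrays hold the reward of every state and the
probability of every transition. Everything else is zero. -/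
def MDP.Listing.input {M : MDP S Act AP} (E : M.Listing) (a b : AP) : Store where
  nreg
    | 0 => Fintype.card S
    | 1 => Nat.card M.Choice
    | 2 => M.numTrans
    | _ => 0
  narr
    | 0 => arrayOf fun i => if a ∈ M.label (E.states i) then 1 else 0
    | 1 => arrayOf fun i => if b ∈ M.label (E.states i) then 1 else 0
    | 2 => arrayOf fun c => (E.states.symm (E.choices c).1.1 : ℕ)
    | 3 => arrayOf fun j => (E.choices.symm
        ⟨((E.transitions j).1.1, (E.transitions j).1.2.1), (E.transitions j).2.1⟩ : ℕ)
    | 4 => arrayOf fun j => (E.states.symm (E.transitions j).1.2.2 : ℕ)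
    | _ => fun _ => 0
  rreg _ := 0
  rarr
    | 0 => arrayOf fun i => (M.rew (E.states i) : ℝ)
    | 1 => arrayOf E.prob
    | _ => fun _ => 0

/-- The value that the memory `m` holds for the `i`-th state: array `5` holds a tag that says
whether the value is finite (`0`), `∞` (`1`) or `-∞` (any other tag), and the real array `2`
holds the value if it is finite. -/
def Store.output (m : Store) (i : ℕ) : EReal :=
  match m.narr 5 i with
  | 0 => (m.rarr 2 i : EReal)
  | 1 => ⊤
  | _ => ⊥

/-- All natural numbers in the memory are at most `B`. -/
def Store.NatBounded (m : Store) (B : ℕ) : Prop :=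
  (∀ x, m.nreg x ≤ B) ∧ ∀ A i, m.narr A i ≤ B

/-- The length of the binary representation of a rational number. -/
def bitLen (q : ℚ) : ℕ := q.num.natAbs.size + q.den.size

/-- All real numbers in the memory are rational numbers of binary length at most `B`. -/
def Store.RatBounded (m : Store) (B : ℕ) : Prop :=
  (∀ x, ∃ q : ℚ, m.rreg x = q ∧ bitLen q ≤ B) ∧
    ∀ A i, ∃ q : ℚ, m.rarr A i = q ∧ bitLen q ≤ B

/-- The size of an input with rational rewards `ρ` and transition probabilities `π`: the number
of states and transitions plus the binary lengths of the numbers. -/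
def MDP.inputSize (M : MDP S Act AP) (ρ : S → ℚ) (π : Fin M.numTrans → ℚ) : ℕ :=
  Fintype.card S + M.numTrans + ∑ s, bitLen (ρ s) + ∑ j, bitLen (π j)

end QuantileMDP

end

open QuantileMDP

/-! Let Z be the set of states that satisfy `a`, violate `b` and have reward 0, and let Q be one of
the four basic quantifiers. Inside Z a path uses up nothing of the bound, so whether a state
satisfies the query with bound r is decided at the first state outside Z
(`sat_untilLE_iff_untilSet`). Its proof glues schedulers; finiteness of the state space turns
pointwise bounds on probabilities into uniform ones. Adding one step, a state with `a` and without
`b` satisfies the query with bound r iff it satisfies Q X (Z U Y), where Y consists of the states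
outside Z that satisfy the query with bound r minus the reward of the state
(`sat_untilLE_iff_nextUntil`).

This makes an argument in the style of Dijkstra possible. The set Y grows with the bound, and since
nonzero rewards are bounded away from 0, it changes only at values of discovered states
(`GreedyInv.exitStates_subset`). Processing the values in increasing order therefore assigns the
exact threshold to every discovered state (`GreedyInv.round`), and each round accounts for a new
value of some state, which limits the number of rounds. A query and its dual accept complementary
sets of bounds, so their values agree (`MDP.val_dual`). The remaining qualitative quantifiers hold
always or never.

Deciding Q X (Z U Y) is a problem on the transition graph. For positive probability the answer is an
attractor, a least fixed point. For probability 1 under all schedulers it is the complement of an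
attractor of failing states (`IsAttr.compl_eq_sat_allOne`). For probability 1 under some scheduler,
candidates are restricted again and again to those attracted by safe choices
(`MDP.sat_exOne_iff_candidates`), which costs the additional factor |S|. Almost sure reachability is
certified by ranks that decrease with positive probability (`pr_until_eq_one_of_rank`).

An attractor is computed in time linear in |δ| with counters, a stack and lists of incoming
transitions (`attr_spec`). The program logic `WP` tracks correctness, time and a memory invariant
together. Every computed real number is a sum of rewards with small multiplicities, whence the bound
on binary lengths (`bitLen_sum_le`). -/

noncomputable section

namespace QuantileMDP

/-! ### Path measures on cylinders. -/

section PathMeasure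

variable {S : Type u} {Act : Type v} {AP : Type w} {M : MDP S Act AP}

/-- The history of a path up to time `n`. -/
def hist (ω : ℕ → S) (n : ℕ) : (i : Finset.Iic n) → S := fun i => ω i

/-- The path `ω` preceded by the state `s`. -/
def scons (s : S) (ω : ℕ → S) : ℕ → S
  | 0 => s
  | n + 1 => ω n

@[simp] theorem scons_zero (s : S) (ω : ℕ → S) : scons s ω 0 = s := rfl

@[simp] theorem scons_succ (s : S) (ω : ℕ → S) (n : ℕ) : scons s ω (n + 1) = ω n := rfl

theorem scons_shift (ω : ℕ → S) : scons (ω 0) (fun n => ω (n + 1)) = ω := by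
  funext n; cases n <;> rfl

/-- Extend a history to a path, by repeating the last state. -/
def extendHist {n : ℕ} (h : (i : Finset.Iic n) → S) : ℕ → S :=
  fun i => h ⟨min i n, Finset.mem_Iic.2 (min_le_right _ _)⟩

theorem hist_extendHist {n : ℕ} (h : (i : Finset.Iic n) → S) : hist (extendHist h) n = h := by
  funext i
  have := Finset.mem_Iic.1 i.2
  simp [hist, extendHist, this]

theorem measurable_hist [MeasurableSpace S] (n : ℕ) : Measurable (fun x : ℕ → S => hist x n) :=
  measurable_pi_lambda _ fun _ => measurable_pi_apply _

theorem measurable_scons [MeasurableSpace S] (s : S) : Measurable (scons s) :=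
  measurable_pi_lambda _ fun n => by
    cases n
    · exact measurable_const
    · exact measurable_pi_apply _

variable [Fintype S] [MeasurableSpace S] [DiscreteMeasurableSpace S]

instance (σ : M.Scheduler) (s : S) : IsProbabilityMeasure (σ.pathMeasure s) := by
  unfold MDP.Scheduler.pathMeasure; infer_instance

/-- Under the map that appends a state, a single history pulls back to a rectangle, so the
composition integrates a multiple of the indicator of one shorter history. -/
theorem partialTraj_succ_singleton (σ : M.Scheduler) (n : ℕ) (x₀ : (i : Finset.Iic 0) → S)
    (ω : ℕ → S) :
    Kernel.partialTraj (X := fun _ => S) σ.kernel 0 (n + 1) x₀ {hist ω (n + 1)} =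
      Kernel.partialTraj (X := fun _ => S) σ.kernel 0 n x₀ {hist ω n} *
        M.δ (ω n) (σ.choose n (hist ω n)) (ω (n + 1)) := by
  have hpre : IicProdIoc (X := fun _ => S) n (n + 1) ⁻¹' {hist ω (n + 1)} =
      {hist ω n} ×ˢ {MeasurableEquiv.piSingleton (X := fun _ => S) n (ω (n + 1))} := by
    ext ⟨x, y⟩
    simp only [Set.mem_preimage, Set.mem_singleton_iff, Set.mem_prod]
    constructor
    · intro h
      constructor
      · funext i
        have hi := Finset.mem_Iic.1 i.2
        have := congrFun h ⟨i, Finset.mem_Iic.2 (hi.trans n.le_succ)⟩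
        simpa [IicProdIoc, hi, hist] using this
      · funext i
        have hi := Finset.mem_Ioc.1 i.2
        have := congrFun h ⟨i, Finset.mem_Iic.2 hi.2⟩
        obtain ⟨i, hi'⟩ := i
        obtain rfl : i = n + 1 := by simp at hi; omega
        simpa [IicProdIoc, hist, MeasurableEquiv.piSingleton] using this
    · rintro ⟨rfl, rfl⟩
      funext i
      obtain ⟨i, hi'⟩ := i
      have hi := Finset.mem_Iic.1 hi'
      rcases Nat.lt_or_ge n i with h | h
      · obtain rfl : i = n + 1 := by omega
        simp [IicProdIoc, hist, MeasurableEquiv.piSingleton]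
      · simp [IicProdIoc, hist, h]
  rw [Kernel.partialTraj_succ_of_le (Nat.zero_le n),
    Kernel.map_apply' _ (by fun_prop) _ (MeasurableSet.singleton _), hpre,
    Kernel.comp_apply' _ _ _ ((MeasurableSet.singleton _).prod (MeasurableSet.singleton _))]
  have h_int : ∀ z : (i : Finset.Iic n) → S,
      ((Kernel.id ×ₖ (σ.kernel n).map (MeasurableEquiv.piSingleton (X := fun _ => S) n)) z)
        ({hist ω n} ×ˢ {MeasurableEquiv.piSingleton (X := fun _ => S) n (ω (n + 1))}) =
      Set.indicator {hist ω n}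
        (fun _ => M.δ (ω n) (σ.choose n (hist ω n)) (ω (n + 1))) z := by
    intro z
    have : IsMarkovKernel ((σ.kernel n).map (MeasurableEquiv.piSingleton (X := fun _ => S) n)) :=
      Kernel.IsMarkovKernel.map _ (MeasurableEquiv.piSingleton n).measurable
    rw [Kernel.prod_apply, Measure.prod_prod, Kernel.id_apply,
      Measure.dirac_apply' _ (MeasurableSet.singleton _)]
    by_cases hz : z = hist ω n
    · subst hz
      rw [Kernel.map_apply' _ (MeasurableEquiv.measurable _) _ (MeasurableSet.singleton _)]
      have : (MeasurableEquiv.piSingleton (X := fun _ => S) n) ⁻¹'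
          {MeasurableEquiv.piSingleton (X := fun _ => S) n (ω (n + 1))} = {ω (n + 1)} := by
        ext y; simp
      rw [this]
      simp only [Set.mem_singleton_iff, Set.indicator_of_mem, Pi.one_apply, one_mul]
      change (M.δ _ (σ.choose n (hist ω n))).toMeasure {ω (n + 1)} = _
      rw [PMF.toMeasure_apply_singleton _ _ (MeasurableSet.singleton _)]
      rfl
    · simp [hz]
  simp_rw [h_int]
  rw [lintegral_indicator (MeasurableSet.singleton _)]
  simp [mul_comm]

theorem partialTraj_singleton (σ : M.Scheduler) (n : ℕ) (s : S) (ω : ℕ → S) (h0 : ω 0 = s) :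
    Kernel.partialTraj (X := fun _ => S) σ.kernel 0 n (fun _ => s) {hist ω n} =
      ∏ i ∈ Finset.range n, M.δ (ω i) (σ.choose i (hist ω i)) (ω (i + 1)) := by
  induction n with
  | zero =>
    rw [Kernel.partialTraj_self, Kernel.id_apply, Measure.dirac_apply' _ (MeasurableSet.singleton _)]
    have : (fun _ => s : (i : Finset.Iic 0) → S) = hist ω 0 := by
      funext i
      have := Finset.mem_Iic.1 i.2
      have hi : (i : ℕ) = 0 := by omega
      simp [hist, hi, h0]
    simp [this]
  | succ n ih => rw [partialTraj_succ_singleton, ih, Finset.prod_range_succ]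

theorem partialTraj_singleton_ne (σ : M.Scheduler) (n : ℕ) (s : S) (ω : ℕ → S) (h0 : ω 0 ≠ s) :
    Kernel.partialTraj (X := fun _ => S) σ.kernel 0 n (fun _ => s) {hist ω n} = 0 := by
  induction n with
  | zero =>
    rw [Kernel.partialTraj_self, Kernel.id_apply, Measure.dirac_apply' _ (MeasurableSet.singleton _)]
    have : (fun _ => s : (i : Finset.Iic 0) → S) ≠ hist ω 0 := by
      intro h
      exact h0 (congrFun h ⟨0, by simp⟩).symm
    simp [this]
  | succ n ih => rw [partialTraj_succ_singleton, ih, zero_mul]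

/-- Together with `pathMeasure_cylinder_ne` and `pathMeasure_ext`, this product formula
characterizes the path measure. -/
theorem pathMeasure_cylinder (σ : M.Scheduler) (s : S) (n : ℕ) (ω : ℕ → S) (h0 : ω 0 = s) :
    (σ.pathMeasure s).map (fun x => hist x n) {hist ω n} =
      ∏ i ∈ Finset.range n, M.δ (ω i) (σ.choose i (hist ω i)) (ω (i + 1)) := by
  rw [← partialTraj_singleton σ n s ω h0, ← Kernel.traj_map_frestrictLe_apply]
  rfl

theorem pathMeasure_cylinder_ne (σ : M.Scheduler) (s : S) (n : ℕ) (ω : ℕ → S) (h0 : ω 0 ≠ s) :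
    (σ.pathMeasure s).map (fun x => hist x n) {hist ω n} = 0 := by
  rw [← partialTraj_singleton_ne σ n s ω h0, ← Kernel.traj_map_frestrictLe_apply]
  rfl

/-- Finite measures on paths that agree on cylinders are equal. -/
theorem pathMeasure_ext {μ ν : Measure (ℕ → S)} [IsFiniteMeasure μ] [IsFiniteMeasure ν]
    (h : ∀ n (ω : ℕ → S), μ.map (fun x => hist x n) {hist ω n} =
      ν.map (fun x => hist x n) {hist ω n}) : μ = ν := by
  -- Both measures turn out to be projective limits of the marginals of `ν`. On the natural numbers
  -- initial segments suffice, and there singletons determine a measure.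
  have hν : IsProjectiveLimit (α := fun _ : ℕ => S) ν
      (fun I : Finset ℕ => ν.map I.restrict) := fun I => rfl
  refine IsProjectiveLimit.unique (α := fun _ : ℕ => S)
    (P := fun I : Finset ℕ => ν.map I.restrict) ?_ hν
  rw [isProjectiveLimit_nat_iff]
  · intro n
    refine Measure.ext_of_singleton fun x => ?_
    have := h n (extendHist x)
    rw [hist_extendHist] at this
    exact this
  · intro I J hJI
    rw [Measure.map_map (by fun_prop) (by fun_prop)]
    rfl

/-- The path measure depends only on the choices for histories that start in `s`. -/
theorem pathMeasure_congr {σ σ' : M.Scheduler} {s : S}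
    (h : ∀ n (ω : ℕ → S), ω 0 = s → σ.choose n (hist ω n) = σ'.choose n (hist ω n)) :
    σ.pathMeasure s = σ'.pathMeasure s := by
  refine pathMeasure_ext fun n ω => ?_
  by_cases h0 : ω 0 = s
  · rw [pathMeasure_cylinder _ _ _ _ h0, pathMeasure_cylinder _ _ _ _ h0]
    exact Finset.prod_congr rfl fun i _ => by rw [h i ω h0]
  · rw [pathMeasure_cylinder_ne _ _ _ _ h0, pathMeasure_cylinder_ne _ _ _ _ h0]

end PathMeasure

/-! ### Shifting, prefixing and gluing schedulers. -/

section Schedulers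

variable {S : Type u} {Act : Type v} {AP : Type w} {M : MDP S Act AP}

theorem hist_eq_hist {ω ω' : ℕ → S} {n : ℕ} : hist ω n = hist ω' n ↔ ∀ i ≤ n, ω i = ω' i :=
  ⟨fun h i hi => congrFun h ⟨i, Finset.mem_Iic.2 hi⟩,
    fun h => funext fun i => h i (Finset.mem_Iic.1 i.2)⟩

theorem extendHist_of_le {n i : ℕ} (h : (i : Finset.Iic n) → S) (hi : i ≤ n) :
    extendHist h i = h ⟨i, Finset.mem_Iic.2 hi⟩ := by
  simp [extendHist, hi]

theorem extendHist_hist {n i : ℕ} (ω : ℕ → S) (hi : i ≤ n) : extendHist (hist ω n) i = ω i := by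
  rw [extendHist_of_le _ hi]; rfl

theorem hist_scons_extendHist (s : S) (ω : ℕ → S) (n : ℕ) :
    hist (scons s (extendHist (hist ω n))) (n + 1) = hist (scons s ω) (n + 1) := by
  rw [hist_eq_hist]
  rintro (_ | i) hi
  · rfl
  · exact extendHist_hist ω (by omega)

namespace MDP.Scheduler

/-- The action chosen in the initial state. -/
def first (σ : M.Scheduler) (s : S) : Act := σ.choose 0 fun _ => s

theorem first_mem (σ : M.Scheduler) (s : S) : σ.first s ∈ M.enabled s := σ.choose_mem 0 _

theorem choose_zero (σ : M.Scheduler) (ω : ℕ → S) : σ.choose 0 (hist ω 0) = σ.first (ω 0) := by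
  have : hist ω 0 = fun _ => ω 0 := by
    funext i
    have := Finset.mem_Iic.1 i.2
    simp [hist, show (i : ℕ) = 0 by omega]
  rw [this]; rfl

/-- The scheduler that remains after the first step from `s`. -/
def tail (σ : M.Scheduler) (s : S) : M.Scheduler where
  choose n h := σ.choose (n + 1) (hist (scons s (extendHist h)) (n + 1))
  choose_mem n h := by
    convert σ.choose_mem (n + 1) (hist (scons s (extendHist h)) (n + 1)) using 2
    exact (extendHist_of_le h le_rfl).symm

theorem tail_choose (σ : M.Scheduler) (s : S) (ω : ℕ → S) (n : ℕ) :
    (σ.tail s).choose n (hist ω n) = σ.choose (n + 1) (hist (scons s ω) (n + 1)) := by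
  rw [← hist_scons_extendHist]; rfl

end MDP.Scheduler

/-- Some enabled action. -/
def MDP.anyAct (M : MDP S Act AP) (s : S) : Act := (M.enabled_nonempty s).choose

theorem MDP.anyAct_mem (M : MDP S Act AP) (s : S) : M.anyAct s ∈ M.enabled s :=
  (M.enabled_nonempty s).choose_spec

/-- The scheduler that follows the enabled actions `f`. -/
def MDP.memoryless (M : MDP S Act AP) (f : S → Act) (hf : ∀ s, f s ∈ M.enabled s) :
    M.Scheduler where
  choose n h := f (h ⟨n, Finset.mem_Iic.2 le_rfl⟩)
  choose_mem _ _ := hf _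

theorem MDP.memoryless_choose (f : S → Act) (hf : ∀ s, f s ∈ M.enabled s) (ω : ℕ → S) (n : ℕ) :
    (M.memoryless f hf).choose n (hist ω n) = f (ω n) := rfl

open Classical in
/-- The scheduler that first chooses `α` (if enabled) and then follows `τ t` from the next
state `t`. -/
def MDP.Scheduler.cons (α : Act) (τ : S → M.Scheduler) : M.Scheduler where
  choose
    | 0, h => if α ∈ M.enabled (h ⟨0, Finset.mem_Iic.2 le_rfl⟩) then α
        else M.anyAct (h ⟨0, Finset.mem_Iic.2 le_rfl⟩)
    | n + 1, h => (τ (extendHist h 1)).choose n (hist (fun i => extendHist h (i + 1)) n)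
  choose_mem n h := by
    rcases n with _ | n
    · dsimp only
      split_ifs with hα
      · exact hα
      · exact M.anyAct_mem _
    · convert (τ (extendHist h 1)).choose_mem n _ using 2
      exact (extendHist_of_le h le_rfl).symm

theorem MDP.Scheduler.cons_first {α : Act} (τ : S → M.Scheduler) {s : S} (h : α ∈ M.enabled s) :
    (cons α τ).first s = α := by
  simp [MDP.Scheduler.first, cons, h]

theorem MDP.Scheduler.cons_choose_succ (α : Act) (τ : S → M.Scheduler) (ω : ℕ → S) (n : ℕ) :
    (cons α τ).choose (n + 1) (hist ω (n + 1)) = (τ (ω 1)).choose n (hist (fun i => ω (i + 1)) n) := by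
  have h1 : extendHist (hist ω (n + 1)) 1 = ω 1 := extendHist_hist ω (by omega)
  have h2 : hist (fun i => extendHist (hist ω (n + 1)) (i + 1)) n =
      hist (fun i => ω (i + 1)) n :=
    hist_eq_hist.2 fun i hi => extendHist_hist ω (by omega)
  simp only [cons, h1, h2]

open Classical in
/-- The choices of the scheduler that follows `σ` inside `Z`, and `τ t` from the first state `t`
outside `Z`. -/
def MDP.glueChoose (Z : Set S) (τ : S → M.Scheduler) :
    ℕ → M.Scheduler → (ℕ → S) → Act
  | 0, σ, ω => if ω 0 ∈ Z then σ.first (ω 0) else (τ (ω 0)).first (ω 0)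
  | n + 1, σ, ω => if ω 0 ∈ Z then glueChoose Z τ n (σ.tail (ω 0)) (fun i => ω (i + 1))
      else (τ (ω 0)).choose (n + 1) (hist ω (n + 1))

theorem MDP.glueChoose_mem (Z : Set S) (τ : S → M.Scheduler) (n : ℕ) (σ : M.Scheduler)
    (ω : ℕ → S) : M.glueChoose Z τ n σ ω ∈ M.enabled (ω n) := by
  induction n generalizing σ ω with
  | zero =>
    unfold glueChoose
    split_ifs
    · exact σ.first_mem _
    · exact (τ _).first_mem _
  | succ n ih =>
    unfold glueChoose
    split_ifs
    · exact ih _ _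
    · exact (τ _).choose_mem _ _

/-- The choice at time `n` looks at the first `n + 1` states only, so the padding by `extendHist` in
`glue` is irrelevant. -/
theorem MDP.glueChoose_congr (Z : Set S) (τ : S → M.Scheduler) (n : ℕ) (σ : M.Scheduler)
    {ω ω' : ℕ → S} (h : ∀ i ≤ n, ω i = ω' i) :
    M.glueChoose Z τ n σ ω = M.glueChoose Z τ n σ ω' := by
  induction n generalizing σ ω ω' with
  | zero =>
    unfold glueChoose
    rw [h 0 le_rfl]
  | succ n ih =>
    unfold glueChoose
    rw [h 0 (Nat.zero_le _), hist_eq_hist.2 h, ih _ (fun i hi => h (i + 1) (by omega))]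

/-- The scheduler that follows `σ` inside `Z`, and `τ t` from the first state `t` outside `Z`. -/
def MDP.Scheduler.glue (Z : Set S) (τ : S → M.Scheduler) (σ : M.Scheduler) : M.Scheduler where
  choose n h := M.glueChoose Z τ n σ (extendHist h)
  choose_mem n h := by
    convert M.glueChoose_mem Z τ n σ (extendHist h) using 2
    exact (extendHist_of_le h le_rfl).symm

theorem MDP.Scheduler.glue_choose (Z : Set S) (τ : S → M.Scheduler) (σ : M.Scheduler)
    (ω : ℕ → S) (n : ℕ) : (glue Z τ σ).choose n (hist ω n) = M.glueChoose Z τ n σ ω :=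
  M.glueChoose_congr Z τ n σ fun _ hi => extendHist_hist ω hi

theorem MDP.Scheduler.glue_first {Z : Set S} (τ : S → M.Scheduler) (σ : M.Scheduler)
    {t : S} (ht : t ∈ Z) : (glue Z τ σ).first t = σ.first t := by
  have := glue_choose Z τ σ (fun _ => t) 0
  rw [choose_zero] at this
  simpa [MDP.glueChoose, ht] using this

theorem MDP.sum_δ [Fintype S] (M : MDP S Act AP) (s : S) (α : Act) : ∑ t, M.δ s α t = 1 := by
  rw [← tsum_fintype (L := .unconditional S)]; exact (M.δ s α).tsum_coe

/-- The transition probabilities as real numbers. -/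
def MDP.p (M : MDP S Act AP) (s : S) (α : Act) (t : S) : ℝ := (M.δ s α t).toReal

theorem MDP.p_nonneg (M : MDP S Act AP) (s : S) (α : Act) (t : S) : 0 ≤ M.p s α t :=
  ENNReal.toReal_nonneg

theorem MDP.p_pos (M : MDP S Act AP) {s : S} {α : Act} {t : S} : 0 < M.p s α t ↔ 0 < M.δ s α t := by
  unfold p
  rw [ENNReal.toReal_pos_iff]
  exact and_iff_left ((M.δ s α).apply_lt_top t)

theorem MDP.sum_p [Fintype S] (M : MDP S Act AP) (s : S) (α : Act) : ∑ t, M.p s α t = 1 := by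
  unfold p
  rw [← ENNReal.toReal_sum fun t _ => (M.δ s α).apply_ne_top t, M.sum_δ]
  simp

variable [Fintype S] [MeasurableSpace S] [DiscreteMeasurableSpace S]

/-- Compare both sides on cylinders: the factor of the first transition splits off, the other
factors belong to `σ.tail s`, and of all successors only the second state of the cylinder
contributes. Later probabilities are computed from this decomposition, through `pr_step`, and from
limits of finite horizons. -/
theorem MDP.Scheduler.pathMeasure_step (σ : M.Scheduler) (s : S) :
    σ.pathMeasure s =
      ∑ t, M.δ s (σ.first s) t • ((σ.tail s).pathMeasure t).map (scons s) := by
  have hmap : ∀ t, IsProbabilityMeasure (((σ.tail s).pathMeasure t).map (scons s)) := fun t =>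
    Measure.isProbabilityMeasure_map (measurable_scons s).aemeasurable
  have hfin : IsFiniteMeasure
      (∑ t, M.δ s (σ.first s) t • ((σ.tail s).pathMeasure t).map (scons s)) := by
    refine ⟨?_⟩
    simp [M.sum_δ]
  refine pathMeasure_ext fun n ω => ?_
  have hR : (Measure.map (fun x => hist x n)
      (∑ t, M.δ s (σ.first s) t • ((σ.tail s).pathMeasure t).map (scons s))) {hist ω n} =
      ∑ t, M.δ s (σ.first s) t *
        (σ.tail s).pathMeasure t {x | hist (scons s x) n = hist ω n} := by
    rw [Measure.map_apply (measurable_hist n) (MeasurableSet.singleton _)]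
    simp only [Measure.coe_finsetSum, Finset.sum_apply, Measure.smul_apply, smul_eq_mul]
    refine Finset.sum_congr rfl fun t _ => ?_
    rw [Measure.map_apply (measurable_scons s)
      (measurable_hist n (MeasurableSet.singleton _))]
    rfl
  rw [hR]
  by_cases h0 : ω 0 = s
  · rw [pathMeasure_cylinder _ _ _ _ h0]
    rcases n with _ | n
    · have : {x | hist (scons s x) 0 = hist ω 0} = Set.univ := by
        ext x
        simp [hist_eq_hist, h0]
      simp [this, M.sum_δ]
    · have hset : {x | hist (scons s x) (n + 1) = hist ω (n + 1)} =
          (fun x => hist x n) ⁻¹' {hist (fun i => ω (i + 1)) n} := by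
        ext x
        simp only [Set.mem_ofPred_eq, Set.mem_preimage, Set.mem_singleton_iff, hist_eq_hist]
        constructor
        · intro h i hi
          exact h (i + 1) (by omega)
        · rintro h (_ | i) hi
          · exact h0.symm
          · exact h i (by omega)
      have hterm : ∀ t, (σ.tail s).pathMeasure t {x | hist (scons s x) (n + 1) = hist ω (n + 1)} =
          ((σ.tail s).pathMeasure t).map (fun x => hist x n) {hist (fun i => ω (i + 1)) n} := by
        intro t
        rw [hset, Measure.map_apply (measurable_hist n) (MeasurableSet.singleton _)]
      simp_rw [hterm]
      rw [Finset.sum_eq_single (ω 1)]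
      · rw [pathMeasure_cylinder _ (ω 1) n (fun i => ω (i + 1)) rfl, Finset.prod_range_succ', mul_comm, choose_zero, h0]
        congr 1
        refine Finset.prod_congr rfl fun i _ => ?_
        rw [tail_choose, ← h0, scons_shift]
      · intro t _ ht
        rw [pathMeasure_cylinder_ne _ _ _ _ (Ne.symm ht), mul_zero]
      · simp
  · rw [pathMeasure_cylinder_ne _ _ _ _ h0]
    symm
    refine Finset.sum_eq_zero fun t _ => ?_
    have : {x | hist (scons s x) n = hist ω n} = ∅ := by
      ext x
      simp only [Set.mem_ofPred_eq, Set.mem_empty_iff_false, iff_false, hist_eq_hist]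
      intro h
      exact h0 (h 0 (Nat.zero_le _)).symm
    simp [this]

/-- The probability of the set `A` of paths. -/
def MDP.Scheduler.pr (σ : M.Scheduler) (s : S) (A : Set (ℕ → S)) : ℝ := (σ.pathMeasure s).real A

theorem MDP.Scheduler.pr_step (σ : M.Scheduler) (s : S) {A : Set (ℕ → S)} (hA : MeasurableSet A) :
    σ.pr s A = ∑ t, M.p s (σ.first s) t * (σ.tail s).pr t {ω | scons s ω ∈ A} := by
  unfold pr Measure.real MDP.p
  rw [pathMeasure_step]
  simp only [Measure.coe_finsetSum, Finset.sum_apply, Measure.smul_apply, smul_eq_mul]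
  rw [ENNReal.toReal_sum]
  · refine Finset.sum_congr rfl fun t _ => ?_
    rw [ENNReal.toReal_mul, Measure.map_apply (measurable_scons s) hA]
    rfl
  · intro t _
    refine ENNReal.mul_ne_top ((M.δ s _).apply_ne_top t) ?_
    rw [Measure.map_apply (measurable_scons s) hA]
    exact measure_ne_top _ _

theorem MDP.Scheduler.pr_nonneg (σ : M.Scheduler) (s : S) (A : Set (ℕ → S)) : 0 ≤ σ.pr s A :=
  measureReal_nonneg

theorem MDP.Scheduler.pr_le_one (σ : M.Scheduler) (s : S) (A : Set (ℕ → S)) : σ.pr s A ≤ 1 :=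
  measureReal_le_one

theorem MDP.Scheduler.pr_mono (σ : M.Scheduler) (s : S) {A B : Set (ℕ → S)} (h : A ⊆ B) :
    σ.pr s A ≤ σ.pr s B := measureReal_mono h

theorem MDP.Scheduler.pr_congr {σ σ' : M.Scheduler} {s : S} (A : Set (ℕ → S))
    (h : ∀ n (ω : ℕ → S), ω 0 = s → σ.choose n (hist ω n) = σ'.choose n (hist ω n)) :
    σ.pr s A = σ'.pr s A := by
  unfold pr; rw [pathMeasure_congr h]

theorem MDP.Scheduler.pr_iUnion (σ : M.Scheduler) (s : S) {A : ℕ → Set (ℕ → S)}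
    (h : Monotone A) :
    Filter.Tendsto (fun k => σ.pr s (A k)) Filter.atTop (nhds (σ.pr s (⋃ k, A k))) :=
  (ENNReal.tendsto_toReal (measure_ne_top _ _)).comp (tendsto_measure_iUnion_atTop h)

theorem MDP.Scheduler.pr_cons_tail {α : Act} (τ : S → M.Scheduler) (s t : S)
    (A : Set (ℕ → S)) : ((cons α τ).tail s).pr t A = (τ t).pr t A := by
  refine pr_congr A fun n ω h0 => ?_
  rw [tail_choose, cons_choose_succ]
  simp [h0]

theorem MDP.Scheduler.pr_memoryless_tail (f : S → Act) (hf : ∀ s, f s ∈ M.enabled s) (s t : S)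
    (A : Set (ℕ → S)) : ((M.memoryless f hf).tail s).pr t A = (M.memoryless f hf).pr t A := by
  refine pr_congr A fun n ω h0 => ?_
  rw [tail_choose, memoryless_choose, memoryless_choose]
  rfl

theorem MDP.Scheduler.pr_glue_of_notMem {Z : Set S} (τ : S → M.Scheduler) (σ : M.Scheduler)
    {t : S} (ht : t ∉ Z) (A : Set (ℕ → S)) : (glue Z τ σ).pr t A = (τ t).pr t A := by
  refine pr_congr A fun n ω h0 => ?_
  rw [glue_choose]
  cases n <;> simp [MDP.glueChoose, h0, ht, choose_zero]

/-- One step inside `Z` leaves a glued scheduler again, with `σ` replaced by its tail; inductions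
over the horizon therefore generalize `σ`. -/
theorem MDP.Scheduler.pr_glue_tail {Z : Set S} (τ : S → M.Scheduler) (σ : M.Scheduler)
    {s : S} (hs : s ∈ Z) (t : S) (A : Set (ℕ → S)) :
    ((glue Z τ σ).tail s).pr t A = (glue Z τ (σ.tail s)).pr t A := by
  refine pr_congr A fun n ω h0 => ?_
  rw [tail_choose, glue_choose, glue_choose]
  simp [MDP.glueChoose, hs]

end Schedulers

/-! ### Reachability with memory, for finite and infinite horizons. -/

section Reachability

variable {S : Type u} {Act : Type v} {AP : Type w} {M : MDP S Act AP} {K : Type*}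

/-- The paths that, started with the memory content `κ`, reach a winning pair of a memory content
and a state within `n` steps, through pairs that allow to go on. -/
def reachWithin (win go : K → S → Prop) (upd : K → S → K) : ℕ → K → Set (ℕ → S)
  | 0, κ => {ω | win κ (ω 0)}
  | n + 1, κ => {ω | win κ (ω 0) ∨
      go κ (ω 0) ∧ (fun i => ω (i + 1)) ∈ reachWithin win go upd n (upd κ (ω 0))}

/-- The paths that reach a winning pair. -/
def reach (win go : K → S → Prop) (upd : K → S → K) (κ : K) : Set (ℕ → S) :=
  ⋃ n, reachWithin win go upd n κ

variable {win go : K → S → Prop} {upd : K → S → K}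

theorem reachWithin_subset_succ (n : ℕ) (κ : K) :
    reachWithin win go upd n κ ⊆ reachWithin win go upd (n + 1) κ := by
  induction n generalizing κ with
  | zero => exact fun ω h => Or.inl h
  | succ n ih => exact fun ω h => h.imp id fun h' => ⟨h'.1, ih _ h'.2⟩

theorem reachWithin_mono (κ : K) : Monotone fun n => reachWithin win go upd n κ :=
  monotone_nat_of_le_succ fun n => reachWithin_subset_succ n κ

theorem scons_mem_reachWithin {n : ℕ} {κ : K} {s : S} {ω : ℕ → S} :
    scons s ω ∈ reachWithin win go upd (n + 1) κ ↔
      win κ s ∨ go κ s ∧ ω ∈ reachWithin win go upd n (upd κ s) := Iff.rfl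

theorem scons_mem_reach {κ : K} {s : S} {ω : ℕ → S} :
    scons s ω ∈ reach win go upd κ ↔ win κ s ∨ go κ s ∧ ω ∈ reach win go upd (upd κ s) := by
  simp only [reach, Set.mem_iUnion]
  constructor
  · rintro ⟨n, hn⟩
    rcases scons_mem_reachWithin.1 (reachWithin_subset_succ n κ hn) with h | h
    · exact Or.inl h
    · exact Or.inr ⟨h.1, n, h.2⟩
  · rintro (h | ⟨h, n, hn⟩)
    · exact ⟨0, h⟩
    · exact ⟨n + 1, Or.inr ⟨h, hn⟩⟩

variable [Fintype S] [MeasurableSpace S] [DiscreteMeasurableSpace S]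

theorem measurableSet_reachWithin (n : ℕ) (κ : K) :
    MeasurableSet (reachWithin win go upd n κ) := by
  induction n generalizing κ with
  | zero => exact measurable_pi_apply 0 (MeasurableSet.of_discrete (s := {s | win κ s}))
  | succ n ih =>
    -- The updated memory depends on the first state; splitting by the finitely many first states
    -- makes it constant on each piece.
    have : reachWithin win go upd (n + 1) κ = ((fun ω : ℕ → S => ω 0) ⁻¹' {s | win κ s}) ∪
        ⋃ s : S, ((fun ω : ℕ → S => ω 0) ⁻¹' {t | t = s ∧ go κ s}) ∩
          (fun (ω : ℕ → S) i => ω (i + 1)) ⁻¹' reachWithin win go upd n (upd κ s) := by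
      ext ω
      simp [reachWithin]
    rw [this]
    refine (measurable_pi_apply 0 .of_discrete).union (MeasurableSet.iUnion fun s => ?_)
    refine (measurable_pi_apply 0 .of_discrete).inter ?_
    exact measurable_pi_lambda _ (fun i => measurable_pi_apply _) (ih _)

theorem measurableSet_reach (κ : K) : MeasurableSet (reach win go upd κ) :=
  MeasurableSet.iUnion fun n => measurableSet_reachWithin n κ

namespace MDP.Scheduler

theorem pr_univ (σ : M.Scheduler) (s : S) : σ.pr s Set.univ = 1 := by simp [pr]

theorem pr_empty (σ : M.Scheduler) (s : S) : σ.pr s ∅ = 0 := by simp [pr]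

theorem pr_reachWithin_zero (σ : M.Scheduler) {κ : K} {s : S} (h : ¬ win κ s) :
    σ.pr s (reachWithin win go upd 0 κ) = 0 := by
  rw [σ.pr_step s (measurableSet_reachWithin 0 κ)]
  have : {ω | scons s ω ∈ reachWithin win go upd 0 κ} = ∅ := by
    ext ω; simp [reachWithin, h]
  simp [this, pr_empty]

theorem pr_reachWithin_win (σ : M.Scheduler) (n : ℕ) {κ : K} {s : S} (h : win κ s) :
    σ.pr s (reachWithin win go upd n κ) = 1 := by
  rw [σ.pr_step s (measurableSet_reachWithin n κ)]
  have : {ω | scons s ω ∈ reachWithin win go upd n κ} = Set.univ := by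
    ext ω; cases n <;> simp [reachWithin, h]
  simp [this, pr_univ, M.sum_p]

theorem pr_reach_win (σ : M.Scheduler) {κ : K} {s : S} (h : win κ s) :
    σ.pr s (reach win go upd κ) = 1 :=
  le_antisymm (σ.pr_le_one _ _) ((σ.pr_reachWithin_win 0 h).symm.le.trans
    (σ.pr_mono s (Set.subset_iUnion (fun n => reachWithin win go upd n κ) 0)))

theorem pr_reachWithin_succ (σ : M.Scheduler) (n : ℕ) {κ : K} {s : S} (h : ¬ win κ s)
    (h' : go κ s) :
    σ.pr s (reachWithin win go upd (n + 1) κ) =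
      ∑ t, M.p s (σ.first s) t * (σ.tail s).pr t (reachWithin win go upd n (upd κ s)) := by
  rw [σ.pr_step s (measurableSet_reachWithin (n + 1) κ)]
  have : {ω | scons s ω ∈ reachWithin win go upd (n + 1) κ} =
      reachWithin win go upd n (upd κ s) := by
    ext ω; simp [scons_mem_reachWithin, h, h']
  rw [this]

theorem pr_reach_step (σ : M.Scheduler) {κ : K} {s : S} (h : ¬ win κ s) (h' : go κ s) :
    σ.pr s (reach win go upd κ) =
      ∑ t, M.p s (σ.first s) t * (σ.tail s).pr t (reach win go upd (upd κ s)) := by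
  rw [σ.pr_step s (measurableSet_reach κ)]
  have : {ω | scons s ω ∈ reach win go upd κ} = reach win go upd (upd κ s) := by
    ext ω; simp [scons_mem_reach, h, h']
  rw [this]

theorem pr_reach_lose (σ : M.Scheduler) {κ : K} {s : S} (h : ¬ win κ s) (h' : ¬ go κ s) :
    σ.pr s (reach win go upd κ) = 0 := by
  rw [σ.pr_step s (measurableSet_reach κ)]
  have : {ω | scons s ω ∈ reach win go upd κ} = ∅ := by
    ext ω; simp [scons_mem_reach, h, h']
  simp [this, pr_empty]

theorem pr_reachWithin_le (σ : M.Scheduler) (n : ℕ) (κ : K) (s : S) :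
    σ.pr s (reachWithin win go upd n κ) ≤ σ.pr s (reach win go upd κ) :=
  σ.pr_mono s (Set.subset_iUnion (fun n => reachWithin win go upd n κ) n)

/-- Continuity from below: the event is the increasing union of its finite horizons. Statements
about infinite paths thus become inductions on the number of steps. -/
theorem pr_reach_le (σ : M.Scheduler) {κ : K} {s : S} {c : ℝ}
    (h : ∀ n, σ.pr s (reachWithin win go upd n κ) ≤ c) : σ.pr s (reach win go upd κ) ≤ c :=
  le_of_tendsto' (σ.pr_iUnion s (reachWithin_mono κ)) h

theorem exists_pr_reachWithin_pos (σ : M.Scheduler) {κ : K} {s : S}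
    (h : 0 < σ.pr s (reach win go upd κ)) : ∃ n, 0 < σ.pr s (reachWithin win go upd n κ) := by
  by_contra! hn
  exact absurd (σ.pr_reach_le hn) (not_le.2 h)

end MDP.Scheduler

end Reachability

/-! ### Averages over successors. -/

section ConvexCombination

variable {S : Type u} {Act : Type v} {AP : Type w} [Fintype S] (M : MDP S Act AP)

/-- Positivity of an average depends only on the support of the distribution. With `sum_p_eq_one`
this is why qualitative queries ignore the sizes of the probabilities. -/
theorem MDP.sum_p_pos {s : S} {α : Act} {x : S → ℝ} (hx : ∀ t, 0 ≤ x t) :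
    0 < ∑ t, M.p s α t * x t ↔ ∃ t, 0 < M.δ s α t ∧ 0 < x t := by
  rw [Finset.sum_pos_iff_of_nonneg fun t _ => mul_nonneg (M.p_nonneg s α t) (hx t)]
  simp only [Finset.mem_univ, true_and, ← M.p_pos]
  refine exists_congr fun t => ⟨fun h => ?_, fun h => mul_pos h.1 h.2⟩
  have h1 : M.p s α t ≠ 0 := fun h0 => by simp [h0] at h
  have h2 : x t ≠ 0 := fun h0 => by simp [h0] at h
  exact ⟨lt_of_le_of_ne (M.p_nonneg _ _ _) h1.symm, lt_of_le_of_ne (hx t) h2.symm⟩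

/-- Apply `sum_p_pos` to the deficits `1 - x t`: the average reaches 1 when no successor has a
deficit. -/
theorem MDP.sum_p_eq_one {s : S} {α : Act} {x : S → ℝ} (hx : ∀ t, x t ≤ 1) :
    1 ≤ ∑ t, M.p s α t * x t ↔ ∀ t, 0 < M.δ s α t → 1 ≤ x t := by
  have h := (M.sum_p_pos (s := s) (α := α) (x := fun t => 1 - x t)
    (fun t => sub_nonneg.2 (hx t))).not
  have hs : ∑ t, M.p s α t * (1 - x t) = 1 - ∑ t, M.p s α t * x t := by
    simp [mul_sub, M.sum_p]
  rw [hs] at h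
  push Not at h
  simpa using h

theorem MDP.sum_p_le_sum_p {s : S} {α : Act} {x y : S → ℝ}
    (h : ∀ t, 0 < M.δ s α t → x t ≤ y t) :
    ∑ t, M.p s α t * x t ≤ ∑ t, M.p s α t * y t := by
  refine Finset.sum_le_sum fun t _ => ?_
  rcases (M.p_nonneg s α t).eq_or_lt with h0 | h0
  · simp [← h0]
  · exact mul_le_mul_of_nonneg_left (h t (M.p_pos.1 h0)) h0.le

end ConvexCombination

/-! ### One-step expansion of the basic quantifiers. -/

section Predecessors

variable {S : Type u} {Act : Type v} {AP : Type w}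

/-- The states from which a step into `V` is possible, in the sense of the quantifier `Q`. -/
def MDP.pre (M : MDP S Act AP) (Q : ProbQuant) (V : Set S) (s : S) : Prop :=
  match Q.mode, Q.cmp with
  | .all, .gt => ∀ α ∈ M.enabled s, ∃ t, 0 < M.δ s α t ∧ t ∈ V
  | .ex, .gt => ∃ α ∈ M.enabled s, ∃ t, 0 < M.δ s α t ∧ t ∈ V
  | .all, _ => ∀ α ∈ M.enabled s, ∀ t, 0 < M.δ s α t → t ∈ V
  | .ex, _ => ∃ α ∈ M.enabled s, ∀ t, 0 < M.δ s α t → t ∈ V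

/-- The four basic quantifiers. -/
def ProbQuant.Basic (Q : ProbQuant) : Prop :=
  Q = allPos ∨ Q = exPos ∨ Q = allOne ∨ Q = exOne

variable [Fintype S] [MeasurableSpace S] [DiscreteMeasurableSpace S] {M : MDP S Act AP}

theorem sat_allPos {s : S} {A : Set (ℕ → S)} :
    M.sat allPos s A ↔ ∀ σ : M.Scheduler, 0 < σ.pr s A := Iff.rfl

theorem sat_exPos {s : S} {A : Set (ℕ → S)} :
    M.sat exPos s A ↔ ∃ σ : M.Scheduler, 0 < σ.pr s A := Iff.rfl

theorem sat_allOne {s : S} {A : Set (ℕ → S)} :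
    M.sat allOne s A ↔ ∀ σ : M.Scheduler, 1 ≤ σ.pr s A := Iff.rfl

theorem sat_exOne {s : S} {A : Set (ℕ → S)} :
    M.sat exOne s A ↔ ∃ σ : M.Scheduler, 1 ≤ σ.pr s A := Iff.rfl

/-- Expansion of the first step. -/
theorem sat_step {Q : ProbQuant} (hQ : Q.Basic) {s : S} {A A' : Set (ℕ → S)}
    (hA : MeasurableSet A) (h : {ω | scons s ω ∈ A} = A') :
    M.sat Q s A ↔ M.pre Q {t | M.sat Q t A'} s := by
  have hstep : ∀ σ : M.Scheduler,
      σ.pr s A = ∑ t, M.p s (σ.first s) t * (σ.tail s).pr t A' := fun σ => by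
    rw [σ.pr_step s hA, h]
  have hcons : ∀ (α) (_ : α ∈ M.enabled s) (τ : S → M.Scheduler),
      (MDP.Scheduler.cons α τ).pr s A = ∑ t, M.p s α t * (τ t).pr t A' := by
    intro α hα τ
    rw [hstep, MDP.Scheduler.cons_first τ hα]
    simp_rw [MDP.Scheduler.pr_cons_tail]
  rcases hQ with rfl | rfl | rfl | rfl
  · change (∀ σ : M.Scheduler, 0 < σ.pr s A) ↔ ∀ α ∈ M.enabled s, ∃ t, 0 < M.δ s α t ∧
      ∀ σ : M.Scheduler, 0 < σ.pr t A'
    constructor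
    · intro H α hα
      by_contra! hn
      -- Otherwise every successor under `α` admits a scheduler with probability 0. Running `α`
      -- first and these afterwards gives probability 0 from `s`; other states get a dummy
      -- scheduler.
      have : ∀ t, ∃ σ : M.Scheduler, 0 < M.δ s α t → σ.pr t A' ≤ 0 := fun t => by
        by_cases ht : 0 < M.δ s α t
        · exact (hn t ht).imp fun σ hσ _ => hσ
        · exact ⟨M.memoryless M.anyAct M.anyAct_mem, fun h => absurd h ht⟩
      choose τ hτ using this
      have := H (MDP.Scheduler.cons α τ)
      rw [hcons α hα, M.sum_p_pos fun t => (τ t).pr_nonneg _ _] at this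
      obtain ⟨t, ht, h'⟩ := this
      exact absurd (hτ t ht) (not_le.2 h')
    · intro H σ
      obtain ⟨t, ht, h'⟩ := H _ (σ.first_mem s)
      rw [hstep, M.sum_p_pos fun t => (σ.tail s).pr_nonneg _ _]
      exact ⟨t, ht, h' _⟩
  · change (∃ σ : M.Scheduler, 0 < σ.pr s A) ↔ ∃ α ∈ M.enabled s, ∃ t, 0 < M.δ s α t ∧
      ∃ σ : M.Scheduler, 0 < σ.pr t A'
    constructor
    · rintro ⟨σ, hσ⟩
      rw [hstep, M.sum_p_pos fun t => (σ.tail s).pr_nonneg _ _] at hσ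
      obtain ⟨t, ht, h'⟩ := hσ
      exact ⟨_, σ.first_mem s, t, ht, _, h'⟩
    · rintro ⟨α, hα, t, ht, σ, hσ⟩
      refine ⟨MDP.Scheduler.cons α fun _ => σ, ?_⟩
      rw [hcons α hα, M.sum_p_pos fun t => σ.pr_nonneg _ _]
      exact ⟨t, ht, hσ⟩
  · change (∀ σ : M.Scheduler, 1 ≤ σ.pr s A) ↔ ∀ α ∈ M.enabled s, ∀ t, 0 < M.δ s α t →
      ∀ σ : M.Scheduler, 1 ≤ σ.pr t A'
    constructor
    · intro H α hα t ht σ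
      have := H (MDP.Scheduler.cons α fun _ => σ)
      rw [hcons α hα, M.sum_p_eq_one fun t => σ.pr_le_one _ _] at this
      exact this t ht
    · intro H σ
      rw [hstep, M.sum_p_eq_one fun t => (σ.tail s).pr_le_one _ _]
      exact fun t ht => H _ (σ.first_mem s) t ht _
  · change (∃ σ : M.Scheduler, 1 ≤ σ.pr s A) ↔ ∃ α ∈ M.enabled s, ∀ t, 0 < M.δ s α t →
      ∃ σ : M.Scheduler, 1 ≤ σ.pr t A'
    constructor
    · rintro ⟨σ, hσ⟩
      rw [hstep, M.sum_p_eq_one fun t => (σ.tail s).pr_le_one _ _] at hσ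
      exact ⟨_, σ.first_mem s, fun t ht => ⟨_, hσ t ht⟩⟩
    · rintro ⟨α, hα, H⟩
      have : ∀ t, ∃ σ : M.Scheduler, 0 < M.δ s α t → 1 ≤ σ.pr t A' := fun t => by
        by_cases ht : 0 < M.δ s α t
        · exact (H t ht).imp fun σ hσ _ => hσ
        · exact ⟨M.memoryless M.anyAct M.anyAct_mem, fun h => absurd h ht⟩
      choose τ hτ using this
      refine ⟨MDP.Scheduler.cons α τ, ?_⟩
      rw [hcons α hα, M.sum_p_eq_one fun t => (τ t).pr_le_one _ _]
      exact hτ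

/-- Monotonicity of `sat` in the property. -/
theorem sat_mono {Q : ProbQuant} (hQ : Q.Basic) {s : S} {A A' : Set (ℕ → S)} (h : A ⊆ A')
    (hs : M.sat Q s A) : M.sat Q s A' := by
  rcases hQ with rfl | rfl | rfl | rfl
  · exact fun σ => (hs σ).trans_le (σ.pr_mono s h)
  · exact hs.imp fun σ hσ => lt_of_lt_of_le hσ (σ.pr_mono s h)
  · exact fun σ => (show (1:ℝ) ≤ _ from hs σ).trans (σ.pr_mono s h)
  · exact hs.imp fun σ hσ => (show (1:ℝ) ≤ _ from hσ).trans (σ.pr_mono s h)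

theorem not_sat_of_pr_eq_zero {Q : ProbQuant} (hQ : Q.Basic) {s : S} {A : Set (ℕ → S)}
    (h : ∀ σ : M.Scheduler, σ.pr s A = 0) : ¬ M.sat Q s A := by
  intro hs
  rcases hQ with rfl | rfl | rfl | rfl
  · exact absurd (sat_allPos.1 hs (M.memoryless M.anyAct M.anyAct_mem)) (by simp [h])
  · obtain ⟨σ, hσ⟩ := sat_exPos.1 hs
    simp [h] at hσ
  · exact absurd (sat_allOne.1 hs (M.memoryless M.anyAct M.anyAct_mem)) (by norm_num [h])
  · obtain ⟨σ, hσ⟩ := sat_exOne.1 hs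
    norm_num [h] at hσ

theorem sat_of_pr_eq_one {Q : ProbQuant} (hQ : Q.Basic) {s : S} {A : Set (ℕ → S)}
    (h : ∀ σ : M.Scheduler, σ.pr s A = 1) : M.sat Q s A := by
  rcases hQ with rfl | rfl | rfl | rfl
  · exact sat_allPos.2 fun σ => by simp [h]
  · exact sat_exPos.2 ⟨M.memoryless M.anyAct M.anyAct_mem, by simp [h]⟩
  · exact fun σ => (h σ).symm.le
  · exact ⟨M.memoryless M.anyAct M.anyAct_mem, (h _).symm.le⟩

end Predecessors

/-! ### The bounded until property is decided on leaving the zero-reward states. -/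

section Until

variable {S : Type u} {Act : Type v} {AP : Type w}

/-- The paths that satisfy `Z U Y`. -/
def untilSet (Z Y : Set S) : Set (ℕ → S) :=
  reach (fun _ : Unit => (· ∈ Y)) (fun _ => (· ∈ Z)) (fun _ _ => ()) ()

/-- The paths that satisfy `Z U Y` within `n` steps. -/
def untilWithin (Z Y : Set S) (n : ℕ) : Set (ℕ → S) :=
  reachWithin (fun _ : Unit => (· ∈ Y)) (fun _ => (· ∈ Z)) (fun _ _ => ()) n ()

theorem mem_untilWithin {Z Y : Set S} {n : ℕ} {ω : ℕ → S} :
    ω ∈ untilWithin Z Y n ↔ ∃ k ≤ n, ω k ∈ Y ∧ ∀ i < k, ω i ∈ Z := by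
  induction n generalizing ω with
  | zero => simp [untilWithin, reachWithin]
  | succ n ih =>
    change (ω 0 ∈ Y ∨ ω 0 ∈ Z ∧ (fun i => ω (i + 1)) ∈ untilWithin Z Y n) ↔ _
    rw [ih]
    constructor
    · rintro (h | ⟨h, k, hk, h1, h2⟩)
      · exact ⟨0, by omega, h, by simp⟩
      · refine ⟨k + 1, by omega, h1, ?_⟩
        rintro (_ | i) hi
        · exact h
        · exact h2 i (by omega)
    · rintro ⟨_ | k, hk, h1, h2⟩
      · exact Or.inl h1
      · exact Or.inr ⟨h2 0 (by omega), k, by omega, h1, fun i hi => h2 (i + 1) (by omega)⟩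

theorem mem_untilSet {Z Y : Set S} {ω : ℕ → S} :
    ω ∈ untilSet Z Y ↔ ∃ k, ω k ∈ Y ∧ ∀ i < k, ω i ∈ Z := by
  have : ω ∈ untilSet Z Y ↔ ∃ n, ω ∈ untilWithin Z Y n := Set.mem_iUnion
  simp only [this, mem_untilWithin]
  exact ⟨fun ⟨n, k, _, h⟩ => ⟨k, h⟩, fun ⟨k, h⟩ => ⟨k, k, le_rfl, h⟩⟩

theorem untilSet_mono {Z Y Y' : Set S} (h : Y ⊆ Y') : untilSet Z Y ⊆ untilSet Z Y' := by
  intro ω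
  rw [mem_untilSet, mem_untilSet]
  exact fun ⟨k, h1, h2⟩ => ⟨k, h h1, h2⟩

theorem scons_mem_nextUntil {Z Y : Set S} {s : S} {ω : ℕ → S} :
    scons s ω ∈ nextUntil Z Y ↔ ω ∈ untilSet Z Y := mem_untilSet.symm

/-- The paths that satisfy `a U_{≤ r} b` within `n` steps. -/
def MDP.untilLEWithin (M : MDP S Act AP) (a b : AP) (r : ℝ) (n : ℕ) : Set (ℕ → S) :=
  reachWithin (fun (r : ℝ) s => b ∈ M.label s ∧ 0 ≤ r) (fun _ s => a ∈ M.label s)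
    (fun r s => r - M.rew s) n r

theorem MDP.mem_untilLEWithin {M : MDP S Act AP} {a b : AP} {r : ℝ} {n : ℕ} {ω : ℕ → S} :
    ω ∈ M.untilLEWithin a b r n ↔ ∃ k ≤ n, b ∈ M.label (ω k) ∧ (∀ i < k, a ∈ M.label (ω i)) ∧
      ∑ i ∈ Finset.range k, (M.rew (ω i) : ℝ) ≤ r := by
  induction n generalizing ω r with
  | zero => simp [untilLEWithin, reachWithin]
  | succ n ih =>
    change ((b ∈ M.label (ω 0) ∧ 0 ≤ r) ∨ a ∈ M.label (ω 0) ∧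
      (fun i => ω (i + 1)) ∈ M.untilLEWithin a b (r - M.rew (ω 0)) n) ↔ _
    rw [ih]
    constructor
    · rintro (h | ⟨h, k, hk, h1, h2, h3⟩)
      · exact ⟨0, by omega, h.1, by simp, by simpa using h.2⟩
      · refine ⟨k + 1, by omega, h1, ?_, ?_⟩
        · rintro (_ | i) hi
          · exact h
          · exact h2 i (by omega)
        · rw [Finset.sum_range_succ']
          linarith
    · rintro ⟨_ | k, hk, h1, h2, h3⟩
      · exact Or.inl ⟨h1, by simpa using h3⟩
      · refine Or.inr ⟨h2 0 (by omega), k, by omega, h1, fun i hi => h2 (i + 1) (by omega), ?_⟩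
        rw [Finset.sum_range_succ'] at h3
        linarith

/-- The memory is the part of the bound that is left. It may become negative on the way; its sign is
tested only at the target. -/
theorem MDP.untilLE_eq_reach (M : MDP S Act AP) (a b : AP) (r : ℝ) :
    M.untilLE a b r = reach (fun (r : ℝ) s => b ∈ M.label s ∧ 0 ≤ r)
      (fun _ s => a ∈ M.label s) (fun r s => r - M.rew s) r := by
  ext ω
  have : ω ∈ reach (fun (r : ℝ) s => b ∈ M.label s ∧ 0 ≤ r)
      (fun _ s => a ∈ M.label s) (fun r s => r - M.rew s) r ↔
      ∃ n, ω ∈ M.untilLEWithin a b r n := Set.mem_iUnion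
  rw [this]
  simp only [mem_untilLEWithin]
  exact ⟨fun ⟨k, h⟩ => ⟨k, k, le_rfl, h⟩, fun ⟨n, k, _, h⟩ => ⟨k, h⟩⟩

theorem MDP.untilLE_mono (M : MDP S Act AP) (a b : AP) : Monotone (M.untilLE a b) :=
  fun _ _ h _ ⟨k, h1, h2, h3⟩ => ⟨k, h1, h2, h3.trans h⟩

theorem MDP.untilLE_of_neg (M : MDP S Act AP) (a b : AP) {r : ℝ} (h : r < 0) :
    M.untilLE a b r = ∅ := by
  ext ω
  simp only [Set.mem_empty_iff_false, iff_false]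
  rintro ⟨k, -, -, h3⟩
  have : 0 ≤ ∑ i ∈ Finset.range k, (M.rew (ω i) : ℝ) :=
    Finset.sum_nonneg fun _ _ => NNReal.coe_nonneg _
  linarith

variable [Fintype S] [MeasurableSpace S] [DiscreteMeasurableSpace S] {M : MDP S Act AP}

namespace MDP.Scheduler

variable {Z Y : Set S}

theorem pr_until_of_mem (σ : M.Scheduler) {s : S} (h : s ∈ Y) : σ.pr s (untilSet Z Y) = 1 :=
  σ.pr_reach_win h

theorem pr_untilWithin_of_mem (σ : M.Scheduler) {s : S} (n : ℕ) (h : s ∈ Y) :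
    σ.pr s (untilWithin Z Y n) = 1 :=
  σ.pr_reachWithin_win n h

theorem pr_untilWithin_zero (σ : M.Scheduler) {s : S} (h : s ∉ Y) :
    σ.pr s (untilWithin Z Y 0) = 0 :=
  σ.pr_reachWithin_zero h

theorem pr_until_step (σ : M.Scheduler) {s : S} (h : s ∉ Y) (h' : s ∈ Z) :
    σ.pr s (untilSet Z Y) = ∑ t, M.p s (σ.first s) t * (σ.tail s).pr t (untilSet Z Y) :=
  σ.pr_reach_step h h'

theorem pr_untilWithin_succ (σ : M.Scheduler) {s : S} (n : ℕ) (h : s ∉ Y) (h' : s ∈ Z) :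
    σ.pr s (untilWithin Z Y (n + 1)) =
      ∑ t, M.p s (σ.first s) t * (σ.tail s).pr t (untilWithin Z Y n) :=
  σ.pr_reachWithin_succ n h h'

theorem pr_until_of_notMem (σ : M.Scheduler) {s : S} (h : s ∉ Y) (h' : s ∉ Z) :
    σ.pr s (untilSet Z Y) = 0 :=
  σ.pr_reach_lose h h'

theorem pr_untilWithin_le (σ : M.Scheduler) (s : S) (n : ℕ) :
    σ.pr s (untilWithin Z Y n) ≤ σ.pr s (untilSet Z Y) := σ.pr_reachWithin_le n () s

theorem pr_until_le (σ : M.Scheduler) {s : S} {c : ℝ}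
    (h : ∀ n, σ.pr s (untilWithin Z Y n) ≤ c) : σ.pr s (untilSet Z Y) ≤ c := σ.pr_reach_le h

theorem exists_pr_untilWithin_pos (σ : M.Scheduler) {s : S} (h : 0 < σ.pr s (untilSet Z Y)) :
    ∃ n, 0 < σ.pr s (untilWithin Z Y n) := σ.exists_pr_reachWithin_pos h

theorem pr_untilWithin_of_notMem (σ : M.Scheduler) {s : S} (n : ℕ) (h : s ∉ Y) (h' : s ∉ Z) :
    σ.pr s (untilWithin Z Y n) = 0 :=
  le_antisymm ((σ.pr_untilWithin_le s n).trans_eq (σ.pr_until_of_notMem h h')) (σ.pr_nonneg _ _)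

variable {a b : AP}

theorem pr_untilLE_step (σ : M.Scheduler) {s : S} (r : ℝ) (ha : a ∈ M.label s)
    (hb : b ∉ M.label s) : σ.pr s (M.untilLE a b r) =
      ∑ t, M.p s (σ.first s) t * (σ.tail s).pr t (M.untilLE a b (r - M.rew s)) := by
  simp only [MDP.untilLE_eq_reach]
  exact σ.pr_reach_step (κ := r) (fun h => hb h.1) ha

theorem pr_untilLE_of_b (σ : M.Scheduler) {s : S} {r : ℝ} (hb : b ∈ M.label s) (hr : 0 ≤ r) :
    σ.pr s (M.untilLE a b r) = 1 := by
  simp only [MDP.untilLE_eq_reach]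
  exact σ.pr_reach_win (κ := r) ⟨hb, hr⟩

theorem pr_untilLE_of_notMem (σ : M.Scheduler) {s : S} (r : ℝ) (ha : a ∉ M.label s)
    (hb : b ∉ M.label s) : σ.pr s (M.untilLE a b r) = 0 := by
  simp only [MDP.untilLE_eq_reach]
  exact σ.pr_reach_lose (κ := r) (fun h => hb h.1) ha

theorem pr_untilLE_le (σ : M.Scheduler) {s : S} {r c : ℝ}
    (h : ∀ n, σ.pr s (M.untilLEWithin a b r n) ≤ c) : σ.pr s (M.untilLE a b r) ≤ c := by
  simp only [MDP.untilLE_eq_reach]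
  exact σ.pr_reach_le h

theorem pr_untilLEWithin_le (σ : M.Scheduler) (s : S) (r : ℝ) (n : ℕ) :
    σ.pr s (M.untilLEWithin a b r n) ≤ σ.pr s (M.untilLE a b r) := by
  simp only [MDP.untilLE_eq_reach]
  exact σ.pr_reachWithin_le n r s

theorem exists_pr_untilLEWithin_pos (σ : M.Scheduler) {s : S} {r : ℝ}
    (h : 0 < σ.pr s (M.untilLE a b r)) : ∃ n, 0 < σ.pr s (M.untilLEWithin a b r n) := by
  simp only [MDP.untilLE_eq_reach] at h
  exact σ.exists_pr_reachWithin_pos h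

theorem pr_untilLEWithin_zero_of_zeroStates (σ : M.Scheduler) {s : S} (r : ℝ)
    (hs : s ∈ M.zeroStates a b) : σ.pr s (M.untilLEWithin a b r 0) = 0 :=
  σ.pr_reachWithin_zero fun h => hs.2.1 h.1

theorem pr_untilLEWithin_succ_of_zeroStates (σ : M.Scheduler) {s : S} (r : ℝ) (n : ℕ)
    (hs : s ∈ M.zeroStates a b) : σ.pr s (M.untilLEWithin a b r (n + 1)) =
      ∑ t, M.p s (σ.first s) t * (σ.tail s).pr t (M.untilLEWithin a b r n) := by
  have := σ.pr_reachWithin_succ (win := fun (r : ℝ) s => b ∈ M.label s ∧ 0 ≤ r)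
    (go := fun _ s => a ∈ M.label s) (upd := fun r s => r - M.rew s) n (κ := r) (s := s)
    (fun h => hs.2.1 h.1) hs.1
  rwa [hs.2.2, NNReal.coe_zero, sub_zero] at this

theorem pr_untilLE_of_zeroStates (σ : M.Scheduler) {s : S} (r : ℝ)
    (hs : s ∈ M.zeroStates a b) : σ.pr s (M.untilLE a b r) =
      ∑ t, M.p s (σ.first s) t * (σ.tail s).pr t (M.untilLE a b r) := by
  have := σ.pr_untilLE_step r hs.1 hs.2.1
  rwa [hs.2.2, NNReal.coe_zero, sub_zero] at this

end MDP.Scheduler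

/-- The states with positive reward (or satisfying `b`, or violating `a`) that satisfy the
bounded until property. -/
def MDP.exitStates (M : MDP S Act AP) (Q : ProbQuant) (a b : AP) (r : ℝ) : Set S :=
  {t | t ∉ M.zeroStates a b ∧ M.sat Q t (M.untilLE a b r)}

variable {a b : AP} {r : ℝ}

open MDP.Scheduler

/-- Inside `zeroStates` the bound is not consumed. The glued scheduler reaches `Y` as `σ` does, with
the whole bound left, and then succeeds with probability at least `c`. -/
theorem pr_glue_ge {Y : Set S} {τ : S → M.Scheduler} {c : ℝ}
    (hY : Y ⊆ (M.zeroStates a b)ᶜ)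
    (hτ : ∀ t ∈ Y, c ≤ (τ t).pr t (M.untilLE a b r)) (n : ℕ) (σ : M.Scheduler) (t : S) :
    c * σ.pr t (untilWithin (M.zeroStates a b) Y n) ≤
      (glue (M.zeroStates a b) τ σ).pr t (M.untilLE a b r) := by
  induction n generalizing σ t with
  | zero =>
    by_cases ht : t ∈ Y
    · rw [pr_untilWithin_of_mem _ _ ht, mul_one, pr_glue_of_notMem _ _ (hY ht)]
      exact hτ t ht
    · rw [pr_untilWithin_zero _ ht, mul_zero]
      exact pr_nonneg _ _ _
  | succ n ih =>
    by_cases ht : t ∈ Y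
    · rw [pr_untilWithin_of_mem _ _ ht, mul_one, pr_glue_of_notMem _ _ (hY ht)]
      exact hτ t ht
    by_cases hz : t ∈ M.zeroStates a b
    · rw [pr_untilWithin_succ _ _ ht hz, pr_untilLE_of_zeroStates _ _ hz, Finset.mul_sum,
        glue_first _ _ hz]
      refine Finset.sum_le_sum fun t' _ => ?_
      rw [pr_glue_tail _ _ hz, mul_left_comm]
      exact mul_le_mul_of_nonneg_left (ih _ _) (M.p_nonneg _ _ _)
    · rw [pr_untilWithin_of_notMem _ _ ht hz, mul_zero]
      exact pr_nonneg _ _ _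

/-- A success either goes through `Y` or leaves `zeroStates` elsewhere, where its probability is at
most `c`. The bound is affine in the probability of reaching `Y`, hence compatible with averaging
over successors. -/
theorem pr_glue_le {Y : Set S} {τ : S → M.Scheduler} {c : ℝ} (hc : c ≤ 1) (hc0 : 0 ≤ c)
    (hY : Y ⊆ (M.zeroStates a b)ᶜ)
    (hτ : ∀ t, t ∉ M.zeroStates a b → t ∉ Y → (τ t).pr t (M.untilLE a b r) ≤ c) (n : ℕ)
    (σ : M.Scheduler) (t : S) :
    (glue (M.zeroStates a b) τ σ).pr t (M.untilLEWithin a b r n) ≤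
      c + (1 - c) * σ.pr t (untilSet (M.zeroStates a b) Y) := by
  have key : ∀ t ∉ M.zeroStates a b, ∀ n (σ : M.Scheduler),
      (glue (M.zeroStates a b) τ σ).pr t (M.untilLEWithin a b r n) ≤
      c + (1 - c) * σ.pr t (untilSet (M.zeroStates a b) Y) := by
    intro t hz n σ
    by_cases ht : t ∈ Y
    · rw [pr_until_of_mem _ ht]
      linarith [(glue (M.zeroStates a b) τ σ).pr_le_one t (M.untilLEWithin a b r n)]
    · rw [pr_until_of_notMem _ ht hz, mul_zero, add_zero]
      refine (pr_untilLEWithin_le _ _ _ _).trans ?_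
      rw [pr_glue_of_notMem _ _ hz]
      exact hτ t hz ht
  induction n generalizing σ t with
  | zero =>
    by_cases hz : t ∈ M.zeroStates a b
    · rw [pr_untilLEWithin_zero_of_zeroStates _ _ hz]
      have := mul_nonneg (sub_nonneg.2 hc) (σ.pr_nonneg t (untilSet (M.zeroStates a b) Y))
      linarith
    · exact key t hz _ _
  | succ n ih =>
    by_cases hz : t ∈ M.zeroStates a b
    · rw [pr_untilLEWithin_succ_of_zeroStates _ _ _ hz, pr_until_step _ (fun h => hY h hz) hz,
        glue_first _ _ hz]
      calc _ ≤ ∑ t', M.p t (σ.first t) t' *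
            (c + (1 - c) * (σ.tail t).pr t' (untilSet (M.zeroStates a b) Y)) := by
            refine Finset.sum_le_sum fun t' _ => ?_
            rw [pr_glue_tail _ _ hz]
            exact mul_le_mul_of_nonneg_left (ih _ _) (M.p_nonneg _ _ _)
        _ = _ := by
            simp only [mul_add, Finset.sum_add_distrib, ← Finset.sum_mul, M.sum_p, one_mul,
              Finset.mul_sum, mul_left_comm]
    · exact key t hz _ _

/-- No gluing is needed, since every scheduler succeeds almost surely from `Y` and the bound is
untouched before. -/
theorem pr_untilLE_ge {Y : Set S}
    (hY : ∀ t ∈ Y, ∀ σ : M.Scheduler, 1 ≤ σ.pr t (M.untilLE a b r)) (n : ℕ) (σ : M.Scheduler)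
    (t : S) :
    σ.pr t (untilWithin (M.zeroStates a b) Y n) ≤ σ.pr t (M.untilLE a b r) := by
  by_cases ht : t ∈ Y
  · exact (pr_le_one _ _ _).trans (hY t ht σ)
  induction n generalizing σ t with
  | zero =>
    rw [pr_untilWithin_zero _ ht]
    exact pr_nonneg _ _ _
  | succ n ih =>
    by_cases hz : t ∈ M.zeroStates a b
    · rw [pr_untilWithin_succ _ _ ht hz, pr_untilLE_of_zeroStates _ _ hz]
      refine Finset.sum_le_sum fun t' _ => mul_le_mul_of_nonneg_left ?_ (M.p_nonneg _ _ _)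
      by_cases ht' : t' ∈ Y
      · exact (pr_le_one _ _ _).trans (hY t' ht' _)
      · exact ih _ _ ht'
    · rw [pr_untilWithin_of_notMem _ _ ht hz]
      exact pr_nonneg _ _ _

theorem pr_untilLE_pos {Y : Set S}
    (hY : ∀ t ∈ Y, ∀ σ : M.Scheduler, 0 < σ.pr t (M.untilLE a b r)) (n : ℕ) (σ : M.Scheduler)
    (t : S) (h : 0 < σ.pr t (untilWithin (M.zeroStates a b) Y n)) :
    0 < σ.pr t (M.untilLE a b r) := by
  induction n generalizing σ t with
  | zero =>
    by_cases ht : t ∈ Y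
    · exact hY t ht σ
    rw [pr_untilWithin_zero _ ht] at h
    exact absurd h (lt_irrefl _)
  | succ n ih =>
    by_cases ht : t ∈ Y
    · exact hY t ht σ
    by_cases hz : t ∈ M.zeroStates a b
    · rw [pr_untilWithin_succ _ _ ht hz, M.sum_p_pos fun t => pr_nonneg _ _ _] at h
      rw [pr_untilLE_of_zeroStates _ _ hz, M.sum_p_pos fun t => pr_nonneg _ _ _]
      exact h.imp fun t' ⟨h1, h2⟩ => ⟨h1, ih _ _ h2⟩
    · rw [pr_untilWithin_of_notMem _ _ ht hz] at h
      exact absurd h (lt_irrefl _)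

/-- Success requires a state with `b`, which is outside `zeroStates`. A successful path thus leaves
these states, at a state from which success is still possible. -/
theorem pr_until_pos (n : ℕ) (σ : M.Scheduler) (t : S)
    (h : 0 < σ.pr t (M.untilLEWithin a b r n)) :
    0 < σ.pr t (untilSet (M.zeroStates a b) (M.exitStates exPos a b r)) := by
  have key : ∀ t ∉ M.zeroStates a b, ∀ n (σ : M.Scheduler),
      0 < σ.pr t (M.untilLEWithin a b r n) →
      0 < σ.pr t (untilSet (M.zeroStates a b) (M.exitStates exPos a b r)) := by
    intro t hz n σ h
    rw [pr_until_of_mem]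
    · exact one_pos
    · exact ⟨hz, σ, h.trans_le (pr_untilLEWithin_le _ _ _ _)⟩
  induction n generalizing σ t with
  | zero =>
    by_cases hz : t ∈ M.zeroStates a b
    · rw [pr_untilLEWithin_zero_of_zeroStates _ _ hz] at h
      exact absurd h (lt_irrefl _)
    · exact key t hz _ _ h
  | succ n ih =>
    by_cases hz : t ∈ M.zeroStates a b
    · rw [pr_untilLEWithin_succ_of_zeroStates _ _ _ hz, M.sum_p_pos fun t => pr_nonneg _ _ _] at h
      rw [pr_until_step _ (fun h => h.1 hz) hz, M.sum_p_pos fun t => pr_nonneg _ _ _]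
      exact h.imp fun t' ⟨h1, h2⟩ => ⟨h1, ih _ _ h2⟩
    · exact key t hz _ _ h

/-- While the bound is untouched, almost sure success is inherited by all successors. So every state
at which `zeroStates` is left is an exit state, and paths that stay there forever do not succeed. -/
theorem pr_untilLEWithin_le_until (n : ℕ) (σ : M.Scheduler) (t : S)
    (h : 1 ≤ σ.pr t (M.untilLE a b r)) :
    σ.pr t (M.untilLEWithin a b r n) ≤
      σ.pr t (untilSet (M.zeroStates a b) (M.exitStates exOne a b r)) := by
  by_cases hz : t ∈ M.zeroStates a b
  · induction n generalizing σ t with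
    | zero =>
      rw [pr_untilLEWithin_zero_of_zeroStates _ _ hz]
      exact pr_nonneg _ _ _
    | succ n ih =>
      rw [pr_untilLE_of_zeroStates _ _ hz, M.sum_p_eq_one fun t => pr_le_one _ _ _] at h
      rw [pr_untilLEWithin_succ_of_zeroStates _ _ _ hz, pr_until_step _ (fun h => h.1 hz) hz]
      refine M.sum_p_le_sum_p fun t' ht' => ?_
      by_cases hz' : t' ∈ M.zeroStates a b
      · exact ih _ _ (h t' ht') hz'
      · rw [pr_until_of_mem (Y := M.exitStates exOne a b r) _ ⟨hz', _, h t' ht'⟩]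
        exact pr_le_one _ _ _
  · rw [pr_until_of_mem (Y := M.exitStates exOne a b r) _ ⟨hz, _, h⟩]
    exact pr_le_one _ _ _

/-- The bounded until property is determined at the first state outside `zeroStates`. -/
theorem sat_untilLE_iff_untilSet {Q : ProbQuant} (hQ : Q.Basic) (t : S) :
    M.sat Q t (M.untilLE a b r) ↔
      M.sat Q t (untilSet (M.zeroStates a b) (M.exitStates Q a b r)) := by
  have hsub : ∀ Q : ProbQuant, M.exitStates Q a b r ⊆ (M.zeroStates a b)ᶜ := fun Q t ht => ht.1
  rcases hQ with rfl | rfl | rfl | rfl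
  · constructor
    · intro H
      by_contra hn
      rw [sat_allPos] at hn
      push Not at hn
      obtain ⟨σ, hσ⟩ := hn
      -- A counterexample is assembled: `σ` misses the exit states almost surely, and wherever else
      -- `zeroStates` is left, a scheduler with success probability 0 takes over.
      have : ∀ t, ∃ τ : M.Scheduler, t ∉ M.zeroStates a b → t ∉ M.exitStates allPos a b r →
          τ.pr t (M.untilLE a b r) ≤ 0 := by
        intro t
        by_cases h : t ∉ M.zeroStates a b ∧ t ∉ M.exitStates allPos a b r
        · have h2 : ¬ M.sat allPos t (M.untilLE a b r) := fun h' => h.2 ⟨h.1, h'⟩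
          rw [sat_allPos] at h2
          push Not at h2
          exact h2.imp fun τ hτ _ _ => hτ
        · exact ⟨σ, fun h1 h2 => absurd ⟨h1, h2⟩ h⟩
      choose τ hτ using this
      have h1 := pr_untilLE_le _ fun n =>
        pr_glue_le (c := 0) zero_le_one le_rfl (hsub allPos) hτ n σ t
      have h2 := sat_allPos.1 H (glue (M.zeroStates a b) τ σ)
      linarith
    · intro H σ
      obtain ⟨n, hn⟩ := exists_pr_untilWithin_pos _ (sat_allPos.1 H σ)
      exact pr_untilLE_pos (fun t ht => sat_allPos.1 ht.2) n σ t hn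
  · constructor
    · rintro ⟨σ, hσ⟩
      obtain ⟨n, hn⟩ := exists_pr_untilLEWithin_pos _ hσ
      exact ⟨σ, pr_until_pos n σ t hn⟩
    · rintro ⟨σ, hσ⟩
      obtain ⟨n, hn⟩ := exists_pr_untilWithin_pos _ hσ
      have : ∀ t, ∃ τ : M.Scheduler, t ∈ M.exitStates exPos a b r →
          0 < τ.pr t (M.untilLE a b r) := by
        intro t
        by_cases h : t ∈ M.exitStates exPos a b r
        · exact h.2.imp fun τ hτ _ => hτ
        · exact ⟨σ, fun h' => absurd h' h⟩
      choose τ hτ using this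
      -- Finitely many exit states have a common positive lower bound; 1 is a dummy if there are
      -- none.
      obtain ⟨c, hc0, hc⟩ : ∃ c : ℝ, 0 < c ∧ ∀ t ∈ M.exitStates exPos a b r,
          c ≤ (τ t).pr t (M.untilLE a b r) := by
        by_cases hne : (M.exitStates exPos a b r).Nonempty
        · obtain ⟨t0, h0, hmin⟩ := Set.exists_min_image _
            (fun t => (τ t).pr t (M.untilLE a b r)) (Set.toFinite _) hne
          exact ⟨_, hτ t0 h0, hmin⟩
        · exact ⟨1, one_pos, fun t ht => absurd ⟨t, ht⟩ hne⟩
      exact ⟨_, (mul_pos hc0 hn).trans_le (pr_glue_ge (hsub exPos) hc n σ t)⟩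
  · constructor
    · intro H
      by_contra hn
      rw [sat_allOne] at hn
      push Not at hn
      obtain ⟨σ, hσ⟩ := hn
      have : ∀ t, ∃ τ : M.Scheduler, t ∉ M.zeroStates a b → t ∉ M.exitStates allOne a b r →
          τ.pr t (M.untilLE a b r) < 1 := by
        intro t
        by_cases h : t ∉ M.zeroStates a b ∧ t ∉ M.exitStates allOne a b r
        · have h2 : ¬ M.sat allOne t (M.untilLE a b r) := fun h' => h.2 ⟨h.1, h'⟩
          rw [sat_allOne] at h2
          push Not at h2
          exact h2.imp fun τ hτ _ _ => hτ
        · exact ⟨σ, fun h1 h2 => absurd ⟨h1, h2⟩ h⟩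
      choose τ hτ using this
      -- By finiteness one `c < 1` works for all states, so that `c + (1 - c) * x` is below 1 for
      -- the probability `x < 1` with which `σ` reaches the exit states.
      obtain ⟨c, hc0, hc1, hc⟩ : ∃ c : ℝ, 0 ≤ c ∧ c < 1 ∧ ∀ t, t ∉ M.zeroStates a b →
          t ∉ M.exitStates allOne a b r → (τ t).pr t (M.untilLE a b r) ≤ c := by
        by_cases hne : {t | t ∉ M.zeroStates a b ∧ t ∉ M.exitStates allOne a b r}.Nonempty
        · obtain ⟨t0, h0, hmax⟩ := Set.exists_max_image _
            (fun t => (τ t).pr t (M.untilLE a b r)) (Set.toFinite _) hne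
          exact ⟨_, pr_nonneg _ _ _, hτ t0 h0.1 h0.2, fun t h1 h2 => hmax t ⟨h1, h2⟩⟩
        · exact ⟨0, le_rfl, one_pos, fun t h1 h2 => absurd ⟨t, h1, h2⟩ hne⟩
      have h1 := pr_untilLE_le _ fun n =>
        pr_glue_le (c := c) hc1.le hc0 (hsub allOne) hc n σ t
      have h2 := sat_allOne.1 H (glue (M.zeroStates a b) τ σ)
      nlinarith
    · intro H σ
      exact (sat_allOne.1 H σ).trans (pr_until_le _ fun n =>
        pr_untilLE_ge (fun t ht => sat_allOne.1 ht.2) n σ t)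
  · constructor
    · rintro ⟨σ, hσ⟩
      exact ⟨σ, ge_trans (pr_untilLE_le _ fun n => pr_untilLEWithin_le_until n σ t hσ) hσ⟩
    · rintro ⟨σ, hσ⟩
      have : ∀ t, ∃ τ : M.Scheduler, t ∈ M.exitStates exOne a b r →
          1 ≤ τ.pr t (M.untilLE a b r) := by
        intro t
        by_cases h : t ∈ M.exitStates exOne a b r
        · exact h.2.imp fun τ hτ _ => hτ
        · exact ⟨σ, fun h' => absurd h' h⟩
      choose τ hτ using this
      refine ⟨glue (M.zeroStates a b) τ σ, ge_trans (pr_until_le σ fun n => ?_) hσ⟩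
      exact (one_mul _).symm.le.trans (pr_glue_ge (hsub exOne) hτ n σ t)

theorem measurableSet_nextUntil (Z Y : Set S) : MeasurableSet (nextUntil Z Y) := by
  have : nextUntil Z Y = (fun (ω : ℕ → S) i => ω (i + 1)) ⁻¹' untilSet Z Y := by
    ext ω
    exact mem_untilSet.symm
  rw [this]
  exact measurable_pi_lambda _ (fun i => measurable_pi_apply _) (measurableSet_reach _)

/-- The bounded until property in a state that satisfies `a` and not `b`. -/
theorem sat_untilLE_iff_nextUntil {Q : ProbQuant} (hQ : Q.Basic) {s : S} (ha : a ∈ M.label s)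
    (hb : b ∉ M.label s) :
    M.sat Q s (M.untilLE a b r) ↔
      M.sat Q s (nextUntil (M.zeroStates a b) (M.exitStates Q a b (r - M.rew s))) := by
  have hm1 : MeasurableSet (M.untilLE a b r) := by
    rw [M.untilLE_eq_reach]; exact measurableSet_reach _
  rw [sat_step (A' := M.untilLE a b (r - M.rew s)) hQ hm1, sat_step
    (A' := untilSet (M.zeroStates a b) (M.exitStates Q a b (r - M.rew s))) hQ
    (measurableSet_nextUntil _ _)]
  · simp_rw [sat_untilLE_iff_untilSet hQ]
  · ext ω; exact scons_mem_nextUntil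
  · ext ω
    simp only [M.untilLE_eq_reach]
    refine scons_mem_reach.trans ?_
    simp [ha, hb]

end Until

/-! ### Fixed points and ranks for the qualitative until property. -/

section QualitativeUntil

variable {S : Type u} {Act : Type v} {AP : Type w}

open MDP.Scheduler

/-- The scheduler chooses in every state `s` an action in `A s`. -/
def MDP.Scheduler.Follows {M : MDP S Act AP} (σ : M.Scheduler) (A : S → Set Act) : Prop :=
  ∀ n (ω : ℕ → S), σ.choose n (hist ω n) ∈ A (ω n)

theorem MDP.Scheduler.Follows.first_mem {M : MDP S Act AP} {σ : M.Scheduler} {A : S → Set Act}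
    (h : σ.Follows A) (s : S) : σ.first s ∈ A s := h 0 fun _ => s

theorem MDP.Scheduler.Follows.tail {M : MDP S Act AP} {σ : M.Scheduler} {A : S → Set Act}
    (h : σ.Follows A) (s : S) : (σ.tail s).Follows A := fun n ω => by
  rw [tail_choose]; exact h (n + 1) (scons s ω)

theorem MDP.exists_le_p [Finite S] [Finite Act] (M : MDP S Act AP) :
    ∃ ε : ℝ, 0 < ε ∧ ε ≤ 1 ∧ ∀ s α t, 0 < M.δ s α t → ε ≤ M.p s α t := by
  by_cases hne : {x : S × Act × S | 0 < M.δ x.1 x.2.1 x.2.2}.Nonempty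
  · obtain ⟨x, hx, hmin⟩ := Set.exists_min_image _ (fun x : S × Act × S => M.p x.1 x.2.1 x.2.2)
      (Set.toFinite _) hne
    refine ⟨min 1 (M.p x.1 x.2.1 x.2.2), lt_min one_pos (M.p_pos.2 hx), min_le_left _ _, ?_⟩
    exact fun s α t h => (min_le_right _ _).trans (hmin (s, α, t) h)
  · exact ⟨1, one_pos, le_rfl, fun s α t h => absurd ⟨(s, α, t), h⟩ hne⟩

variable [Fintype S] [MeasurableSpace S] [DiscreteMeasurableSpace S] {M : MDP S Act AP}
  {Z Y : Set S}

/-- Whatever actions from `A` are chosen, a run whose steps all decrease the rank hits `Y` within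
`n` steps, and each of these steps has probability at least `ε`. -/
theorem pow_le_pr_untilWithin {A : S → Set Act} {W : Set S} {ρ : S → ℕ} {ε : ℝ} (hε : 0 < ε)
    (hε1 : ε ≤ 1) (hp : ∀ s α t, 0 < M.δ s α t → ε ≤ M.p s α t)
    (hW : ∀ t ∈ W, t ∉ Y → t ∈ Z ∧ ∀ α ∈ A t, (∀ t', 0 < M.δ t α t' → t' ∈ W) ∧
      ∃ t', 0 < M.δ t α t' ∧ ρ t' < ρ t) (n : ℕ) {σ : M.Scheduler} (hσ : σ.Follows A) {t : S}
    (ht : t ∈ W) (hn : ρ t ≤ n) : ε ^ n ≤ σ.pr t (untilWithin Z Y n) := by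
  induction n generalizing σ t with
  | zero =>
    by_cases hY : t ∈ Y
    · simp [pr_untilWithin_of_mem _ _ hY]
    · obtain ⟨-, h⟩ := hW t ht hY
      obtain ⟨-, t', -, h'⟩ := h _ (hσ.first_mem t)
      omega
  | succ n ih =>
    by_cases hY : t ∈ Y
    · rw [pr_untilWithin_of_mem _ _ hY]
      exact pow_le_one₀ hε.le hε1
    · obtain ⟨hz, h⟩ := hW t ht hY
      obtain ⟨h1, t', h2, h3⟩ := h _ (hσ.first_mem t)
      rw [pr_untilWithin_succ _ _ hY hz]
      calc ε ^ (n + 1) = ε * ε ^ n := pow_succ' _ _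
        _ ≤ M.p t (σ.first t) t' * (σ.tail t).pr t' (untilWithin Z Y n) :=
            mul_le_mul (hp _ _ _ h2) (ih (hσ.tail t) (h1 t' h2) (by omega)) (by positivity)
              (M.p_nonneg _ _ _)
        _ ≤ _ := Finset.single_le_sum
            (f := fun t' => M.p t (σ.first t) t' * (σ.tail t).pr t' (untilWithin Z Y n))
            (fun t' _ => mul_nonneg (M.p_nonneg _ _ _) (pr_nonneg _ _ _)) (Finset.mem_univ t')

/-- A path that has not succeeded after `n` steps is still in `W`, where the chance is at least `x`.
So the uniform bound `x` improves itself. -/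
theorem pr_until_ge_of_forall_ge {A : S → Set Act} {W : Set S} {x : ℝ}
    (hW : ∀ t ∈ W, t ∉ Y → t ∈ Z ∧ ∀ α ∈ A t, ∀ t', 0 < M.δ t α t' → t' ∈ W)
    (hx : ∀ σ : M.Scheduler, σ.Follows A → ∀ t ∈ W, x ≤ σ.pr t (untilSet Z Y)) (n : ℕ)
    {σ : M.Scheduler} (hσ : σ.Follows A) {t : S} (ht : t ∈ W) :
    x + (1 - x) * σ.pr t (untilWithin Z Y n) ≤ σ.pr t (untilSet Z Y) := by
  induction n generalizing σ t with
  | zero =>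
    by_cases hY : t ∈ Y
    · simp [pr_untilWithin_of_mem _ _ hY, pr_until_of_mem _ hY]
    · rw [pr_untilWithin_zero _ hY, mul_zero, add_zero]
      exact hx σ hσ t ht
  | succ n ih =>
    by_cases hY : t ∈ Y
    · simp [pr_untilWithin_of_mem _ _ hY, pr_until_of_mem _ hY]
    · obtain ⟨hz, h⟩ := hW t ht hY
      rw [pr_untilWithin_succ _ _ hY hz, pr_until_step _ hY hz]
      calc _ = ∑ t', M.p t (σ.first t) t' *
            (x + (1 - x) * (σ.tail t).pr t' (untilWithin Z Y n)) := by
            simp only [mul_add, Finset.sum_add_distrib, ← Finset.sum_mul, M.sum_p, one_mul,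
              Finset.mul_sum, mul_left_comm]
        _ ≤ _ := M.sum_p_le_sum_p fun t' ht' =>
            ih (hσ.tail t) (h _ (hσ.first_mem t) t' ht')

/-- A ranking function that decreases with positive probability certifies almost sure
reachability. -/
theorem pr_until_eq_one_of_rank [Finite Act] {A : S → Set Act} {W : Set S} {ρ : S → ℕ}
    (hW : ∀ t ∈ W, t ∉ Y → t ∈ Z ∧ ∀ α ∈ A t, (∀ t', 0 < M.δ t α t' → t' ∈ W) ∧
      ∃ t', 0 < M.δ t α t' ∧ ρ t' < ρ t) {σ : M.Scheduler} (hσ : σ.Follows A) {t : S}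
    (ht : t ∈ W) : 1 ≤ σ.pr t (untilSet Z Y) := by
  obtain ⟨ε, hε, hε1, hp⟩ := M.exists_le_p
  set N := ∑ t, ρ t
  have hN : ∀ t, ρ t ≤ N := fun t => Finset.single_le_sum (fun _ _ => Nat.zero_le _)
    (Finset.mem_univ t)
  have hc0 : 0 < ε ^ N := by positivity
  have hc1 : ε ^ N ≤ 1 := pow_le_one₀ hε.le hε1
  -- Consider `j` blocks of `N` steps: whatever happened before, a block fails with probability at
  -- most `1 - ε ^ N`.
  have key : ∀ j : ℕ, ∀ σ : M.Scheduler, σ.Follows A → ∀ t ∈ W,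
      1 - (1 - ε ^ N) ^ j ≤ σ.pr t (untilSet Z Y) := by
    intro j
    induction j with
    | zero => intro σ _ t _; simpa using pr_nonneg _ _ _
    | succ j ih =>
      intro σ hσ t ht
      refine le_trans ?_ (pr_until_ge_of_forall_ge
        (fun t ht hY => (hW t ht hY).imp id fun h α hα => (h α hα).1) ih N hσ ht)
      have h1 := pow_le_pr_untilWithin hε hε1 hp hW N hσ ht (hN t)
      have h2 : 0 ≤ (1 - ε ^ N) ^ j := pow_nonneg (by linarith) _
      rw [pow_succ]
      nlinarith
  have hlim : Filter.Tendsto (fun j : ℕ => 1 - (1 - ε ^ N) ^ j) Filter.atTop (nhds (1 - 0)) :=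
    (tendsto_pow_atTop_nhds_zero_of_lt_one (by linarith) (by linarith)).const_sub 1
  rw [sub_zero] at hlim
  exact le_of_tendsto' hlim fun j => key j σ hσ t ht

theorem sat_until_of_mem {Q : ProbQuant} (hQ : Q.Basic) {t : S} (h : t ∈ Y) :
    M.sat Q t (untilSet Z Y) := sat_of_pr_eq_one hQ fun σ => pr_until_of_mem σ h

theorem sat_until_step {Q : ProbQuant} (hQ : Q.Basic) {t : S} (hY : t ∉ Y) (hz : t ∈ Z) :
    M.sat Q t (untilSet Z Y) ↔ M.pre Q {t | M.sat Q t (untilSet Z Y)} t := by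
  refine sat_step hQ (measurableSet_reach _) ?_
  ext ω
  refine scons_mem_reach.trans ?_
  simp [hY, hz]
  rfl

theorem mem_of_sat_until {Q : ProbQuant} (hQ : Q.Basic) {t : S} (hY : t ∉ Y)
    (h : M.sat Q t (untilSet Z Y)) : t ∈ Z := by
  by_contra hz
  exact not_sat_of_pr_eq_zero hQ (fun σ => pr_until_of_notMem σ hY hz) h

theorem sat_nextUntil_iff {Q : ProbQuant} (hQ : Q.Basic) (s : S) :
    M.sat Q s (nextUntil Z Y) ↔ M.pre Q {t | M.sat Q t (untilSet Z Y)} s := by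
  refine sat_step hQ (measurableSet_nextUntil _ _) ?_
  ext ω; exact scons_mem_nextUntil

/-- A path of positive probability leads through `Z` to `Y`; backwards from its end, its states
belong to `V`. -/
theorem sat_exPos_until_least {V : Set S} (hY : Y ⊆ V) (hV : ∀ t ∈ Z, M.pre exPos V t → t ∈ V)
    {t : S} (h : M.sat exPos t (untilSet Z Y)) : t ∈ V := by
  obtain ⟨σ, hσ⟩ := h
  obtain ⟨n, hn⟩ := exists_pr_untilWithin_pos _ hσ
  clear hσ
  induction n generalizing σ t with
  | zero =>
    by_contra ht
    rw [pr_untilWithin_zero _ fun h => ht (hY h)] at hn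
    exact absurd hn (lt_irrefl _)
  | succ n ih =>
    by_cases ht : t ∈ Y
    · exact hY ht
    by_cases hz : t ∈ Z
    · rw [pr_untilWithin_succ _ _ ht hz, M.sum_p_pos fun t => pr_nonneg _ _ _] at hn
      obtain ⟨t', h1, h2⟩ := hn
      exact hV t hz ⟨_, σ.first_mem t, t', h1, ih _ h2⟩
    · rw [pr_untilWithin_of_notMem _ _ ht hz] at hn
      exact absurd hn (lt_irrefl _)

/-- Every state of `Z` outside `V` has an action without successors in `V`. Starting outside `V`,
the memoryless scheduler of these actions reaches `Y` with probability 0. -/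
theorem sat_allPos_until_least {V : Set S} (hY : Y ⊆ V) (hV : ∀ t ∈ Z, M.pre allPos V t → t ∈ V)
    {t : S} (h : M.sat allPos t (untilSet Z Y)) : t ∈ V := by
  by_contra htV
  have : ∀ t, ∃ α ∈ M.enabled t, t ∈ Z → t ∉ V → ∀ t', 0 < M.δ t α t' → t' ∉ V := by
    intro t
    by_cases ht : t ∈ Z ∧ t ∉ V
    · have : ¬ ∀ α ∈ M.enabled t, ∃ t', 0 < M.δ t α t' ∧ t' ∈ V :=
        fun h => ht.2 (hV t ht.1 h)
      push Not at this
      obtain ⟨α, h1, h2⟩ := this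
      exact ⟨α, h1, fun _ _ => h2⟩
    · exact ⟨_, M.anyAct_mem t, fun h1 h2 => absurd ⟨h1, h2⟩ ht⟩
  choose f hf hfV using this
  have key : ∀ n, ∀ t ∉ V, (M.memoryless f hf).pr t (untilWithin Z Y n) ≤ 0 := by
    intro n
    induction n with
    | zero => exact fun t ht => (pr_untilWithin_zero _ fun h => ht (hY h)).le
    | succ n ih =>
      intro t ht
      by_cases hz : t ∈ Z
      · rw [pr_untilWithin_succ _ _ (fun h => ht (hY h)) hz]
        refine Finset.sum_nonpos fun t' _ => ?_
        rw [pr_memoryless_tail]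
        rcases (M.p_nonneg t ((M.memoryless f hf).first t) t').eq_or_lt with h0 | h0
        · simp [← h0]
        · exact mul_nonpos_of_nonneg_of_nonpos h0.le (ih _ (hfV t hz ht t' (M.p_pos.1 h0)))
      · exact (pr_untilWithin_of_notMem _ _ (fun h => ht (hY h)) hz).le
  exact absurd (sat_allPos.1 h (M.memoryless f hf))
    (not_lt.2 (pr_until_le _ fun n => key n t htV))

/-- An almost surely winning scheduler leaves all successors winning, so its actions meet the
restriction in `hV`. The induction follows a horizon within which it succeeds with positive
probability. -/
theorem sat_exOne_until_least {V : Set S} (hY : Y ⊆ V)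
    (hV : ∀ t ∈ Z, ∀ α ∈ M.enabled t, (∀ t', 0 < M.δ t α t' → M.sat exOne t' (untilSet Z Y)) →
      (∃ t', 0 < M.δ t α t' ∧ t' ∈ V) → t ∈ V)
    {t : S} (h : M.sat exOne t (untilSet Z Y)) : t ∈ V := by
  obtain ⟨σ, hσ⟩ := h
  replace hσ : 1 ≤ σ.pr t (untilSet Z Y) := hσ
  obtain ⟨n, hn⟩ := exists_pr_untilWithin_pos σ (one_pos.trans_le hσ)
  induction n generalizing σ t with
  | zero =>
    by_contra ht
    rw [pr_untilWithin_zero _ fun h => ht (hY h)] at hn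
    exact absurd hn (lt_irrefl _)
  | succ n ih =>
    by_cases ht : t ∈ Y
    · exact hY ht
    by_cases hz : t ∈ Z
    · rw [pr_untilWithin_succ _ _ ht hz, M.sum_p_pos fun t => pr_nonneg _ _ _] at hn
      obtain ⟨t', h1, h2⟩ := hn
      rw [pr_until_step _ ht hz, M.sum_p_eq_one fun t => pr_le_one _ _ _] at hσ
      exact hV t hz _ (σ.first_mem t) (fun t'' h'' => ⟨_, hσ t'' h''⟩)
        ⟨t', h1, ih _ (hσ t' h1) h2⟩
    · rw [pr_untilWithin_of_notMem _ _ ht hz] at hn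
      exact absurd hn (lt_irrefl _)

end QualitativeUntil

/-! ### Stages and ranks of a least fixed point. -/

section Stages

variable {S : Type u}

/-- The stages of the least set that contains `Y` and is closed under adding states that satisfy
`P V`. -/
def stage (P : Set S → S → Prop) (Y : Set S) : ℕ → Set S
  | 0 => Y
  | n + 1 => stage P Y n ∪ {t | P (stage P Y n) t}

theorem stage_mono (P : Set S → S → Prop) (Y : Set S) : Monotone (stage P Y) :=
  monotone_nat_of_le_succ fun _ => Set.subset_union_left

open Classical in
/-- The first stage that contains `t`. -/
def stageRank (P : Set S → S → Prop) (Y : Set S) (t : S) : ℕ :=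
  if h : ∃ n, t ∈ stage P Y n then Nat.find h else 0

/-- A state outside `Y` first appears at some stage `n + 1`, because of `P` at stage `n`; everything
in stage `n` has rank at most `n`. -/
theorem stageRank_lt {P : Set S → S → Prop} {Y : Set S}
    {t : S} (ht : ∃ n, t ∈ stage P Y n) (hY : t ∉ Y) :
    ∃ n, P (stage P Y n) t ∧ ∀ t' ∈ stage P Y n, stageRank P Y t' < stageRank P Y t := by
  classical
  have hr : stageRank P Y t = Nat.find ht := by simp [stageRank, ht]
  have hspec := Nat.find_spec ht
  have hmin := fun m => Nat.find_min ht (m := m)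
  rw [← hr] at hspec hmin
  rcases h : stageRank P Y t with _ | n
  · rw [h] at hspec
    exact absurd hspec hY
  · rw [h] at hspec hmin
    refine ⟨n, ?_, fun t' ht' => ?_⟩
    · rcases hspec with h' | h'
      · exact absurd h' (hmin n (by omega))
      · exact h'
    · have he : ∃ n, t' ∈ stage P Y n := ⟨n, ht'⟩
      have : stageRank P Y t' = Nat.find he := by simp [stageRank, he]
      rw [this]
      exact Nat.lt_succ_of_le (Nat.find_min' he ht')

end Stages

/-! ### Sufficient conditions for almost sure success. -/

section QualitativeUntilSufficient

variable {S : Type u} {Act : Type v} {AP : Type w} [Fintype S] [MeasurableSpace S]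
  [DiscreteMeasurableSpace S] [Finite Act] {M : MDP S Act AP} {Z Y : Set S}

/-- Minimality shows that the attractor stages exhaust `W`. A memoryless scheduler picks actions
that stay in `W` and may decrease the rank, so `pr_until_eq_one_of_rank` applies. -/
theorem sat_exOne_until_of_least {W : Set S}
    (hW : ∀ V : Set S, Y ⊆ V → (∀ t ∈ Z, ∀ α ∈ M.enabled t, (∀ t', 0 < M.δ t α t' → t' ∈ W) →
      (∃ t', 0 < M.δ t α t' ∧ t' ∈ V) → t ∈ V) → W ⊆ V) {t : S} (ht : t ∈ W) :
    M.sat exOne t (untilSet Z Y) := by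
  set P : Set S → S → Prop := fun V t => t ∈ Z ∧ ∃ α ∈ M.enabled t,
    (∀ t', 0 < M.δ t α t' → t' ∈ W) ∧ ∃ t', 0 < M.δ t α t' ∧ t' ∈ V
  have hst : W ⊆ {t | ∃ n, t ∈ stage P Y n} := by
    refine hW _ (fun t ht => ⟨0, ht⟩) ?_
    rintro t hz α hα h1 ⟨t', h2, n, h3⟩
    exact ⟨n + 1, Or.inr ⟨hz, α, hα, h1, t', h2, h3⟩⟩
  have : ∀ t, ∃ α ∈ M.enabled t, t ∈ W → t ∉ Y → t ∈ Z ∧ (∀ t', 0 < M.δ t α t' → t' ∈ W) ∧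
      ∃ t', 0 < M.δ t α t' ∧ stageRank P Y t' < stageRank P Y t := by
    intro t
    by_cases h : t ∈ W ∧ t ∉ Y
    · obtain ⟨n, ⟨hz, α, hα, h1, t', h2, h3⟩, hn⟩ := stageRank_lt (hst h.1) h.2
      exact ⟨α, hα, fun _ _ => ⟨hz, h1, t', h2, hn t' h3⟩⟩
    · exact ⟨_, M.anyAct_mem t, fun h1 h2 => absurd ⟨h1, h2⟩ h⟩
  choose f hf hfW using this
  refine ⟨M.memoryless f hf, pr_until_eq_one_of_rank (A := fun t => {f t}) (W := W)
    (ρ := stageRank P Y) (σ := M.memoryless f hf) (fun t ht hY => ?_)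
    (fun n ω => Set.mem_singleton_iff.2 rfl) ht⟩
  obtain ⟨h1, h2⟩ := hfW t ht hY
  refine ⟨h1, fun α hα => ?_⟩
  rw [Set.mem_singleton_iff] at hα
  exact hα ▸ h2

/-- If success is possible under every scheduler, the stages rank the states so that each enabled
action may decrease the rank. As `W` is closed before `Y` is reached, this repeats forever until
success. -/
theorem sat_allOne_until_of_closed {W : Set S}
    (hW : ∀ t ∈ W, t ∉ Y → ∀ α ∈ M.enabled t, ∀ t', 0 < M.δ t α t' → t' ∈ W)
    (hpos : ∀ t ∈ W, M.sat allPos t (untilSet Z Y)) {t : S} (ht : t ∈ W) :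
    M.sat allOne t (untilSet Z Y) := by
  set P : Set S → S → Prop := fun V t => t ∈ Z ∧ M.pre allPos V t
  have hst : W ⊆ {t | ∃ n, t ∈ stage P Y n} := by
    refine fun t ht => sat_allPos_until_least
      (V := {t | ∃ n, t ∈ stage P Y n}) (fun t ht => ⟨0, ht⟩) ?_ (hpos t ht)
    intro t hz hpre
    have : ∀ α, ∃ n, α ∈ M.enabled t → ∃ t', 0 < M.δ t α t' ∧ t' ∈ stage P Y n := by
      intro α
      by_cases hα : α ∈ M.enabled t
      · obtain ⟨t', h1, n, h2⟩ := hpre α hα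
        exact ⟨n, fun _ => ⟨t', h1, h2⟩⟩
      · exact ⟨0, fun h => absurd h hα⟩
    choose n hn using this
    -- Different actions may hit different stages; the supremum over the finitely many enabled
    -- actions serves them all.
    refine ⟨(M.enabled t).sup n + 1, Or.inr ⟨hz, fun α hα => ?_⟩⟩
    obtain ⟨t', h1, h2⟩ := hn α hα
    exact ⟨t', h1, stage_mono P Y (Finset.le_sup hα) h2⟩
  intro σ
  refine pr_until_eq_one_of_rank (A := fun t => M.enabled t) (W := W)
    (ρ := stageRank P Y) (fun t ht hY => ?_) (fun n ω => σ.choose_mem n _) ht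
  obtain ⟨n, ⟨hz, hpre⟩, hn⟩ := stageRank_lt (hst ht) hY
  refine ⟨hz, fun α hα => ⟨hW t ht hY α hα, ?_⟩⟩
  obtain ⟨t', h1, h2⟩ := hpre α hα
  exact ⟨t', h1, hn t' h2⟩

end QualitativeUntilSufficient

/-! ### Correctness and termination of the greedy algorithm. -/

section Greedy

theorem MDP.exists_le_rew {S : Type u} {Act : Type v} {AP : Type w} [Finite S]
    (M : MDP S Act AP) :
    ∃ ε : ℝ, 0 < ε ∧ ∀ s, M.rew s ≠ 0 → ε ≤ M.rew s := by
  by_cases hne : {s | M.rew s ≠ 0}.Nonempty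
  · obtain ⟨s, hs, hmin⟩ := Set.exists_min_image _ (fun s => (M.rew s : ℝ)) (Set.toFinite _) hne
    exact ⟨M.rew s, by exact_mod_cast pos_iff_ne_zero.2 hs, hmin⟩
  · exact ⟨1, one_pos, fun s h => absurd ⟨s, h⟩ hne⟩

variable {S : Type u} {Act : Type v} {AP : Type w} [Fintype S] [MeasurableSpace S]
  [DiscreteMeasurableSpace S] {M : MDP S Act AP} {Q : ProbQuant} {a b : AP}

theorem sat_untilLE_mono (hQ : Q.Basic) {s : S} {r r' : ℝ} (h : r ≤ r')
    (hs : M.sat Q s (M.untilLE a b r)) : M.sat Q s (M.untilLE a b r') :=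
  sat_mono hQ (M.untilLE_mono a b h) hs

theorem nonneg_of_sat_untilLE (hQ : Q.Basic) {s : S} {r : ℝ}
    (hs : M.sat Q s (M.untilLE a b r)) : 0 ≤ r := by
  by_contra! hr
  rw [M.untilLE_of_neg a b hr] at hs
  exact not_sat_of_pr_eq_zero hQ (fun σ => σ.pr_empty s) hs

theorem sat_untilLE_of_b (hQ : Q.Basic) {s : S} {r : ℝ} (hb : b ∈ M.label s) (hr : 0 ≤ r) :
    M.sat Q s (M.untilLE a b r) :=
  sat_of_pr_eq_one hQ fun σ => σ.pr_untilLE_of_b hb hr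

theorem mem_a_of_sat_untilLE (hQ : Q.Basic) {s : S} {r : ℝ} (hb : b ∉ M.label s)
    (hs : M.sat Q s (M.untilLE a b r)) : a ∈ M.label s := by
  by_contra ha
  exact not_sat_of_pr_eq_zero hQ (fun σ => σ.pr_untilLE_of_notMem r ha hb) hs

theorem sat_nextUntil_mono (hQ : Q.Basic) {s : S} {Z Y Y' : Set S} (h : Y ⊆ Y')
    (hs : M.sat Q s (nextUntil Z Y)) : M.sat Q s (nextUntil Z Y') :=
  sat_mono hQ (A := nextUntil Z Y) (fun _ ⟨k, h1, h2⟩ => ⟨k, h h1, h2⟩) hs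

theorem not_sat_nextUntil_empty (hQ : Q.Basic) {s : S} {Z : Set S} :
    ¬ M.sat Q s (nextUntil Z ∅) := by
  have : nextUntil Z ∅ = (∅ : Set (ℕ → S)) := by
    ext ω; simp [nextUntil]
  rw [this]
  exact not_sat_of_pr_eq_zero hQ fun σ => σ.pr_empty s

theorem exitStates_mono (hQ : Q.Basic) {r r' : ℝ} (h : r ≤ r') :
    M.exitStates Q a b r ⊆ M.exitStates Q a b r' :=
  fun _ ht => ⟨ht.1, sat_untilLE_mono hQ h ht.2⟩

/-- The invariant of the greedy algorithm after the value `r` has been processed. -/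
structure GreedyInv (M : MDP S Act AP) (Q : ProbQuant) (a b : AP) (g : GreedyState S) (r : ℝ) :
    Prop where
  mem_X : ∀ s, s ∈ g.X ↔ b ∈ M.label s ∨
    a ∈ M.label s ∧ M.sat Q s (nextUntil (M.zeroStates a b) (M.exitStates Q a b r))
  v_eq : ∀ s ∈ g.X, ∃ x : ℝ, g.v s = x ∧ ∀ ρ, M.sat Q s (M.untilLE a b ρ) ↔ x ≤ ρ
  v_top : ∀ s ∉ g.X, g.v s = ⊤
  lt_of_mem_R : ∀ x ∈ g.R, r < x
  mem_R : ∀ s ∈ g.X, ∀ x : ℝ, g.v s = x → r < x → x ∈ g.R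
  R_sub : (g.X = ∅ ∧ g.R ⊆ {0}) ∨ ∀ x ∈ g.R, ∃ s ∈ g.X, g.v s = (x : EReal)

/-- Any negative number can play the value processed before the first round: with a negative bound
nothing is satisfied, so there are no exit states. -/
theorem greedyInv_start (hQ : Q.Basic) : GreedyInv M Q a b (M.greedyStart b) (-1) where
  mem_X s := by
    have : M.exitStates Q a b (-1) = ∅ := by
      ext t
      simp only [Set.mem_empty_iff_false, iff_false]
      exact fun h => absurd (nonneg_of_sat_untilLE hQ h.2) (by norm_num)
    rw [this]
    simp [MDP.greedyStart, not_sat_nextUntil_empty hQ]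
  v_eq s hs := by
    have hs' : b ∈ M.label s := hs
    refine ⟨0, by simp [MDP.greedyStart, hs'], fun ρ => ⟨nonneg_of_sat_untilLE hQ,
      sat_untilLE_of_b hQ hs'⟩⟩
  v_top s hs := by
    have hs' : b ∉ M.label s := hs
    simp [MDP.greedyStart, hs']
  lt_of_mem_R x hx := by
    have : x = 0 := by simpa [MDP.greedyStart] using hx
    rw [this]; norm_num
  mem_R s hs x hx _ := by
    have hs' : b ∈ M.label s := hs
    have : (0 : EReal) = x := by simpa [MDP.greedyStart, hs'] using hx
    have : x = 0 := by exact_mod_cast this.symm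
    simp [MDP.greedyStart, this]
  R_sub := by
    by_cases h : ∃ s, b ∈ M.label s
    · obtain ⟨s, hs⟩ := h
      refine Or.inr fun x hx => ⟨s, hs, ?_⟩
      have : x = 0 := by simpa [MDP.greedyStart] using hx
      simp [MDP.greedyStart, hs, this]
    · push Not at h
      left
      refine ⟨?_, fun x hx => hx⟩
      ext s
      simp [MDP.greedyStart, h]

/-- No exit states appear between the processed value and the next one. -/
theorem GreedyInv.exitStates_subset {g : GreedyState S} {r : ℝ} (hQ : Q.Basic)
    (H : GreedyInv M Q a b g r) {r' : ℝ} (hr' : ∀ x ∈ g.R, r' ≤ x) {ρ : ℝ} (hρ : ρ < r') :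
    M.exitStates Q a b ρ ⊆ M.exitStates Q a b r := by
  -- Nonzero rewards are at least `ε`, so a bound `ρ` can be reduced by them only about `ρ / ε`
  -- times; this is the induction parameter.
  obtain ⟨ε, hε, hrew⟩ := M.exists_le_rew
  obtain ⟨n, hn⟩ := exists_nat_gt (ρ / ε)
  rw [div_lt_iff₀ hε] at hn
  induction n generalizing ρ with
  | zero =>
    intro t ht
    have := nonneg_of_sat_untilLE hQ ht.2
    simp at hn
    linarith
  | succ n ih =>
    rintro t ⟨hz, ht⟩
    have hX : t ∈ g.X := by
      rw [H.mem_X]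
      by_cases hb : b ∈ M.label t
      · exact Or.inl hb
      have ha := mem_a_of_sat_untilLE hQ hb ht
      have hne : M.rew t ≠ 0 := fun h0 => hz ⟨ha, hb, h0⟩
      have hle := hrew t hne
      -- By induction, the exit states for the reduced bound are exit states for `r`, so `t` has
      -- been discovered.
      refine Or.inr ⟨ha, sat_nextUntil_mono hQ (ih (ρ := ρ - M.rew t) ?_ ?_)
        ((sat_untilLE_iff_nextUntil hQ ha hb).1 ht)⟩
      · linarith
      · push_cast at hn
        linarith
    obtain ⟨x, hx, hB⟩ := H.v_eq t hX
    refine ⟨hz, (hB r).2 ?_⟩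
    -- Otherwise the value of `t` is waiting in `R` and is at least `r'`, although `t` succeeds with
    -- `ρ < r'`.
    by_contra! hlt
    have h1 := hr' x (H.mem_R t hX x hx hlt)
    have h2 := (hB ρ).1 ht
    linarith

/-- A state with `a` and without `b` outside `zeroStates` pays a positive reward first. Its success
with bound `r'` thus relies on exit states for a smaller bound, which are known by
`exitStates_subset`. Hence the set Y computed by the algorithm is the right one. -/
theorem GreedyInv.exitStates_eq {g : GreedyState S} {r : ℝ} (hQ : Q.Basic)
    (H : GreedyInv M Q a b g r) {r' : ℝ} (hr' : ∀ x ∈ g.R, r' ≤ x) :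
    {t | t ∈ g.X ∧ g.v t ≤ (r' : EReal)} \ M.zeroStates a b = M.exitStates Q a b r' := by
  ext t
  constructor
  · rintro ⟨⟨hX, hv⟩, hz⟩
    obtain ⟨x, hx, hB⟩ := H.v_eq t hX
    rw [hx] at hv
    exact ⟨hz, (hB r').2 (by exact_mod_cast hv)⟩
  · rintro ⟨hz, ht⟩
    have hX : t ∈ g.X := by
      rw [H.mem_X]
      by_cases hb : b ∈ M.label t
      · exact Or.inl hb
      have ha := mem_a_of_sat_untilLE hQ hb ht
      have hpos : (0 : ℝ) < M.rew t := by
        have : M.rew t ≠ 0 := fun h0 => hz ⟨ha, hb, h0⟩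
        exact_mod_cast pos_iff_ne_zero.2 this
      exact Or.inr ⟨ha, sat_nextUntil_mono hQ (H.exitStates_subset hQ hr' (by linarith))
        ((sat_untilLE_iff_nextUntil hQ ha hb).1 ht)⟩
    obtain ⟨x, hx, hB⟩ := H.v_eq t hX
    exact ⟨⟨hX, by rw [hx]; exact_mod_cast (hB r').1 ht⟩, hz⟩

theorem MDP.greedyRound_of_nonempty {g : GreedyState S} (h : g.R.Nonempty) :
    M.greedyRound Q a b g =
      { v := by classical exact fun s => if s ∈ M.discovered Q a b g (g.R.min' h) then
          ((g.R.min' h + M.rew s : ℝ) : EReal) else g.v s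
        X := g.X ∪ M.discovered Q a b g (g.R.min' h)
        R := by classical exact (g.R ∪ (Finset.univ.filter (· ∈ M.discovered Q a b g
          (g.R.min' h))).image fun s => g.R.min' h + (M.rew s : ℝ)).erase (g.R.min' h) } := by
  classical
  rw [MDP.greedyRound, dif_pos h]

theorem MDP.greedyRound_of_empty {g : GreedyState S} (h : g.R = ∅) :
    M.greedyRound Q a b g = g := by
  rw [MDP.greedyRound, dif_neg (by simp [h])]

/-- A discovered `s` succeeds with bound `ρ` iff it has the next-until property for the exit states
at `ρ - M.rew s`. It has this property at `r'`. Below `r'` there are no exit states besides those at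
`r`, for which `s` was not discovered. So its threshold is `r' + M.rew s`. -/
theorem GreedyInv.round {g : GreedyState S} {r : ℝ} (hQ : Q.Basic)
    (H : GreedyInv M Q a b g r) (hR : g.R.Nonempty) :
    GreedyInv M Q a b (M.greedyRound Q a b g) (g.R.min' hR) := by
  classical
  set r' := g.R.min' hR with hr'
  have hmin : ∀ x ∈ g.R, r' ≤ x := fun x hx => g.R.min'_le x hx
  have hlt : r < r' := H.lt_of_mem_R _ (g.R.min'_mem hR)
  have hE := H.exitStates_eq hQ hmin
  have hD : ∀ s, s ∈ M.discovered Q a b g r' ↔ s ∉ g.X ∧ a ∈ M.label s ∧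
      M.sat Q s (nextUntil (M.zeroStates a b) (M.exitStates Q a b r')) := by
    intro s
    rw [← hE]; rfl
  rw [MDP.greedyRound_of_nonempty hR, ← hr']
  have hold : ∀ s ∈ g.X, s ∉ M.discovered Q a b g r' := fun s hs h => ((hD s).1 h).1 hs
  refine ⟨?_, ?_, ?_, ?_, ?_, ?_⟩
  · intro s
    simp only [Set.mem_union, hD, H.mem_X]
    constructor
    · rintro ((h | ⟨h1, h2⟩) | ⟨-, h⟩)
      · exact Or.inl h
      · exact Or.inr ⟨h1, sat_nextUntil_mono hQ (exitStates_mono hQ hlt.le) h2⟩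
      · exact Or.inr h
    · tauto
  · rintro s (hs | hs)
    · simpa only [hold s hs, if_false] using H.v_eq s hs
    · refine ⟨r' + M.rew s, by simp only [hs, if_true], fun ρ => ?_⟩
      obtain ⟨h1, ha, hN⟩ := (hD s).1 hs
      have hb : b ∉ M.label s := fun hb => h1 ((H.mem_X s).2 (Or.inl hb))
      rw [sat_untilLE_iff_nextUntil hQ ha hb]
      constructor
      · intro h
        by_contra! hρ
        exact h1 ((H.mem_X s).2 (Or.inr ⟨ha, sat_nextUntil_mono hQ
          (H.exitStates_subset hQ hmin (by linarith)) h⟩))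
      · exact fun h => sat_nextUntil_mono hQ (exitStates_mono hQ (by linarith)) hN
  · intro s hs
    simp only [Set.mem_union, not_or] at hs
    simpa only [hs.2, if_false] using H.v_top s hs.1
  · intro x hx
    simp only [Finset.mem_erase, Finset.mem_union, Finset.mem_image, Finset.mem_filter,
      Finset.mem_univ, true_and] at hx
    obtain ⟨hne, hx | ⟨s, -, rfl⟩⟩ := hx
    · exact lt_of_le_of_ne (hmin x hx) (Ne.symm hne)
    -- A discovered state with reward 0 contributes `r'` itself, which is erased together with the
    -- processed value.
    · exact lt_of_le_of_ne (by have := (M.rew s).coe_nonneg; linarith) (Ne.symm hne)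
  · rintro s (hs | hs) x hx hrx
    · simp only [hold s hs, if_false] at hx
      simp only [Finset.mem_erase, Finset.mem_union]
      exact ⟨hrx.ne', Or.inl (H.mem_R s hs x hx (hlt.trans hrx))⟩
    · simp only [hs, if_true] at hx
      have hx' : r' + M.rew s = x := by exact_mod_cast hx
      simp only [Finset.mem_erase, Finset.mem_union, Finset.mem_image, Finset.mem_filter,
        Finset.mem_univ, true_and]
      exact ⟨hrx.ne', Or.inr ⟨s, hs, hx'⟩⟩
  -- If no state satisfies `b`, the initial 0 in `R` is not the value of a state; then nothing is
  -- ever discovered.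
  · rcases H.R_sub with ⟨hX, hR0⟩ | h
    · left
      have hN : M.discovered Q a b g r' = ∅ := by
        ext s
        simp only [Set.mem_empty_iff_false, iff_false]
        rintro ⟨-, -, h3⟩
        have : {t | t ∈ g.X ∧ g.v t ≤ (r' : EReal)} \ M.zeroStates a b = ∅ := by
          rw [hX]; ext; simp
        rw [this] at h3
        exact not_sat_nextUntil_empty hQ h3
      rw [hN]
      refine ⟨by simp [hX], ?_⟩
      simp only [Set.mem_empty_iff_false, Finset.filter_false, Finset.image_empty,
        Finset.union_empty]
      exact (Finset.erase_subset _ _).trans hR0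
    · right
      intro x hx
      simp only [Finset.mem_erase, Finset.mem_union, Finset.mem_image, Finset.mem_filter,
        Finset.mem_univ, true_and] at hx
      obtain ⟨hne, hx | ⟨s, hs, rfl⟩⟩ := hx
      · obtain ⟨s, hs, hv⟩ := h x hx
        exact ⟨s, Or.inl hs, by simp only [hold s hs, if_false, hv]⟩
      · exact ⟨s, Or.inr hs, by simp only [hs, if_true]⟩

/-- The state of the greedy algorithm after `k` rounds. -/
def MDP.greedyIter (M : MDP S Act AP) (Q : ProbQuant) (a b : AP) (k : ℕ) : GreedyState S :=
  (M.greedyRound Q a b)^[k] (M.greedyStart b)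

theorem MDP.greedyIter_succ (k : ℕ) :
    M.greedyIter Q a b (k + 1) = M.greedyRound Q a b (M.greedyIter Q a b k) :=
  Function.iterate_succ_apply' _ _ _

theorem greedyRound_X_subset (g : GreedyState S) : g.X ⊆ (M.greedyRound Q a b g).X := by
  by_cases hR : g.R.Nonempty
  · rw [MDP.greedyRound_of_nonempty hR]
    exact Set.subset_union_left
  · rw [MDP.greedyRound_of_empty (Finset.not_nonempty_iff_eq_empty.1 hR)]

theorem greedyRound_v {g : GreedyState S} {s : S} (h : s ∈ g.X) :
    (M.greedyRound Q a b g).v s = g.v s := by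
  by_cases hR : g.R.Nonempty
  · rw [MDP.greedyRound_of_nonempty hR]
    have : s ∉ M.discovered Q a b g (g.R.min' hR) := fun h' => h'.1 h
    simp [this]
  · rw [MDP.greedyRound_of_empty (Finset.not_nonempty_iff_eq_empty.1 hR)]

/-- A processed value is attained by some state and exceeds all earlier ones, so each round counts
one more state with value at most `r`. The exception is the artificial 0 in `R` when `X` is empty,
after which `R` is empty. -/
theorem greedyIter_inv (hQ : Q.Basic) (k : ℕ) :
    ∃ r, GreedyInv M Q a b (M.greedyIter Q a b k) r ∧ ((M.greedyIter Q a b k).R = ∅ ∨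
      k ≤ {s | s ∈ (M.greedyIter Q a b k).X ∧ (M.greedyIter Q a b k).v s ≤ (r : EReal)}.ncard) := by
  induction k with
  | zero => exact ⟨-1, greedyInv_start hQ, Or.inr (Nat.zero_le _)⟩
  | succ k ih =>
    obtain ⟨r, H, hk⟩ := ih
    rw [MDP.greedyIter_succ]
    set g := M.greedyIter Q a b k
    by_cases hR : g.R.Nonempty
    · have hk := hk.resolve_left hR.ne_empty
      have H' := H.round hQ hR
      refine ⟨_, H', ?_⟩
      rcases H.R_sub with ⟨hX, h0⟩ | h
      · left
        have hmin : g.R.min' hR = 0 := by simpa using h0 (g.R.min'_mem hR)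
        rcases H'.R_sub with ⟨-, h1⟩ | h1
        · by_contra hne
          obtain ⟨x, hx⟩ := Finset.nonempty_iff_ne_empty.2 hne
          have h2 := H'.lt_of_mem_R x hx
          have h3 : x = 0 := by simpa using h1 hx
          rw [hmin, h3] at h2
          exact lt_irrefl _ h2
        · by_contra hne
          obtain ⟨x, hx⟩ := Finset.nonempty_iff_ne_empty.2 hne
          obtain ⟨s, hs, -⟩ := h1 x hx
          rw [MDP.greedyRound_of_nonempty hR] at hs
          rcases hs with hs | ⟨-, -, h3⟩
          · rw [hX] at hs; exact hs
          · have : {t | t ∈ g.X ∧ g.v t ≤ ((g.R.min' hR : ℝ) : EReal)} \ M.zeroStates a b = ∅ := by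
              rw [hX]; ext; simp
            rw [this] at h3
            exact not_sat_nextUntil_empty hQ h3
      · right
        obtain ⟨s, hs, hv⟩ := h _ (g.R.min'_mem hR)
        have hlt : r < g.R.min' hR := H.lt_of_mem_R _ (g.R.min'_mem hR)
        refine (Nat.succ_le_succ hk).trans (Nat.succ_le_of_lt (Set.ncard_lt_ncard ?_))
        rw [Set.ssubset_iff_of_subset]
        · refine ⟨s, ⟨greedyRound_X_subset g hs, by rw [greedyRound_v hs, hv]⟩, fun h => ?_⟩
          have := h.2
          rw [hv] at this
          exact absurd (by exact_mod_cast this) (not_le.2 hlt)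
        · rintro t ⟨h1, h2⟩
          exact ⟨greedyRound_X_subset g h1, by
            rw [greedyRound_v h1]; exact h2.trans (by exact_mod_cast hlt.le)⟩
    · rw [Finset.not_nonempty_iff_eq_empty] at hR
      rw [MDP.greedyRound_of_empty hR]
      exact ⟨r, H, Or.inl hR⟩

/-- A state whose value is still in `R` is not counted in `greedyIter_inv`; this makes the
inequality strict. -/
theorem lt_card_of_greedyIter_nonempty [Nonempty S] (hQ : Q.Basic) {k : ℕ}
    (h : (M.greedyIter Q a b k).R.Nonempty) : k < Fintype.card S := by
  obtain ⟨r, H, hk⟩ := greedyIter_inv (M := M) (a := a) (b := b) hQ k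
  have hk := hk.resolve_left h.ne_empty
  rcases H.R_sub with ⟨hX, -⟩ | h'
  · have : k ≤ 0 := hk.trans (by simp [hX])
    have := Fintype.card_pos (α := S)
    omega
  · obtain ⟨x, hx⟩ := h
    obtain ⟨s, hs, hv⟩ := h' x hx
    refine hk.trans_lt ?_
    rw [← Nat.card_eq_fintype_card, ← Set.ncard_univ]
    refine Set.ncard_lt_ncard ((Set.ssubset_univ_iff).2 fun hu => ?_)
    have hs' : s ∈ {s | s ∈ (M.greedyIter Q a b k).X ∧
        (M.greedyIter Q a b k).v s ≤ (r : EReal)} := hu ▸ Set.mem_univ s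
    have := hs'.2
    rw [hv] at this
    exact absurd (by exact_mod_cast this) (not_le.2 (H.lt_of_mem_R x hx))

theorem MDP.val_eq_of_forall (hQ : Q.Basic) {s : S} {x : ℝ}
    (h : ∀ ρ, M.sat Q s (M.untilLE a b ρ) ↔ x ≤ ρ) : M.val Q a b s = x := by
  have hv : M.val Q a b s =
      sInf ((fun r : ℝ => (r : EReal)) '' {r | M.sat Q s (M.untilLE a b r)}) := by
    rcases hQ with rfl | rfl | rfl | rfl <;> rfl
  rw [hv]
  refine IsLeast.csInf_eq ⟨⟨x, (h x).2 le_rfl, rfl⟩, ?_⟩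
  rintro _ ⟨y, hy, rfl⟩
  exact EReal.coe_le_coe_iff.2 ((h y).1 hy)

theorem MDP.val_eq_top (hQ : Q.Basic) {s : S}
    (h : ∀ ρ, ¬ M.sat Q s (M.untilLE a b ρ)) : M.val Q a b s = ⊤ := by
  have hv : M.val Q a b s =
      sInf ((fun r : ℝ => (r : EReal)) '' {r | M.sat Q s (M.untilLE a b r)}) := by
    rcases hQ with rfl | rfl | rfl | rfl <;> rfl
  have : {r | M.sat Q s (M.untilLE a b r)} = ∅ := by ext; simp [h]
  rw [hv, this, Set.image_empty, sInf_empty]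

theorem MDP.sat_dual (hQ : Q.Basic) {s : S} {A : Set (ℕ → S)} :
    M.sat Q.dual s A ↔ ¬ M.sat Q s A := by
  rcases hQ with rfl | rfl | rfl | rfl
  · rw [sat_allPos]; push Not; exact Iff.rfl
  · rw [sat_exPos]; push Not; exact Iff.rfl
  · rw [sat_allOne]; push Not; exact Iff.rfl
  · rw [sat_exOne]; push Not; exact Iff.rfl

/-- The bounds accepted by `Q` form an upward closed set, and those accepted by the dual form its
complement; the supremum of the latter is the infimum of the former. -/
theorem MDP.val_dual (hQ : Q.Basic) (s : S) : M.val Q.dual a b s = M.val Q a b s := by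
  have hv : M.val Q.dual a b s =
      sSup ((fun r : ℝ => (r : EReal)) '' {r | M.sat Q.dual s (M.untilLE a b r)}) := by
    rcases hQ with rfl | rfl | rfl | rfl <;> rfl
  have hv' : M.val Q a b s =
      sInf ((fun r : ℝ => (r : EReal)) '' {r | M.sat Q s (M.untilLE a b r)}) := by
    rcases hQ with rfl | rfl | rfl | rfl <;> rfl
  rw [hv, hv']
  refine le_antisymm ?_ ?_
  · refine sSup_le ?_
    rintro _ ⟨x, hx, rfl⟩
    refine le_sInf ?_
    rintro _ ⟨y, hy, rfl⟩
    have hx' := (M.sat_dual hQ).1 hx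
    have : x ≤ y := by
      by_contra! hlt
      exact hx' (sat_untilLE_mono hQ hlt.le hy)
    exact EReal.coe_le_coe_iff.2 this
  -- A real `z` above the supremum is rejected by the dual, hence accepted by `Q`, and so bounds the
  -- infimum.
  · refine EReal.le_of_forall_lt_iff_le.1 fun z hz => ?_
    refine sInf_le ⟨z, ?_, rfl⟩
    by_contra hn
    have hmem : z ∈ {r | M.sat Q.dual s (M.untilLE a b r)} := (M.sat_dual hQ).2 hn
    exact absurd (le_sSup (Set.mem_image_of_mem (fun r : ℝ => (r : EReal)) hmem)) (not_le.2 hz)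

/-- The greedy algorithm computes the values. -/
theorem greedyIter_v_eq_val (hQ : Q.Basic) {k : ℕ} (h : (M.greedyIter Q a b k).R = ∅) (s : S) :
    (M.greedyIter Q a b k).v s = M.val Q a b s := by
  obtain ⟨r, H, -⟩ := greedyIter_inv (M := M) (a := a) (b := b) hQ k
  by_cases hs : s ∈ (M.greedyIter Q a b k).X
  · obtain ⟨x, hx, hB⟩ := H.v_eq s hs
    rw [hx, M.val_eq_of_forall hQ hB]
  · rw [H.v_top s hs, M.val_eq_top hQ]
    intro ρ hρ
    rw [H.mem_X, not_or] at hs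
    have ha := mem_a_of_sat_untilLE hQ hs.1 hρ
    -- As `R` is empty, `r'` is unrestricted, so exit states for arbitrarily large bounds are exit
    -- states for `r`.
    refine hs.2 ⟨ha, sat_nextUntil_mono hQ (H.exitStates_subset hQ (r' := ρ - M.rew s + 1)
      (by simp [h]) (by linarith)) ((sat_untilLE_iff_nextUntil hQ ha hs.1).1 hρ)⟩

theorem greedy_correct [Nonempty S] (hQ : Q.Basic) :
    ∃ N ≤ Fintype.card S,
      ((M.greedyRound Q a b)^[N] (M.greedyStart b)).R = ∅ ∧
      ∀ s, ((M.greedyRound Q a b)^[N] (M.greedyStart b)).v s = M.val Q a b s ∧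
        ((M.greedyRound Q a b)^[N] (M.greedyStart b)).v s = M.val Q.dual a b s := by
  have hR : (M.greedyIter Q a b (Fintype.card S)).R = ∅ := by
    by_contra hne
    exact lt_irrefl _ (lt_card_of_greedyIter_nonempty hQ (Finset.nonempty_iff_ne_empty.2 hne))
  refine ⟨_, le_rfl, hR, fun s => ?_⟩
  have := greedyIter_v_eq_val hQ hR s
  exact ⟨this, this.trans (M.val_dual hQ s).symm⟩

end Greedy

/-! ### A program logic with time and memory bounds. -/

section ProgramLogic

/-- All natural numbers in the memory are at most `B`, and all real numbers satisfy `G`. -/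
structure Store.Ok (B : ℕ) (G : ℝ → Prop) (m : Store) : Prop where
  nreg : ∀ x, m.nreg x ≤ B
  narr : ∀ A i, m.narr A i ≤ B
  rreg : ∀ x, G (m.rreg x)
  rarr : ∀ A i, G (m.rarr A i)

/-- The machine gets from `x` to `y` in `t` steps, and the memory satisfies `I` throughout. -/
def Steps (I : Store → Prop) (t : ℕ) (x y : Config) : Prop :=
  step^[t] x = y ∧ ∀ i ≤ t, I (step^[i] x).2

theorem Steps.single {I : Store → Prop} {x : Config} (h : I x.2) (h' : I (step x).2) :
    Steps I 1 x (step x) :=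
  ⟨rfl, fun i hi => by
    obtain rfl | rfl : i = 0 ∨ i = 1 := by omega
    · exact h
    · exact h'⟩

theorem Steps.trans {I : Store → Prop} {t t' : ℕ} {x y z : Config} (h : Steps I t x y)
    (h' : Steps I t' y z) : Steps I (t + t') x z := by
  refine ⟨by rw [Nat.add_comm, Function.iterate_add_apply, h.1, h'.1], fun i hi => ?_⟩
  rcases Nat.lt_or_ge t i with hlt | hge
  · obtain ⟨k, rfl⟩ := Nat.exists_eq_add_of_lt hlt
    rw [Nat.add_assoc, Nat.add_comm, Function.iterate_add_apply, h.1]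
    exact h'.2 _ (by omega)
  · exact h.2 i hge

/-- The program `c` terminates on `m` within `T` steps, the memory satisfies `I` throughout,
and `R` at the end. -/
def WP (I : Store → Prop) (c : Prog) (T : ℕ) (R : Store → Prop) (m : Store) : Prop :=
  ∃ t ≤ T, ∃ m', (∀ K, Steps I t (c :: K, m) (K, m')) ∧ R m'

variable {I : Store → Prop} {c d : Prog} {T T' : ℕ} {R R' : Store → Prop} {m : Store}

theorem WP.mono (h : WP I c T R m) (hT : T ≤ T') (hR : ∀ m', R m' → R' m') : WP I c T' R' m :=
  let ⟨t, ht, m', h1, h2⟩ := h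
  ⟨t, ht.trans hT, m', h1, hR m' h2⟩

theorem WP.inv (h : WP I c T R m) : WP I c T (fun m' => R m' ∧ I m') m := by
  obtain ⟨t, ht, m', h1, h2⟩ := h
  refine ⟨t, ht, m', h1, h2, ?_⟩
  have := (h1 []).2 t le_rfl
  rwa [(h1 []).1] at this

theorem WP.skip (h : I m) (hR : R m) : WP I .skip 1 R m :=
  ⟨1, le_rfl, m, fun _ => Steps.single h h, hR⟩

theorem WP.instr {i : Instr} (h : I m) (h' : I (i.exec m)) (hR : R (i.exec m)) :
    WP I (.instr i) 1 R m :=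
  ⟨1, le_rfl, i.exec m, fun _ => Steps.single h h', hR⟩

theorem WP.seq (hI : I m) (h : WP I c T (fun m' => WP I d T' R m') m) :
    WP I (.seq c d) (T + T' + 1) R m := by
  obtain ⟨t, ht, m', h1, t', ht', m'', h2, h3⟩ := h
  exact ⟨1 + t + t', by omega, m'', fun K =>
    ((Steps.single (x := (.seq c d :: K, m)) hI hI).trans (h1 (d :: K))).trans (h2 K), h3⟩

theorem WP.ite {t : Test} (hI : I m) (h : t.holds m → WP I c T R m)
    (h' : ¬ t.holds m → WP I d T R m) : WP I (.ite t c d) (T + 1) R m := by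
  by_cases ht : t.holds m
  · obtain ⟨t', ht', m', h1, h2⟩ := h ht
    refine ⟨1 + t', by omega, m', fun K => Steps.trans (y := (c :: K, m)) ?_ (h1 K), h2⟩
    have := Steps.single (x := (.ite t c d :: K, m)) hI hI
    simpa only [step, ht, if_true] using this
  · obtain ⟨t', ht', m', h1, h2⟩ := h' ht
    refine ⟨1 + t', by omega, m', fun K => Steps.trans (y := (d :: K, m)) ?_ (h1 K), h2⟩
    have := Steps.single (x := (.ite t c d :: K, m)) hI hI
    simpa only [step, ht, if_false] using this

theorem WP.loop_false {t : Test} (hI : I m) (ht : ¬ t.holds m) (hR : R m) :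
    WP I (.loop t c) 1 R m := by
  refine ⟨1, le_rfl, m, fun K => ?_, hR⟩
  have := Steps.single (x := (.loop t c :: K, m)) hI hI
  simpa only [step, ht, if_false] using this

theorem WP.loop_true {t : Test} (hI : I m) (ht : t.holds m)
    (h : WP I c T (fun m' => WP I (.loop t c) T' R m') m) :
    WP I (.loop t c) (T + T' + 1) R m := by
  obtain ⟨t1, ht1, m', h1, t2, ht2, m'', h2, h3⟩ := h
  refine ⟨1 + t1 + t2, by omega, m'', fun K => Steps.trans (Steps.trans
    (y := (c :: .loop t c :: K, m)) ?_ (h1 _)) (h2 K), h3⟩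
  have := Steps.single (x := (.loop t c :: K, m)) hI hI
  simpa only [step, ht, if_true] using this

/-! #### Frames -/

/-- The sets of registers and arrays that may be changed. -/
structure Writes where
  nreg : List ℕ
  narr : List ℕ
  rreg : List ℕ
  rarr : List ℕ

def Writes.union (w w' : Writes) : Writes :=
  ⟨w.nreg ++ w'.nreg, w.narr ++ w'.narr, w.rreg ++ w'.rreg, w.rarr ++ w'.rarr⟩

def Instr.writes : Instr → Writes
  | .const x _ | .copy x _ | .add x _ _ | .sub x _ _ | .load x _ _ => ⟨[x], [], [], []⟩
  | .store A _ _ => ⟨[], [A], [], []⟩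
  | .rzero x | .rcopy x _ | .radd x _ _ | .rload x _ _ => ⟨[], [], [x], []⟩
  | .rstore A _ _ => ⟨[], [], [], [A]⟩

def Prog.writes : Prog → Writes
  | .skip => ⟨[], [], [], []⟩
  | .instr i => i.writes
  | .seq c d => c.writes.union d.writes
  | .ite _ c d => c.writes.union d.writes
  | .loop _ c => c.writes

/-- The memories agree outside `w`. -/
structure Agree (w : Writes) (m m' : Store) : Prop where
  nreg : ∀ x ∉ w.nreg, m'.nreg x = m.nreg x
  narr : ∀ A ∉ w.narr, m'.narr A = m.narr A
  rreg : ∀ x ∉ w.rreg, m'.rreg x = m.rreg x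
  rarr : ∀ A ∉ w.rarr, m'.rarr A = m.rarr A

theorem Agree.refl (w : Writes) (m : Store) : Agree w m m :=
  ⟨fun _ _ => rfl, fun _ _ => rfl, fun _ _ => rfl, fun _ _ => rfl⟩

theorem Agree.trans {w : Writes} {m m' m'' : Store} (h : Agree w m m') (h' : Agree w m' m'') :
    Agree w m m'' :=
  ⟨fun x hx => (h'.nreg x hx).trans (h.nreg x hx), fun x hx => (h'.narr x hx).trans (h.narr x hx),
    fun x hx => (h'.rreg x hx).trans (h.rreg x hx), fun x hx => (h'.rarr x hx).trans (h.rarr x hx)⟩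

/-- Inclusion of sets of registers and arrays. -/
structure Writes.Sub (w w' : Writes) : Prop where
  nreg : w.nreg ⊆ w'.nreg
  narr : w.narr ⊆ w'.narr
  rreg : w.rreg ⊆ w'.rreg
  rarr : w.rarr ⊆ w'.rarr

theorem Agree.of_sub {w w' : Writes} {m m' : Store} (h : Agree w m m') (hw : w.Sub w') :
    Agree w' m m' :=
  ⟨fun x hx => h.nreg x fun h' => hx (hw.nreg h'), fun x hx => h.narr x fun h' => hx (hw.narr h'),
    fun x hx => h.rreg x fun h' => hx (hw.rreg h'), fun x hx => h.rarr x fun h' => hx (hw.rarr h')⟩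

theorem Writes.sub_refl (w : Writes) : w.Sub w :=
  ⟨List.Subset.refl _, List.Subset.refl _, List.Subset.refl _, List.Subset.refl _⟩

theorem Writes.sub_trans {w w' w'' : Writes} (h : w.Sub w') (h' : w'.Sub w'') : w.Sub w'' :=
  ⟨fun _ hx => h'.nreg (h.nreg hx), fun _ hx => h'.narr (h.narr hx),
    fun _ hx => h'.rreg (h.rreg hx), fun _ hx => h'.rarr (h.rarr hx)⟩

theorem Writes.sub_union_left (w w' : Writes) : w.Sub (w.union w') :=
  ⟨List.subset_append_left _ _, List.subset_append_left _ _, List.subset_append_left _ _,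
    List.subset_append_left _ _⟩

theorem Writes.sub_union_right (w w' : Writes) : w'.Sub (w.union w') :=
  ⟨List.subset_append_right _ _, List.subset_append_right _ _, List.subset_append_right _ _,
    List.subset_append_right _ _⟩

theorem Instr.agree_exec (i : Instr) (m : Store) : Agree i.writes m (i.exec m) := by
  cases i <;>
  · constructor <;> intro x hx <;>
    simp_all [Instr.writes, Instr.exec, setArr]

/-- A step only unfolds pending programs into their parts, so the pending programs keep writing only
into `w`. -/
theorem agree_step (w : Writes) (x : Config) (h : ∀ c ∈ x.1, c.writes.Sub w) :
    Agree w x.2 (step x).2 ∧ ∀ c ∈ (step x).1, c.writes.Sub w := by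
  classical
  obtain ⟨L, m⟩ := x
  rcases L with _ | ⟨c, K⟩
  · exact ⟨Agree.refl _ _, h⟩
  have hc := h c (by simp)
  have hK : ∀ c' ∈ K, c'.writes.Sub w := fun c' hc' => h c' (by simp [hc'])
  cases c with
  | skip => exact ⟨Agree.refl _ _, hK⟩
  | instr i => exact ⟨(i.agree_exec m).of_sub hc, hK⟩
  | seq c d =>
    refine ⟨Agree.refl _ _, ?_⟩
    simp only [step, List.mem_cons]
    rintro c' (rfl | rfl | h')
    · exact Writes.sub_trans (Writes.sub_union_left _ _) hc
    · exact Writes.sub_trans (Writes.sub_union_right _ _) hc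
    · exact hK c' h'
  | ite t c d =>
    refine ⟨Agree.refl _ _, ?_⟩
    simp only [step]
    split_ifs
    · simp only [List.mem_cons]
      rintro c' (rfl | h')
      · exact Writes.sub_trans (Writes.sub_union_left _ _) hc
      · exact hK c' h'
    · simp only [List.mem_cons]
      rintro c' (rfl | h')
      · exact Writes.sub_trans (Writes.sub_union_right _ _) hc
      · exact hK c' h'
  | loop t c =>
    refine ⟨Agree.refl _ _, ?_⟩
    simp only [step]
    split_ifs
    · simp only [List.mem_cons]
      rintro c' (rfl | rfl | h')
      · exact hc
      · exact hc
      · exact hK c' h'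
    · exact hK

theorem agree_iterate (w : Writes) (t : ℕ) (x : Config) (h : ∀ c ∈ x.1, c.writes.Sub w) :
    Agree w x.2 (step^[t] x).2 := by
  induction t generalizing x with
  | zero => exact Agree.refl _ _
  | succ t ih =>
    rw [Function.iterate_succ_apply]
    exact (agree_step w x h).1.trans (ih _ (agree_step w x h).2)

/-- Programs change only what they write. -/
theorem WP.frame (h : WP I c T R m) :
    WP I c T (fun m' => R m' ∧ I m' ∧ Agree c.writes m m') m := by
  obtain ⟨t, ht, m', h1, h2, h3⟩ := h.inv
  refine ⟨t, ht, m', h1, h2, h3, ?_⟩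
  have := agree_iterate c.writes t ([c], m) (by simpa using Writes.sub_refl _)
  rwa [(h1 []).1] at this

/-! #### Programs without loops -/

open Classical in
/-- The effect of a program without loops. -/
def Prog.den : Prog → Store → Store
  | .skip, m => m
  | .instr i, m => i.exec m
  | .seq c d, m => d.den (c.den m)
  | .ite t c d, m => if t.holds m then c.den m else d.den m
  | .loop _ _, m => m

def Instr.Safe (B : ℕ) (G : ℝ → Prop) : Instr → Store → Prop
  | .const _ k, _ => k ≤ B
  | .add _ y z, m => m.nreg y + m.nreg z ≤ B
  | .radd _ y z, m => G (m.rreg y + m.rreg z)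
  | _, _ => True

/-- The additions in a program without loops do not leave the bounds. -/
def Prog.Safe (B : ℕ) (G : ℝ → Prop) : Prog → Store → Prop
  | .skip, _ => True
  | .instr i, m => i.Safe B G m
  | .seq c d, m => c.Safe B G m ∧ d.Safe B G (c.den m)
  | .ite t c d, m => (t.holds m → c.Safe B G m) ∧ (¬ t.holds m → d.Safe B G m)
  | .loop _ _, _ => False

def Prog.cost : Prog → ℕ
  | .skip => 1
  | .instr _ => 1
  | .seq c d => c.cost + d.cost + 1
  | .ite _ c d => max c.cost d.cost + 1
  | .loop _ _ => 0

variable {B : ℕ} {G : ℝ → Prop}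

theorem update_le {f : ℕ → ℕ} {x y : ℕ} (hf : ∀ i, f i ≤ B) (hy : y ≤ B) (i : ℕ) :
    Function.update f x y i ≤ B := by
  by_cases h : i = x
  · subst h; simpa using hy
  · simpa [Function.update_of_ne h] using hf i

theorem update_good {f : ℕ → ℝ} {x : ℕ} {y : ℝ} (hf : ∀ i, G (f i)) (hy : G y) (i : ℕ) :
    G (Function.update f x y i) := by
  by_cases h : i = x
  · subst h; simpa using hy
  · simpa [Function.update_of_ne h] using hf i

/-- Only constants and additions can leave the bounds; copies, truncated differences and memory
accesses cannot. -/
theorem Store.Ok.exec (hG : G 0) {i : Instr} {m : Store} (h : m.Ok B G) (hi : i.Safe B G m) :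
    (i.exec m).Ok B G := by
  cases i with
  | const x k => exact ⟨update_le h.1 hi, h.2, h.3, h.4⟩
  | copy x y => exact ⟨update_le h.1 (h.1 y), h.2, h.3, h.4⟩
  | add x y z => exact ⟨update_le h.1 hi, h.2, h.3, h.4⟩
  | sub x y z => exact ⟨update_le h.1 ((Nat.sub_le _ _).trans (h.1 y)), h.2, h.3, h.4⟩
  | load x A i => exact ⟨update_le h.1 (h.2 A _), h.2, h.3, h.4⟩
  | store A i x =>
    refine ⟨h.1, fun A' => ?_, h.3, h.4⟩
    by_cases hA : A' = A
    · subst hA; simpa [Instr.exec, setArr] using update_le (h.2 A') (h.1 x)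
    · simpa [Instr.exec, setArr, Function.update_of_ne hA] using h.2 A'
  | rzero x => exact ⟨h.1, h.2, update_good h.3 hG, h.4⟩
  | rcopy x y => exact ⟨h.1, h.2, update_good h.3 (h.3 y), h.4⟩
  | radd x y z => exact ⟨h.1, h.2, update_good h.3 hi, h.4⟩
  | rload x A i => exact ⟨h.1, h.2, update_good h.3 (h.4 A _), h.4⟩
  | rstore A i x =>
    refine ⟨h.1, h.2, h.3, fun A' => ?_⟩
    by_cases hA : A' = A
    · subst hA; simpa [Instr.exec, setArr] using update_good (h.4 A') (h.3 x)
    · simpa [Instr.exec, setArr, Function.update_of_ne hA] using h.4 A'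

/-- Code without loops is verified by evaluating `den` and `Safe`; termination, time and the memory
invariant follow. -/
theorem WP.of_safe (hG : G 0) {m : Store} (hm : m.Ok B G) (hs : c.Safe B G m)
    (hR : R (c.den m)) : WP (Store.Ok B G) c c.cost R m := by
  classical
  induction c generalizing m R with
  | skip => exact WP.skip hm hR
  | instr i => exact WP.instr hm (hm.exec hG hs) hR
  | seq c d ihc ihd =>
    have h1 := (ihc hm hs.1 (R := fun m' => m' = c.den m) rfl).inv
    exact WP.seq hm (h1.mono le_rfl fun m' h => ihd h.2 (h.1 ▸ hs.2) (h.1 ▸ hR))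
  | ite t c d ihc ihd =>
    refine WP.ite hm (fun ht => ?_) fun ht => ?_
    · exact (ihc hm (hs.1 ht) (R := R) (by simpa [Prog.den, ht] using hR)).mono
        (le_max_left _ _) fun _ h => h
    · exact (ihd hm (hs.2 ht) (R := R) (by simpa [Prog.den, ht] using hR)).mono
        (le_max_right _ _) fun _ h => h
  | loop => exact hs.elim

/-! #### Counting loops -/

/-- `for i = 0, …, b - 1`, with the constant `1` in register `4`. -/
def forLoop (i b : ℕ) (c : Prog) : Prog :=
  .seq (.instr (.const i 0)) (.loop (.lt i b) (.seq c (.instr (.add i i 4))))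

/-- An iteration costs `T` for the body and 3 for test, sequencing and increment. By `hreg` the
invariant ignores the counter, which is incremented after the body. The conditions on the registers
written are left to `decide`. -/
theorem WP.forLoop (hG : G 0) {i b N : ℕ} {m₀ : Store} {Inv : ℕ → Store → Prop}
    (hm : m₀.Ok B G) (hb : m₀.nreg b = N) (h1 : m₀.nreg 4 = 1) (hN : N + 1 ≤ B)
    (hi : i ∉ c.writes.nreg := by decide) (hbi : b ∉ i :: c.writes.nreg := by decide)
    (h4 : 4 ∉ i :: c.writes.nreg := by decide)
    (hreg : ∀ k m x, Inv k m → Inv k { m with nreg := Function.update m.nreg i x })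
    (h0 : Inv 0 m₀)
    (hstep : ∀ k < N, ∀ m, m.Ok B G → Agree (forLoop i b c).writes m₀ m → m.nreg i = k →
      Inv k m → WP (Store.Ok B G) c T (Inv (k + 1)) m) :
    WP (Store.Ok B G) (forLoop i b c) (N * (T + 3) + 3)
      (fun m => Inv N m ∧ m.Ok B G ∧ Agree (QuantileMDP.forLoop i b c).writes m₀ m) m₀ := by
  suffices h : WP (Store.Ok B G) (QuantileMDP.forLoop i b c) (N * (T + 3) + 3) (Inv N) m₀ from
    h.frame
  have hsub : ∀ x ∉ i :: c.writes.nreg, x ∉ (QuantileMDP.forLoop i b c).writes.nreg := by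
    intro x hx
    simp only [List.mem_cons, not_or] at hx
    simp [QuantileMDP.forLoop, Prog.writes, Writes.union, Instr.writes, hx.1, hx.2]
  have hcsub : c.writes.Sub (QuantileMDP.forLoop i b c).writes :=
    Writes.sub_trans (Writes.sub_union_left _ _) (Writes.sub_union_right _ _)
  have hisub : (Instr.add i i 4).writes.Sub (QuantileMDP.forLoop i b c).writes :=
    Writes.sub_trans (Writes.sub_union_right _ _) (Writes.sub_union_right _ _)
  have key : ∀ j k, j + k = N → ∀ m, m.Ok B G →
      Agree (QuantileMDP.forLoop i b c).writes m₀ m → m.nreg i = k → Inv k m →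
      WP (Store.Ok B G) (.loop (.lt i b) (.seq c (.instr (.add i i 4)))) (j * (T + 3) + 1)
        (Inv N) m := by
    intro j
    induction j with
    | zero =>
      intro k hk m hm hag hik hInv
      obtain rfl : k = N := by omega
      refine (WP.loop_false hm ?_ hInv).mono (by omega) fun _ h => h
      simp only [Test.holds, hik, hag.nreg b (hsub b hbi), hb]
      omega
    | succ j ih =>
      intro k hk m hm hag hik hInv
      have htest : (Test.lt i b).holds m := by
        simp only [Test.holds, hik, hag.nreg b (hsub b hbi), hb]
        omega
      refine (WP.loop_true (T := T + 1 + 1) (T' := j * (T + 3) + 1) hm htest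
        (WP.seq hm ((hstep k (by omega) m hm hag hik hInv).frame.mono le_rfl ?_))).mono
        (by rw [Nat.succ_mul]; omega) fun _ h => h
      rintro m' ⟨hInv', hm', hag'⟩
      have hi' : m'.nreg i = k := (hag'.nreg i hi).trans hik
      have hag'' : Agree (QuantileMDP.forLoop i b c).writes m₀ m' :=
        hag.trans (hag'.of_sub hcsub)
      have h4' : m'.nreg 4 = 1 := (hag''.nreg 4 (hsub 4 h4)).trans h1
      have hsafe : (Instr.add i i 4).Safe B G m' := by
        simp only [Instr.Safe, hi', h4']
        omega
      refine WP.instr hm' (hm'.exec hG hsafe) (ih (k + 1) (by omega) _ (hm'.exec hG hsafe)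
        (hag''.trans ((Instr.agree_exec _ _).of_sub hisub)) ?_ ?_)
      · simp [Instr.exec, hi', h4']
      · have := hreg (k + 1) m' (k + 1) hInv'
        simpa only [Instr.exec, hi', h4'] using this
  have hsafe : (Instr.const i 0).Safe B G m₀ := Nat.zero_le _
  refine (WP.seq (T := 1) (T' := N * (T + 3) + 1) hm (WP.instr hm (hm.exec hG hsafe)
    (key N 0 (by omega) _ (hm.exec hG hsafe) ((Instr.agree_exec _ _).of_sub
      (Writes.sub_union_left _ _)) ?_ ?_))).mono (by omega) fun _ h => h
  · simp [Instr.exec]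
  · exact hreg 0 m₀ 0 h0

/-- Sequential composition of several programs. -/
def block : List Prog → Prog
  | [] => .skip
  | [c] => c
  | c :: d :: L => .seq c (block (d :: L))

theorem setArr_apply {α : Type} (f : ℕ → ℕ → α) (A i : ℕ) (y : α) (A' : ℕ) :
    setArr f A i y A' = if A' = A then Function.update (f A) i y else f A' := by
  simp only [setArr, Function.update_apply]

end ProgramLogic

/-! ### The attractor problem on indexed data, and processing one transition. -/

section Attractor

/-- The input of the machine without the probabilities: `src c` is the state of the choice `c`,
and `ch j`, `tg j` are the choice and the target of the transition `j`. -/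
structure Inst where
  n : ℕ
  nc : ℕ
  mm : ℕ
  la : ℕ → ℕ
  lb : ℕ → ℕ
  src : ℕ → ℕ
  ch : ℕ → ℕ
  tg : ℕ → ℕ
  rew : ℕ → ℝ
  src_lt : ∀ c < nc, src c < n
  ch_lt : ∀ j < mm, ch j < nc
  tg_lt : ∀ j < mm, tg j < n

namespace Inst

variable (g : Inst)

open Classical in
/-- The flags of the states that satisfy `a ∧ ¬ b` and have reward `0`. -/
def zf (s : ℕ) : ℕ := if s < g.n ∧ g.la s = 1 ∧ g.lb s = 0 ∧ g.rew s ≤ 0 then 1 else 0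

/-- The transitions into `t` with an index below `k`, in decreasing order. -/
def inListBelow (t : ℕ) : ℕ → List ℕ
  | 0 => []
  | k + 1 => if g.tg k = t then k :: inListBelow t k else inListBelow t k

/-- The transitions into `t`. -/
def inList (t : ℕ) : List ℕ := g.inListBelow t g.mm

theorem mem_inListBelow {t k j : ℕ} : j ∈ g.inListBelow t k ↔ j < k ∧ g.tg j = t := by
  induction k with
  | zero => simp [inListBelow]
  | succ k ih =>
    unfold inListBelow
    split_ifs with h
    · rw [List.mem_cons, ih]
      constructor
      · rintro (rfl | h')
        · exact ⟨by omega, h⟩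
        · exact ⟨by omega, h'.2⟩
      · rintro ⟨h1, h2⟩
        rcases Nat.lt_succ_iff_lt_or_eq.1 h1 with h3 | h3
        · exact Or.inr ⟨h3, h2⟩
        · exact Or.inl h3
    · rw [ih]
      constructor
      · exact fun h' => ⟨by omega, h'.2⟩
      · rintro ⟨h1, h2⟩
        refine ⟨?_, h2⟩
        rcases Nat.lt_succ_iff_lt_or_eq.1 h1 with h3 | h3
        · exact h3
        · subst h3; exact absurd h2 h

/-- Every transition has exactly one target. This bounds the total work of the attractor program. -/
theorem sum_length_inListBelow (k : ℕ) (hk : k ≤ g.mm) :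
    ∑ t ∈ Finset.range g.n, (g.inListBelow t k).length = k := by
  induction k with
  | zero => simp [inListBelow]
  | succ k ih =>
    have h : ∀ t, (g.inListBelow t (k + 1)).length =
        (g.inListBelow t k).length + if g.tg k = t then 1 else 0 := by
      intro t
      rw [inListBelow]
      split_ifs <;> simp
    simp only [h, Finset.sum_add_distrib, ih (by omega)]
    rw [Finset.sum_ite_eq, if_pos (Finset.mem_range.2 (g.tg_lt k (by omega)))]

/-- The number of choices of a state, among the first `k` choices. -/
def nchBelow (k s : ℕ) : ℕ := ((Finset.range k).filter fun c => g.src c = s).card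

open Classical in
/-- The number of choices of `s` outside `H` that have a transition in `J`. -/
def cnt (H J : ℕ → Prop) (s : ℕ) : ℕ :=
  ((Finset.range g.nc).filter fun c => g.src c = s ∧ ¬ H c ∧
    ∃ j < g.mm, g.ch j = c ∧ J j).card

theorem cnt_mono {H J J' : ℕ → Prop} (h : ∀ j < g.mm, J j → J' j) (s : ℕ) :
    g.cnt H J s ≤ g.cnt H J' s := by
  classical
  refine Finset.card_le_card fun c hc => ?_
  simp only [Finset.mem_filter] at hc ⊢
  obtain ⟨h1, h2, h3, j, hj, h4, h5⟩ := hc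
  exact ⟨h1, h2, h3, j, hj, h4, h j hj h5⟩

theorem cnt_congr {H J J' : ℕ → Prop} (h : ∀ j < g.mm, (J j ↔ J' j)) (s : ℕ) :
    g.cnt H J s = g.cnt H J' s :=
  le_antisymm (g.cnt_mono (fun j hj => (h j hj).1) s) (g.cnt_mono (fun j hj => (h j hj).2) s)

theorem cnt_insert_old {H J : ℕ → Prop} {j : ℕ}
    (h : H (g.ch j) ∨ ∃ i < g.mm, g.ch i = g.ch j ∧ J i) (s : ℕ) :
    g.cnt H (fun i => J i ∨ i = j) s = g.cnt H J s := by
  classical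
  refine le_antisymm (Finset.card_le_card fun c hc => ?_) (g.cnt_mono (fun _ _ => Or.inl) s)
  simp only [Finset.mem_filter] at hc ⊢
  obtain ⟨h1, h2, h3, i, hi, h4, h5⟩ := hc
  refine ⟨h1, h2, h3, ?_⟩
  rcases h5 with h5 | rfl
  · exact ⟨i, hi, h4, h5⟩
  · subst h4
    exact h.resolve_left h3

theorem cnt_insert_new {H J : ℕ → Prop} {j : ℕ} (hj : j < g.mm)
    (h : ¬ H (g.ch j)) (h' : ¬ ∃ i < g.mm, g.ch i = g.ch j ∧ J i) (s : ℕ) :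
    g.cnt H (fun i => J i ∨ i = j) s =
      g.cnt H J s + if g.src (g.ch j) = s then 1 else 0 := by
  classical
  by_cases hs : g.src (g.ch j) = s
  · rw [if_pos hs]
    unfold cnt
    rw [← Finset.card_insert_of_notMem (a := g.ch j)]
    · congr 1
      ext c
      simp only [Finset.mem_filter, Finset.mem_insert, Finset.mem_range]
      constructor
      · rintro ⟨h1, h2, h3, i, hi, h4, h5 | rfl⟩
        · exact Or.inr ⟨h1, h2, h3, i, hi, h4, h5⟩
        · exact Or.inl h4.symm
      · rintro (rfl | ⟨h1, h2, h3, i, hi, h4, h5⟩)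
        · exact ⟨g.ch_lt j hj, hs, h, j, hj, rfl, Or.inr rfl⟩
        · exact ⟨h1, h2, h3, i, hi, h4, Or.inl h5⟩
    · simp only [Finset.mem_filter, not_and]
      exact fun _ _ _ => h'
  · rw [if_neg hs, Nat.add_zero]
    refine le_antisymm (Finset.card_le_card fun c hc => ?_) (g.cnt_mono (fun _ _ => Or.inl) s)
    simp only [Finset.mem_filter] at hc ⊢
    obtain ⟨h1, h2, h3, i, hi, h4, h5⟩ := hc
    refine ⟨h1, h2, h3, i, hi, h4, ?_⟩
    rcases h5 with h5 | rfl
    · exact h5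
    · subst h4
      exact absurd h2 hs

end Inst

/-- The array `f` links the elements of the list, starting from `h`; the element `j` is
represented by `j + 1`, and the end of the list by `0`. -/
def Chain (f : ℕ → ℕ) : ℕ → List ℕ → Prop
  | h, [] => h = 0
  | h, j :: L => h = j + 1 ∧ Chain f (f j) L

theorem Chain.congr {f f' : ℕ → ℕ} {h : ℕ} {L : List ℕ} (hc : Chain f h L)
    (hf : ∀ j ∈ L, f' j = f j) : Chain f' h L := by
  induction L generalizing h with
  | nil => exact hc
  | cons j L ih =>
    exact ⟨hc.1, by rw [hf j (by simp)]; exact ih hc.2 fun i hi => hf i (by simp [hi])⟩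

/-- The part of the memory that the main loop does not change. -/
structure Static (g : Inst) (m : Store) : Prop where
  n : m.nreg 0 = g.n
  nc : m.nreg 1 = g.nc
  mm : m.nreg 2 = g.mm
  zero : m.nreg 3 = 0
  one : m.nreg 4 = 1
  la : m.narr 0 = g.la
  lb : m.narr 1 = g.lb
  src : m.narr 2 = g.src
  ch : m.narr 3 = g.ch
  tg : m.narr 4 = g.tg
  zf : m.narr 6 = g.zf
  rew : m.rarr 0 = g.rew
  links : ∀ t < g.n, Chain (m.narr 8) (m.narr 7 t) (g.inList t)
  nch : ∀ s < g.n, m.narr 9 s = g.nchBelow g.nc s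

/-- Memory layout: registers up to 4, arrays up to 9 except the tags in array 5, and real array 0
stay fixed after the preparation. Write sets decide whether a program respects this. -/
theorem Static.of_agree {g : Inst} {w : Writes} {m m' : Store} (h : Static g m)
    (ha : Agree w m m') (h1 : ∀ x ∈ w.nreg, 4 < x := by decide)
    (h2 : ∀ A ∈ w.narr, A = 5 ∨ 9 < A := by decide) (h3 : ∀ A ∈ w.rarr, 0 < A := by decide) :
    Static g m' := by
  have hn : ∀ x ≤ 4, m'.nreg x = m.nreg x := fun x hx => ha.nreg x fun h => by
    have := h1 x h; omega
  have hA : ∀ A ≤ 9, A ≠ 5 → m'.narr A = m.narr A := fun A hA hA' => ha.narr A fun h => by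
    have := h2 A h; omega
  have hR : m'.rarr 0 = m.rarr 0 := ha.rarr 0 fun h => by
    have := h3 0 h; omega
  constructor
  · rw [hn 0 (by omega), h.n]
  · rw [hn 1 (by omega), h.nc]
  · rw [hn 2 (by omega), h.mm]
  · rw [hn 3 (by omega), h.zero]
  · rw [hn 4 (by omega), h.one]
  · rw [hA 0 (by omega) (by omega), h.la]
  · rw [hA 1 (by omega) (by omega), h.lb]
  · rw [hA 2 (by omega) (by omega), h.src]
  · rw [hA 3 (by omega) (by omega), h.ch]
  · rw [hA 4 (by omega) (by omega), h.tg]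
  · rw [hA 6 (by omega) (by omega), h.zf]
  · rw [hR, h.rew]
  · rw [hA 7 (by omega) (by omega), hA 8 (by omega) (by omega)]; exact h.links
  · rw [hA 9 (by omega) (by omega)]; exact h.nch

/-- The contents of the stack. -/
def stk (m : Store) : List ℕ := (List.range (m.nreg 7)).map (m.narr 13)

/-- The problem solved by the attractor program: starting from the states in `Sd`, a state is
marked as soon as `need s` of its choices outside `H` have a transition to a state that is a seed
or marked and in `Zp`. -/
structure AttrData where
  need : ℕ → ℕ
  H : ℕ → Prop
  Sd : ℕ → Prop

variable {g : Inst} {p : AttrData}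

def AttrData.Marked (p : AttrData) (g : Inst) (J : ℕ → Prop) (s : ℕ) : Prop :=
  0 < p.need s ∧ p.need s ≤ g.cnt p.H J s

/-- The sets that contain the seeds and are closed under adding states. -/
def AttrData.Closed (p : AttrData) (g : Inst) (V : Set ℕ) : Prop :=
  (∀ s < g.n, p.Sd s → s ∈ V) ∧
    ∀ s < g.n, g.zf s = 1 → p.Marked g (fun j => g.tg j ∈ V) s → s ∈ V

open Classical in
/-- The invariant of the attractor program, where the transitions in `J` into the states in `D`
have been processed. -/
structure AttrInv (g : Inst) (p : AttrData) (m : Store) (D : Finset ℕ) (J : ℕ → Prop) :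
    Prop where
  hit : ∀ c < g.nc, m.narr 11 c = 0 ↔ ¬ p.H c ∧ ¬ ∃ j < g.mm, g.ch j = c ∧ J j
  need : ∀ s < g.n, m.narr 10 s = p.need s - g.cnt p.H J s
  mark : ∀ s < g.n, m.narr 12 s = if p.Marked g J s then 1 else 0
  seed : ∀ s < g.n, m.narr 14 s = 1 ↔ p.Sd s
  nodup : (stk m).Nodup
  mem : ∀ s, s ∈ stk m ∨ s ∈ D ↔ s < g.n ∧ (p.Sd s ∨ g.zf s = 1 ∧ p.Marked g J s)
  disj : ∀ s ∈ stk m, s ∉ D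
  tg_mem : ∀ j < g.mm, J j → g.tg j ∈ D
  least : ∀ V, p.Closed g V → ∀ s, s ∈ stk m ∨ s ∈ D → s ∈ V

/-- Processing one transition into a state that has been taken from the stack. -/
def attrStep : Prog :=
  block [.instr (.sub 10 9 4), .instr (.load 11 3 10), .instr (.load 12 11 11),
    .ite (.eq 12 3)
      (block [.instr (.store 11 11 4), .instr (.load 13 2 11), .instr (.load 14 10 13),
        .ite (.lt 3 14)
          (block [.instr (.sub 14 14 4), .instr (.store 10 13 14),
            .ite (.eq 14 3)
              (block [.instr (.store 12 13 4), .instr (.load 12 6 13),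
                .ite (.eq 12 4)
                  (block [.instr (.load 12 14 13),
                    .ite (.eq 12 4) .skip
                      (block [.instr (.store 13 7 13), .instr (.add 7 7 4)])])
                  .skip])
              .skip])
          .skip])
      .skip,
    .instr (.load 9 8 10)]

theorem stk_congr {m m' : Store} (h7 : m'.nreg 7 = m.nreg 7) (h13 : m'.narr 13 = m.narr 13) :
    stk m' = stk m := by
  simp only [stk, h7, h13]

theorem stk_push {m m' : Store} {s : ℕ} (h7 : m'.nreg 7 = m.nreg 7 + 1)
    (h13 : m'.narr 13 = Function.update (m.narr 13) (m.nreg 7) s) : stk m' = stk m ++ [s] := by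
  simp only [stk, h7, h13, List.range_succ, List.map_append, List.map_cons, List.map_nil,
    Function.update_self]
  congr 1
  refine List.map_congr_left fun i hi => ?_
  rw [List.mem_range] at hi
  exact Function.update_of_ne (by omega) _ _

/-- The stack consists of distinct states; this keeps its height within the memory bound. -/
theorem AttrInv.length_le {m : Store} {D : Finset ℕ} {J : ℕ → Prop} (h : AttrInv g p m D J) :
    m.nreg 7 ≤ g.n := by
  have h1 : (stk m).length = m.nreg 7 := by simp [stk]
  have h2 : (stk m).toFinset ⊆ Finset.range g.n := fun s hs => by
    rw [List.mem_toFinset] at hs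
    exact Finset.mem_range.2 ((h.mem s).1 (Or.inl hs)).1
  have := Finset.card_le_card h2
  rwa [List.toFinset_card_of_nodup h.nodup, h1, Finset.card_range] at this

variable {B : ℕ} {G : ℝ → Prop}

-- Array 11 flags the choices excluded or already counted, array 10 holds the outstanding needs, 12
-- the marks, 13 the stack with its height in register 7, and 14 the seeds; register 9 points into
-- the list of transitions. The cases are: the choice cannot be counted, the need is 0, above 1, or
-- exactly 1. In the last case the source gets marked.
set_option maxHeartbeats 1000000 in
theorem attrStep_spec (hG : G 0) (hB : g.n + 1 ≤ B) {m : Store} {D : Finset ℕ} {J : ℕ → Prop}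
    {j : ℕ} (hm : m.Ok B G) (hs : Static g m) (h : AttrInv g p m D J) (hj : j < g.mm)
    (hD : g.tg j ∈ D) (h9 : m.nreg 9 = j + 1) :
    WP (Store.Ok B G) attrStep attrStep.cost
      (fun m' => AttrInv g p m' D (fun i => J i ∨ i = j) ∧ m'.nreg 9 = m.narr 8 j) m := by
  classical
  have hc := g.ch_lt j hj
  have hsrc := g.src_lt _ hc
  set c := g.ch j with hcdef
  set s := g.src c with hsdef
  have htg : ∀ i < g.mm, (J i ∨ i = j) → g.tg i ∈ D := by
    rintro i hi (h' | rfl)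
    · exact h.tg_mem i hi h'
    · exact hD
  have hex : ∀ c', (∃ i < g.mm, g.ch i = c' ∧ (J i ∨ i = j)) ↔
      c' = c ∨ ∃ i < g.mm, g.ch i = c' ∧ J i := by
    intro c'
    constructor
    · rintro ⟨i, hi, h1, h2 | rfl⟩
      · exact Or.inr ⟨i, hi, h1, h2⟩
      · exact Or.inl h1.symm
    · rintro (rfl | ⟨i, hi, h1, h2⟩)
      · exact ⟨j, hj, rfl, Or.inr rfl⟩
      · exact ⟨i, hi, h1, Or.inl h2⟩
  by_cases hhit : m.narr 11 c = 0
  swap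
  · -- the choice has been counted before or is excluded
    have hold : p.H c ∨ ∃ i < g.mm, g.ch i = c ∧ J i := by
      by_contra hn
      exact hhit ((h.hit c hc).2 ⟨fun h' => hn (Or.inl h'), fun h' => hn (Or.inr h')⟩)
    have hden : attrStep.den m = { m with
        nreg := Function.update (Function.update (Function.update (Function.update m.nreg 10 j)
          11 c) 12 (m.narr 11 c)) 9 (m.narr 8 j) } := by
      simp [attrStep, block, Prog.den, Instr.exec, Test.holds, h9, hs.one, hs.zero, hs.ch,
        ← hcdef, hhit]
    refine WP.of_safe hG hm ?_ ?_
    · simp [attrStep, block, Prog.den, Prog.Safe, Instr.Safe, Instr.exec, Test.holds, h9, hs.one,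
        hs.zero, hs.ch, ← hcdef, hhit]
    rw [hden]
    have hcnt := g.cnt_insert_old hold
    have hM : ∀ s, p.Marked g (fun i => J i ∨ i = j) s ↔ p.Marked g J s := fun s => by
      simp only [AttrData.Marked, hcnt]
    refine ⟨⟨fun c' hc' => ?_, ?_, ?_, h.seed, h.nodup, ?_, h.disj, htg, h.least⟩, ?_⟩
    · rw [h.hit c' hc', hex]
      refine and_congr_right fun hH => not_congr ⟨Or.inr, ?_⟩
      rintro (rfl | h')
      · exact hold.resolve_left hH
      · exact h'
    · intro s hs; rw [hcnt]; exact h.need s hs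
    · intro s hs; simp only [hM]; exact h.mark s hs
    · intro s; simp only [hM]; exact h.mem s
    · simp
  obtain ⟨hH, hnew⟩ := (h.hit c hc).1 hhit
  have hcnt := g.cnt_insert_new hj hH hnew
  rw [← hcdef] at hcnt
  have hcs : g.cnt p.H (fun i => J i ∨ i = j) s = g.cnt p.H J s + 1 := by simp [hcnt, hsdef]
  have hco : ∀ s' ≠ s, g.cnt p.H (fun i => J i ∨ i = j) s' = g.cnt p.H J s' := fun s' hs' => by
    rw [hcnt, if_neg (Ne.symm hs'), Nat.add_zero]
  have hMo : ∀ s' ≠ s, (p.Marked g (fun i => J i ∨ i = j) s' ↔ p.Marked g J s') :=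
    fun s' hs' => by simp only [AttrData.Marked, hco s' hs']
  have hneed := h.need s hsrc
  have hhit' : ∀ c' < g.nc, Function.update (m.narr 11) c 1 c' = 0 ↔
      ¬ p.H c' ∧ ¬ ∃ i < g.mm, g.ch i = c' ∧ (J i ∨ i = j) := by
    intro c' hc'
    rw [hex]
    by_cases hcc : c' = c
    · subst hcc; simp
    · rw [Function.update_of_ne hcc, h.hit c' hc']
      simp [hcc]
  have hneed' : ∀ q, q = m.narr 10 s - 1 → ∀ s' < g.n, Function.update (m.narr 10) s q s' =
      p.need s' - g.cnt p.H (fun i => J i ∨ i = j) s' := by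
    intro q hq s' hs'
    by_cases hss : s' = s
    · subst hss
      rw [Function.update_self, hcs, hq, hneed]; omega
    · rw [Function.update_of_ne hss, hco s' hss, h.need s' hs']
  by_cases hq : m.narr 10 s = 0
  · -- the state had been marked before
    have hden : attrStep.den m = { m with
        nreg := Function.update (Function.update (Function.update (Function.update (Function.update
          (Function.update m.nreg 10 j) 11 c) 12 0) 13 s) 14 0) 9 (m.narr 8 j)
        narr := setArr m.narr 11 c 1 } := by
      simp [attrStep, block, Prog.den, Instr.exec, Test.holds, h9, hs.one, hs.zero, hs.ch,
        ← hcdef, hhit, setArr_apply, hs.src, ← hsdef, hq]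
    refine WP.of_safe hG hm ?_ ?_
    · simp [attrStep, block, Prog.den, Prog.Safe, Instr.Safe, Instr.exec, Test.holds, h9, hs.one,
        hs.zero, hs.ch, ← hcdef, hhit, setArr_apply, hs.src, ← hsdef, hq]
    rw [hden]
    have hM : ∀ s', p.Marked g (fun i => J i ∨ i = j) s' ↔ p.Marked g J s' := fun s' => by
      by_cases hss : s' = s
      · subst hss
        simp only [AttrData.Marked, hcs]
        -- By truncated subtraction, an outstanding need of 0 means that `s` was marked before, or
        -- that its need is 0 and it never gets marked.
        rw [hneed] at hq
        omega
      · exact hMo s' hss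
    refine ⟨⟨?_, ?_, ?_, ?_, h.nodup, ?_, h.disj, htg, h.least⟩, ?_⟩
    · simpa [setArr_apply] using hhit'
    · intro s' hs'
      have := hneed' 0 (by omega) s' hs'
      rw [← hq, Function.update_eq_self] at this
      simpa [setArr_apply] using this
    · intro s' hs'; simp only [hM]; simpa [setArr_apply] using h.mark s' hs'
    · simpa [setArr_apply] using h.seed
    · intro s'; simp only [hM]; exact h.mem s'
    · simp
  by_cases hq1 : m.narr 10 s = 1
  swap
  · -- the counter decreases
    have hq2 : m.narr 10 s - 1 ≠ 0 := by omega
    have hden : attrStep.den m = { m with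
        nreg := Function.update (Function.update (Function.update (Function.update (Function.update
          (Function.update m.nreg 10 j) 11 c) 12 0) 13 s) 14 (m.narr 10 s - 1)) 9 (m.narr 8 j)
        narr := setArr (setArr m.narr 11 c 1) 10 s (m.narr 10 s - 1) } := by
      simp [attrStep, block, Prog.den, Instr.exec, Test.holds, h9, hs.one, hs.zero, hs.ch,
        ← hcdef, hhit, setArr_apply, hs.src, ← hsdef, hq, hq2,
        Nat.pos_iff_ne_zero]
    refine WP.of_safe hG hm ?_ ?_
    · simp [attrStep, block, Prog.den, Prog.Safe, Instr.Safe, Instr.exec, Test.holds, h9, hs.one,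
        hs.zero, hs.ch, ← hcdef, hhit, setArr_apply, hs.src, ← hsdef, hq,
        hq2, Nat.pos_iff_ne_zero]
    rw [hden]
    have hM : ∀ s', p.Marked g (fun i => J i ∨ i = j) s' ↔ p.Marked g J s' := fun s' => by
      by_cases hss : s' = s
      · subst hss
        simp only [AttrData.Marked, hcs]
        rw [hneed] at hq hq1
        omega
      · exact hMo s' hss
    refine ⟨⟨?_, ?_, ?_, ?_, h.nodup, ?_, h.disj, htg, h.least⟩, ?_⟩
    · simpa [setArr_apply] using hhit'
    · simpa [setArr_apply] using hneed' _ rfl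
    · intro s' hs'; simp only [hM]; simpa [setArr_apply] using h.mark s' hs'
    · simpa [setArr_apply] using h.seed
    · intro s'; simp only [hM]; exact h.mem s'
    · simp
  -- the state gets marked
  have hMs : p.Marked g (fun i => J i ∨ i = j) s := by
    simp only [AttrData.Marked, hcs]
    rw [hneed] at hq1
    omega
  have hMs' : ¬ p.Marked g J s := by
    simp only [AttrData.Marked]
    rw [hneed] at hq1
    omega
  have hmark' : ∀ s' < g.n, Function.update (m.narr 12) s 1 s' =
      if p.Marked g (fun i => J i ∨ i = j) s' then 1 else 0 := by
    intro s' hs'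
    by_cases hss : s' = s
    · subst hss; simp [hMs]
    · rw [Function.update_of_ne hss, h.mark s' hs']; simp only [hMo s' hss]
  -- Seeds start on the stack, so only newly marked states of `Z` that are not seeds are pushed;
  -- this avoids duplicates.
  by_cases hpush : g.zf s = 1 ∧ m.narr 14 s ≠ 1
  · have h7 := h.length_le
    have hsafe : attrStep.Safe B G m := by
      simp [attrStep, block, Prog.den, Prog.Safe, Instr.Safe, Instr.exec, Test.holds, h9, hs.one,
        hs.zero, hs.ch, ← hcdef, hhit, setArr_apply, hs.src, ← hsdef, hq1, hs.zf, hpush.1, hpush.2]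
      omega
    have hden : (attrStep.den m).narr = setArr (setArr (setArr (setArr m.narr 11 c 1) 10 s 0)
          12 s 1) 13 (m.nreg 7) s ∧
        (attrStep.den m).nreg 7 = m.nreg 7 + 1 ∧ (attrStep.den m).nreg 9 = m.narr 8 j := by
      simp [attrStep, block, Prog.den, Instr.exec, Test.holds, h9, hs.one, hs.zero, hs.ch,
        ← hcdef, hhit, setArr_apply, hs.src, ← hsdef, hq1, hs.zf, hpush.1, hpush.2]
    refine WP.of_safe hG hm hsafe ?_
    obtain ⟨hd1, hd2, hd3⟩ := hden
    have hstk := stk_push (m := m) (m' := attrStep.den m) (s := s) hd2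
      (by rw [hd1]; simp [setArr_apply])
    have hsd : ¬ p.Sd s := fun h' => hpush.2 ((h.seed s hsrc).2 h')
    have hnin : ¬ (s ∈ stk m ∨ s ∈ D) := fun h' => by
      rcases ((h.mem s).1 h').2 with h'' | h''
      · exact hsd h''
      · exact hMs' h''.2
    refine ⟨⟨?_, ?_, ?_, ?_, ?_, ?_, ?_, htg, ?_⟩, hd3⟩
    · rw [hd1]; simpa [setArr_apply] using hhit'
    · rw [hd1]; simpa [setArr_apply] using hneed' 0 (by omega)
    · rw [hd1]; simpa [setArr_apply] using hmark'
    · rw [hd1]; simpa [setArr_apply] using h.seed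
    · rw [hstk, List.nodup_append]
      refine ⟨h.nodup, by simp, ?_⟩
      intro x hx y hy
      rw [List.mem_singleton] at hy
      rintro rfl
      exact hnin (Or.inl (hy ▸ hx))
    · intro s'
      rw [hstk, List.mem_append, List.mem_singleton]
      by_cases hss : s' = s
      · subst hss; simp [hsrc, hpush.1, hMs]
      · rw [hMo s' hss, ← h.mem s']; simp [hss]
    · intro s' hs'
      rw [hstk, List.mem_append, List.mem_singleton] at hs'
      rcases hs' with hs' | rfl
      · exact h.disj s' hs'
      · exact fun h' => hnin (Or.inr h')
    · intro V hV s' hs'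
      rw [hstk, List.mem_append, List.mem_singleton] at hs'
      rcases hs' with (hs' | rfl) | hs'
      · exact h.least V hV s' (Or.inl hs')
      -- The counted transitions lead into `D`, which lies in every closed `V`; so `s` is marked
      -- relative to `V` as well.
      · refine hV.2 s hsrc hpush.1 ⟨hMs.1, hMs.2.trans (g.cnt_mono ?_ s)⟩
        intro i hi hJ
        exact h.least V hV _ (Or.inr (htg i hi hJ))
      · exact h.least V hV s' (Or.inr hs')
  · have hden : (attrStep.den m).narr = setArr (setArr (setArr m.narr 11 c 1) 10 s 0) 12 s 1 ∧
        (attrStep.den m).nreg 7 = m.nreg 7 ∧ (attrStep.den m).nreg 9 = m.narr 8 j := by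
      by_cases hz : g.zf s = 1
      · have hsd : m.narr 14 s = 1 := by
          by_contra h'; exact hpush ⟨hz, h'⟩
        simp [attrStep, block, Prog.den, Instr.exec, Test.holds, h9, hs.one, hs.zero, hs.ch,
          ← hcdef, hhit, setArr_apply, hs.src, ← hsdef, hq1, hs.zf, hz, hsd]
      · simp [attrStep, block, Prog.den, Instr.exec, Test.holds, h9, hs.one, hs.zero, hs.ch,
          ← hcdef, hhit, setArr_apply, hs.src, ← hsdef, hq1, hs.zf, hz]
    refine WP.of_safe hG hm ?_ ?_
    · by_cases hz : g.zf s = 1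
      · have hsd : m.narr 14 s = 1 := by
          by_contra h'; exact hpush ⟨hz, h'⟩
        simp [attrStep, block, Prog.den, Prog.Safe, Instr.Safe, Instr.exec, Test.holds, h9, hs.one,
          hs.zero, hs.ch, ← hcdef, hhit, setArr_apply, hs.src, ← hsdef, hq1,
          hs.zf, hz, hsd]
      · simp [attrStep, block, Prog.den, Prog.Safe, Instr.Safe, Instr.exec, Test.holds, h9, hs.one,
          hs.zero, hs.ch, ← hcdef, hhit, setArr_apply, hs.src, ← hsdef, hq1,
          hs.zf, hz]
    obtain ⟨hd1, hd2, hd3⟩ := hden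
    have hstk : stk (attrStep.den m) = stk m :=
      stk_congr hd2 (by rw [hd1]; simp [setArr_apply])
    have hmem : ∀ s', (p.Sd s' ∨ g.zf s' = 1 ∧ p.Marked g (fun i => J i ∨ i = j) s') ↔
        (p.Sd s' ∨ g.zf s' = 1 ∧ p.Marked g J s') := by
      intro s'
      by_cases hss : s' = s
      · subst hss
        by_cases hz : g.zf s = 1
        · have hsd : m.narr 14 s = 1 := by
            by_contra h'; exact hpush ⟨hz, h'⟩
          simp [(h.seed s hsrc).1 hsd]
        · simp [hz]
      · rw [hMo s' hss]
    refine ⟨⟨?_, ?_, ?_, ?_, ?_, ?_, ?_, htg, ?_⟩, hd3⟩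
    · rw [hd1]; simpa [setArr_apply] using hhit'
    · rw [hd1]; simpa [setArr_apply] using hneed' 0 (by omega)
    · rw [hd1]; simpa [setArr_apply] using hmark'
    · rw [hd1]; simpa [setArr_apply] using h.seed
    · rw [hstk]; exact h.nodup
    · intro s'; rw [hstk, hmem]; exact h.mem s'
    · rw [hstk]; exact h.disj
    · rw [hstk]; exact h.least

end Attractor

/-! ### The attractor program in linear time. -/

section AttractorLoops

variable {g : Inst} {p : AttrData} {B : ℕ} {G : ℝ → Prop}

theorem AttrData.marked_congr {J J' : ℕ → Prop} (h : ∀ j < g.mm, (J j ↔ J' j)) (s : ℕ) :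
    p.Marked g J s ↔ p.Marked g J' s := by
  simp only [AttrData.Marked, g.cnt_congr h]

theorem AttrInv.congr {m : Store} {D : Finset ℕ} {J J' : ℕ → Prop} (h : AttrInv g p m D J)
    (hJ : ∀ j < g.mm, (J j ↔ J' j)) : AttrInv g p m D J' := by
  classical
  have hM := AttrData.marked_congr (p := p) hJ
  refine ⟨fun c hc => ?_, fun s hs => ?_, fun s hs => ?_, h.seed, h.nodup, fun s => ?_, h.disj,
    fun j hj hj' => h.tg_mem j hj ((hJ j hj).2 hj'), h.least⟩
  · rw [h.hit c hc]
    refine and_congr_right fun _ => not_congr (exists_congr fun j => and_congr_right fun hj => ?_)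
    rw [hJ j hj]
  · rw [h.need s hs, g.cnt_congr hJ]
  · rw [h.mark s hs]; simp only [hM]
  · rw [h.mem s, hM]

/-- Processing the list of transitions into a state. -/
def attrInner : Prog := .loop (.lt 3 9) attrStep

theorem attrInner_spec (hG : G 0) (hB : g.n + 1 ≤ B) {m : Store} {D : Finset ℕ} {J : ℕ → Prop}
    {L : List ℕ} (hm : m.Ok B G) (hs : Static g m) (h : AttrInv g p m D J)
    (hL : ∀ j ∈ L, j < g.mm ∧ g.tg j ∈ D) (hc : Chain (m.narr 8) (m.nreg 9) L) :
    WP (Store.Ok B G) attrInner (L.length * (attrStep.cost + 1) + 1)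
      (fun m' => AttrInv g p m' D (fun i => J i ∨ i ∈ L)) m := by
  induction L generalizing m J with
  | nil =>
    have h9 : m.nreg 9 = 0 := hc
    refine (WP.loop_false hm ?_ ?_).mono (by simp) fun _ h => h
    · simp [Test.holds, hs.zero, h9]
    · simpa using h
  | cons j L ih =>
    have h9 : m.nreg 9 = j + 1 := hc.1
    have ht : (Test.lt 3 9).holds m := by simp [Test.holds, hs.zero, h9]
    refine (WP.loop_true hm ht ((attrStep_spec hG hB hm hs h (hL j (by simp)).1
      (hL j (by simp)).2 h9).frame.mono le_rfl ?_)).mono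
      (T := attrStep.cost + (L.length * (attrStep.cost + 1) + 1) + 1) ?_ fun _ h => h
    · rintro m' ⟨⟨h1, h2⟩, hm', ha⟩
      refine (ih hm' (hs.of_agree ha) h1 (fun i hi => hL i (by simp [hi])) ?_).mono le_rfl ?_
      · rw [h2, ha.narr 8 (by decide)]
        exact hc.2
      · intro m'' h''
        exact h''.congr fun i _ => by simp [or_assoc]
    · simp only [List.length_cons, Nat.succ_mul]
      omega

/-- Processing the states on the stack. -/
def attrOuter : Prog :=
  .loop (.lt 3 7) (block [.instr (.sub 7 7 4), .instr (.load 8 13 7), .instr (.load 9 7 8),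
    attrInner])

/-- Each state is taken from the stack at most once, as it then belongs to `D`. The time is
therefore charged to the incoming transitions of the states not yet in `D`. -/
theorem attrOuter_spec (hG : G 0) (hB : g.n + 1 ≤ B) {m : Store} {D : Finset ℕ}
    (hm : m.Ok B G) (hs : Static g m) (h : AttrInv g p m D (fun j => g.tg j ∈ D)) :
    WP (Store.Ok B G) attrOuter
      (∑ t ∈ Finset.range g.n \ D, ((g.inList t).length * (attrStep.cost + 1) + 8) + 1)
      (fun m' => ∃ D', AttrInv g p m' D' (fun j => g.tg j ∈ D') ∧ m'.nreg 7 = 0) m := by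
  induction hk : (Finset.range g.n \ D).card generalizing m D with
  | zero =>
    have hsub : Finset.range g.n ⊆ D := by
      rwa [Finset.card_eq_zero, Finset.sdiff_eq_empty_iff_subset] at hk
    have h7 : m.nreg 7 = 0 := by
      by_contra hne
      have hmem : m.narr 13 0 ∈ stk m := by
        simp only [stk, List.mem_map, List.mem_range]
        exact ⟨0, by omega, rfl⟩
      exact h.disj _ hmem (hsub (Finset.mem_range.2 ((h.mem _).1 (Or.inl hmem)).1))
    exact (WP.loop_false hm (by simp [Test.holds, hs.zero, h7]) ⟨D, h, h7⟩).mono (by omega)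
      fun _ h => h
  | succ k ih =>
    by_cases h7 : m.nreg 7 = 0
    · exact (WP.loop_false hm (by simp [Test.holds, hs.zero, h7]) ⟨D, h, h7⟩).mono (by omega)
        fun _ h => h
    obtain ⟨sp, hsp⟩ := Nat.exists_eq_succ_of_ne_zero h7
    set t := m.narr 13 sp with ht
    set m1 : Store := { m with nreg := Function.update (Function.update
      (Function.update m.nreg 7 sp) 8 t) 9 (m.narr 7 t) } with hm1def
    have hstk : stk m = stk m1 ++ [t] := by
      simp [stk, hsp, List.range_succ, hm1def, ht]
    have htm : t ∈ stk m := by simp [hstk]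
    have htn : t < g.n := ((h.mem t).1 (Or.inl htm)).1
    have htD : t ∉ D := h.disj t htm
    have hnd := h.nodup
    rw [hstk, List.nodup_append] at hnd
    have htm1 : t ∉ stk m1 := fun h' => hnd.2.2 t h' t (by simp) rfl
    have hmem : ∀ s, (s ∈ stk m1 ∨ s ∈ insert t D) ↔ (s ∈ stk m ∨ s ∈ D) := fun s => by
      rw [hstk, List.mem_append, List.mem_singleton, Finset.mem_insert]; tauto
    -- `t` enters `D` before its incoming transitions are processed, so `J` lags behind `D` here;
    -- the inner loop catches up.
    have hInv1 : AttrInv g p m1 (insert t D) (fun j => g.tg j ∈ D) := by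
      refine ⟨h.hit, h.need, h.mark, h.seed, hnd.1, fun s => (hmem s).trans (h.mem s), ?_,
        fun j _ hj' => Finset.mem_insert_of_mem hj', fun V hV s hs => h.least V hV s ((hmem s).1 hs)⟩
      intro s hs' h'
      rcases Finset.mem_insert.1 h' with rfl | h'
      · exact htm1 hs'
      · exact h.disj s (by rw [hstk]; simp [hs']) h'
    have hpre : ∀ T R, (m1.Ok B G → Static g m1 → WP (Store.Ok B G) attrInner T R m1) →
        WP (Store.Ok B G) (block [.instr (.sub 7 7 4), .instr (.load 8 13 7),
          .instr (.load 9 7 8), attrInner]) (T + 6) R m := by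
      intro T R hR
      have e1 := hm.exec hG (i := .sub 7 7 4) trivial
      have e2 := e1.exec hG (i := .load 8 13 7) trivial
      have e3 := e2.exec hG (i := .load 9 7 8) trivial
      have hE : (Instr.load 9 7 8).exec ((Instr.load 8 13 7).exec ((Instr.sub 7 7 4).exec m)) =
          m1 := by
        simp [Instr.exec, hm1def, hs.one, hsp, ht]
      have hs1 : Static g m1 := by
        rw [← hE]
        exact ((hs.of_agree (Instr.agree_exec _ _)).of_agree (Instr.agree_exec _ _)).of_agree
          (Instr.agree_exec _ _)
      refine (WP.seq (T := 1) (T' := 1 + (1 + T + 1) + 1) hm (WP.instr hm e1 (WP.seq (T := 1) (T' := 1 + T + 1) e1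
        (WP.instr e1 e2 (WP.seq (T := 1) (T' := T) e2 (WP.instr e2 e3
        (hE ▸ hR (hE ▸ e3) hs1))))))).mono (by omega) fun _ h => h
    have hlist : ∀ j ∈ g.inList t, j < g.mm ∧ g.tg j ∈ insert t D := fun j hj => by
      rw [Inst.inList, Inst.mem_inListBelow] at hj
      exact ⟨hj.1, by rw [hj.2]; exact Finset.mem_insert_self _ _⟩
    have hcard : (Finset.range g.n \ insert t D).card = k := by
      have : Finset.range g.n \ insert t D = (Finset.range g.n \ D).erase t := by
        ext s; simp only [Finset.mem_sdiff, Finset.mem_insert, Finset.mem_erase]; tauto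
      rw [this, Finset.card_erase_of_mem (by simp [htn, htD]), hk]
      rfl
    have hsum : ∑ t ∈ Finset.range g.n \ D, ((g.inList t).length * (attrStep.cost + 1) + 8) =
        (g.inList t).length * (attrStep.cost + 1) + 8 +
        ∑ t ∈ Finset.range g.n \ insert t D, ((g.inList t).length * (attrStep.cost + 1) + 8) := by
      rw [← Finset.add_sum_erase _ _ (show t ∈ Finset.range g.n \ D by simp [htn, htD])]
      congr 1
      refine Finset.sum_congr ?_ fun _ _ => rfl
      ext s; simp only [Finset.mem_sdiff, Finset.mem_insert, Finset.mem_erase]; tauto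
    refine (WP.loop_true hm (by simp [Test.holds, hs.zero, hsp]) ((hpre _ _ fun hok1 hs1 =>
      ((attrInner_spec hG hB hok1 hs1 hInv1 hlist ?_).frame.mono le_rfl
        fun m' ⟨h1, hm', ha⟩ => ih hm' (hs1.of_agree ha) (h1.congr fun j hj => ?_) hcard)))).mono
        ?_ fun _ h => h
    · have h9 : m1.nreg 9 = m1.narr 7 t := by simp [hm1def]
      rw [h9]
      exact hs1.links t htn
    · rw [Inst.inList, Inst.mem_inListBelow, Finset.mem_insert]
      tauto
    · rw [hsum]; omega

/-- Initialization of the marks and the stack. -/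
def attrInit : Prog :=
  block [.instr (.const 7 0), forLoop 5 0 (block [.instr (.store 12 5 3), .instr (.load 10 14 5),
    .ite (.eq 10 4) (block [.instr (.store 13 7 5), .instr (.add 7 7 4)]) .skip])]

theorem attrInit_spec (hG : G 0) (hB : g.n + 1 ≤ B) {m : Store} (hm : m.Ok B G)
    (hs : Static g m) :
    WP (Store.Ok B G) attrInit (13 * g.n + 13)
      (fun m' => (∀ s < g.n, m'.narr 12 s = 0) ∧ (stk m').Nodup ∧
        ∀ s, s ∈ stk m' ↔ s < g.n ∧ m.narr 14 s = 1) m := by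
  have e1 := hm.exec hG (i := .const 7 0) (Nat.zero_le _)
  have hs1 := hs.of_agree (Instr.agree_exec (.const 7 0) m)
  have h14 : ((Instr.const 7 0).exec m).narr 14 = m.narr 14 := rfl
  have h7 : ((Instr.const 7 0).exec m).nreg 7 = 0 := by simp [Instr.exec]
  set m1 := (Instr.const 7 0).exec m
  refine (WP.seq (T := 1) (T' := g.n * (8 + 3) + 3) hm (WP.instr hm e1 ?_)).mono (by omega)
    fun _ h => h
  refine (WP.forLoop hG (T := 8) (N := g.n) (Inv := fun k m' => (∀ s < k, m'.narr 12 s = 0) ∧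
    (stk m').Nodup ∧ m'.nreg 7 ≤ k ∧ ∀ s, s ∈ stk m' ↔ s < k ∧ m.narr 14 s = 1)
    e1 hs1.n hs1.one hB (hreg := ?_) (h0 := ?_) (hstep := ?_)).mono le_rfl
    fun m' h => ⟨h.1.1, h.1.2.1, h.1.2.2.2⟩
  · rintro k m' x ⟨h1, h2, h3, h4⟩
    have : stk { m' with nreg := Function.update m'.nreg 5 x } = stk m' := by simp [stk]
    exact ⟨h1, by rw [this]; exact h2, by simpa using h3, by rw [this]; exact h4⟩
  · simp [stk, h7]
  · rintro k hk m' hm' ha h5 ⟨h1, h2, h3, h4⟩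
    have hs' := hs1.of_agree ha
    have ha14 : m'.narr 14 = m.narr 14 := (ha.narr 14 (by decide)).trans h14
    have hmk : ∀ f : ℕ → ℕ, f = Function.update (m'.narr 12) k 0 → ∀ s < k + 1, f s = 0 := by
      rintro f rfl s hs
      by_cases hsk : s = k
      · subst hsk; simp
      · rw [Function.update_of_ne hsk]; exact h1 s (by omega)
    by_cases hsd : m.narr 14 k = 1
    · refine (WP.of_safe hG hm' ?_ ?_).mono (by decide) fun _ h => h
      · simp [block, Prog.Safe, Prog.den, Instr.Safe, Instr.exec, Test.holds, setArr_apply, h5,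
          ha14, hsd, hs'.one]
        omega
      · have hden : ∀ c, c = (block [.instr (.store 12 5 3), .instr (.load 10 14 5),
            .ite (.eq 10 4) (block [.instr (.store 13 7 5), .instr (.add 7 7 4)]) .skip]) →
            (c.den m').narr = setArr (setArr m'.narr 12 k 0) 13 (m'.nreg 7) k ∧
            (c.den m').nreg 7 = m'.nreg 7 + 1 := by
          rintro c rfl
          simp [block, Prog.den, Instr.exec, Test.holds, setArr_apply, h5, ha14, hsd, hs'.one,
            hs'.zero]
        obtain ⟨hd1, hd2⟩ := hden _ rfl
        have hstk := stk_push (m := m') (s := k) hd2 (by rw [hd1]; simp [setArr_apply])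
        refine ⟨hmk _ (by rw [hd1]; simp [setArr_apply]), ?_, by rw [hd2]; omega, ?_⟩
        · rw [hstk, List.nodup_append]
          refine ⟨h2, by simp, fun x hx y hy hxy => ?_⟩
          rw [List.mem_singleton] at hy
          have := ((h4 x).1 hx).1
          omega
        · intro s
          rw [hstk, List.mem_append, List.mem_singleton, h4]
          constructor
          · rintro (h | rfl)
            · exact ⟨by omega, h.2⟩
            · exact ⟨by omega, hsd⟩
          · rintro ⟨h, h'⟩
            rcases Nat.lt_succ_iff_lt_or_eq.1 h with h'' | h''
            · exact Or.inl ⟨h'', h'⟩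
            · exact Or.inr h''
    · refine (WP.of_safe hG hm' ?_ ?_).mono (by decide) fun _ h => h
      · simp [block, Prog.Safe, Prog.den, Instr.Safe, Instr.exec, Test.holds, setArr_apply, h5,
          ha14, hsd, hs'.one]
      · have hden : ∀ c, c = (block [.instr (.store 12 5 3), .instr (.load 10 14 5),
            .ite (.eq 10 4) (block [.instr (.store 13 7 5), .instr (.add 7 7 4)]) .skip]) →
            (c.den m').narr = setArr m'.narr 12 k 0 ∧ (c.den m').nreg 7 = m'.nreg 7 := by
          rintro c rfl
          simp [block, Prog.den, Instr.exec, Test.holds, setArr_apply, h5, ha14, hsd, hs'.one,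
            hs'.zero]
        obtain ⟨hd1, hd2⟩ := hden _ rfl
        have hstk := stk_congr (m := m') hd2 (by rw [hd1]; simp [setArr_apply])
        refine ⟨hmk _ (by rw [hd1]; simp [setArr_apply]), by rw [hstk]; exact h2,
          by rw [hd2]; omega, ?_⟩
        intro s
        rw [hstk, h4]
        constructor
        · exact fun h => ⟨by omega, h.2⟩
        · rintro ⟨h, h'⟩
          refine ⟨?_, h'⟩
          rcases Nat.lt_succ_iff_lt_or_eq.1 h with h'' | h''
          · exact h''
          · subst h''; exact absurd h' hsd

/-- The attractor program. -/
def attr : Prog := .seq attrInit attrOuter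

/-- The solution of an attractor problem: the least closed set. -/
def AttrData.Solves (p : AttrData) (g : Inst) (P : Set ℕ) : Prop :=
  (∀ s, s ∈ P ↔ s < g.n ∧ (p.Sd s ∨ g.zf s = 1 ∧ p.Marked g (fun j => g.tg j ∈ P) s)) ∧
    ∀ V, p.Closed g V → P ⊆ V

theorem Inst.cnt_false (H : ℕ → Prop) (s : ℕ) : g.cnt H (fun _ => False) s = 0 := by
  simp [Inst.cnt]

-- With an empty stack, the invariant says that `D` satisfies the fixed point equation and lies in
-- every closed set. The transition lists have total length `g.mm`, which makes the time linear.
open Classical in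
theorem attr_spec (hG : G 0) (hB : g.n + 1 ≤ B) {m : Store} (hm : m.Ok B G) (hs : Static g m)
    (hneed : ∀ s < g.n, m.narr 10 s = p.need s) (hH : ∀ c < g.nc, m.narr 11 c = 0 ↔ ¬ p.H c)
    (hSd : ∀ s < g.n, m.narr 14 s = 1 ↔ p.Sd s) :
    WP (Store.Ok B G) attr ((attrStep.cost + 22) * (g.n + g.mm + 1))
      (fun m' => ∃ P, p.Solves g P ∧ ∀ s < g.n, m'.narr 12 s =
        if p.Marked g (fun j => g.tg j ∈ P) s then 1 else 0) m := by
  have hsum : ∑ t ∈ Finset.range g.n \ ∅, ((g.inList t).length * (attrStep.cost + 1) + 8) + 1 =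
      g.mm * (attrStep.cost + 1) + g.n * 8 + 1 := by
    rw [Finset.sdiff_empty, Finset.sum_add_distrib, ← Finset.sum_mul]
    have : ∑ t ∈ Finset.range g.n, (g.inList t).length = g.mm :=
      g.sum_length_inListBelow g.mm le_rfl
    rw [this]
    simp
  refine (WP.seq hm ((attrInit_spec hG hB hm hs).frame.mono le_rfl ?_)).mono
    (T := 13 * g.n + 13 + (g.mm * (attrStep.cost + 1) + g.n * 8 + 1) + 1) ?_ fun _ h => h
  · rintro m' ⟨⟨h1, h2, h3⟩, hm', ha⟩
    have hM : ∀ s, ¬ p.Marked g (fun _ => False) s := fun s h => by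
      have := h.2
      rw [Inst.cnt_false] at this
      have := h.1
      omega
    have hInv : AttrInv g p m' ∅ (fun j => g.tg j ∈ (∅ : Finset ℕ)) := by
      simp only [Finset.notMem_empty]
      refine ⟨fun c hc => ?_, fun s hs => ?_, fun s hs => ?_, fun s hs => ?_, h2, fun s => ?_,
        by simp, by simp, fun V hV s hs => ?_⟩
      · rw [ha.narr 11 (by decide), hH c hc]; simp
      · rw [ha.narr 10 (by decide), hneed s hs, Inst.cnt_false, Nat.sub_zero]
      · rw [h1 s hs, if_neg (hM s)]
      · rw [ha.narr 14 (by decide), hSd s hs]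
      · simp only [Finset.notMem_empty, or_false, hM, and_false, h3]
        exact and_congr_right fun hs => hSd s hs
      · simp only [Finset.notMem_empty, or_false, h3] at hs
        exact hV.1 s hs.1 ((hSd s hs.1).1 hs.2)
    rw [← hsum]
    refine (attrOuter_spec hG hB hm' (hs.of_agree ha) hInv).mono le_rfl ?_
    rintro m'' ⟨D, hD, h7⟩
    have hst : stk m'' = [] := by simp [stk, h7]
    refine ⟨D, ⟨fun s => ?_, fun V hV s hs => hD.least V hV s (Or.inr hs)⟩, hD.mark⟩
    have := hD.mem s
    rw [hst] at this
    simpa using this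
  · have e1 : g.mm * (attrStep.cost + 1) = attrStep.cost * g.mm + g.mm := by ring
    have e2 : (attrStep.cost + 22) * (g.n + g.mm + 1) = attrStep.cost * g.mm +
      (attrStep.cost * (g.n + 1)) + 22 * g.n + 22 * g.mm + 22 := by ring
    omega

end AttractorLoops

/-! ### Building the auxiliary arrays. -/

section Preparation

variable {g : Inst} {B : ℕ} {G : ℝ → Prop}

/-- `for i = 0, …, b - 1` compute the entry `i` of the array `A` by `c`. -/
def fill (A b : ℕ) (c : Prog) : Prog := forLoop 5 b (.seq c (.instr (.store A 5 10)))

theorem fill_spec (hG : G 0) {A b N : ℕ} {c : Prog} {m : Store} {f : ℕ → ℕ} (hm : m.Ok B G)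
    (hb : m.nreg b = N) (h1 : m.nreg 4 = 1) (hN : N + 1 ≤ B)
    (hc : ∀ k < N, ∀ m', m'.Ok B G → Agree (fill A b c).writes m m' → m'.nreg 5 = k →
      m'.narr A k = m.narr A k → c.Safe B G m' ∧ (c.den m').nreg 10 = f k)
    (h5 : 5 ∉ c.writes.nreg := by decide) (hbi : b ∉ 5 :: c.writes.nreg := by decide)
    (h4 : 4 ∉ 5 :: c.writes.nreg := by decide) (hA : c.writes.narr = [] := by decide) :
    WP (Store.Ok B G) (fill A b c) (N * (c.cost + 5) + 3)
      (fun m' => (m'.narr A = fun i => if i < N then f i else m.narr A i) ∧ m'.Ok B G ∧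
        Agree (fill A b c).writes m m') m := by
  have hw : (Prog.seq c (.instr (.store A 5 10))).writes.nreg = c.writes.nreg := by
    simp [Prog.writes, Writes.union, Instr.writes]
  refine (WP.forLoop hG (T := c.cost + 1 + 1) (i := 5) (b := b) (N := N)
    (Inv := fun k m' => m'.narr A = fun i => if i < k then f i else m.narr A i)
    hm hb h1 hN (by rwa [hw]) (by rwa [hw]) (by rwa [hw]) (fun k m x h => h) (by simp)
    ?_).mono (by simp [Nat.add_assoc]) fun _ h => h
  intro k hk m' hm' ha hk5 hInv
  obtain ⟨hs, hd⟩ := hc k hk m' hm' ha hk5 (by rw [hInv]; simp)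
  refine WP.seq hm' ((WP.of_safe hG hm' hs (R := fun m'' => m''.nreg 10 = f k) hd).frame.mono
    le_rfl ?_)
  rintro m'' ⟨h10, hm'', ha'⟩
  refine WP.instr hm'' (hm''.exec hG trivial) ?_
  have hA' : m''.narr A = m'.narr A := ha'.narr A (by simp [hA])
  have h5' : m''.nreg 5 = k := (ha'.nreg 5 h5).trans hk5
  funext i
  simp only [Instr.exec, setArr_apply, if_true, hA', hInv, h5', h10, Function.update_apply]
  split_ifs <;> first | rfl | omega | (subst_vars; rfl)

/-- The memory holds the input `g`. -/
structure Initial (g : Inst) (m : Store) : Prop where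
  n : m.nreg 0 = g.n
  nc : m.nreg 1 = g.nc
  mm : m.nreg 2 = g.mm
  zero : m.nreg 3 = 0
  la : m.narr 0 = g.la
  lb : m.narr 1 = g.lb
  src : m.narr 2 = g.src
  ch : m.narr 3 = g.ch
  tg : m.narr 4 = g.tg
  rew : m.rarr 0 = g.rew
  narr : ∀ A, 4 < A → m.narr A = fun _ => 0
  rreg : ∀ x, m.rreg x = 0

/-- Linking the transitions with the same target. -/
def linkLoop : Prog :=
  forLoop 5 2 (block [.instr (.load 10 4 5), .instr (.load 11 7 10), .instr (.store 8 5 11),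
    .instr (.add 11 5 4), .instr (.store 7 10 11)])

/-- Transition `k` is put in front of the list of its target: the old head becomes its link. Indices
are stored plus 1, so the initial zeros represent empty lists. -/
theorem linkLoop_spec (hG : G 0) {m : Store} (hm : m.Ok B G) (hmm : m.nreg 2 = g.mm)
    (h4 : m.nreg 4 = 1) (htg : m.narr 4 = g.tg) (h7 : m.narr 7 = fun _ => 0)
    (hB : g.mm + 1 ≤ B) :
    WP (Store.Ok B G) linkLoop (g.mm * 12 + 3)
      (fun m' => (∀ t, Chain (m'.narr 8) (m'.narr 7 t) (g.inList t)) ∧ m'.Ok B G ∧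
        Agree linkLoop.writes m m') m := by
  refine WP.forLoop hG (T := 9) (N := g.mm)
    (Inv := fun k m' => ∀ t, Chain (m'.narr 8) (m'.narr 7 t) (g.inListBelow t k))
    hm hmm h4 hB (hreg := fun _ _ _ h => h) (h0 := by simp [h7, Inst.inListBelow, Chain])
    (hstep := ?_)
  intro k hk m' hm' ha h5 hInv
  have h4' : m'.nreg 4 = 1 := (ha.nreg 4 (by decide)).trans h4
  have htg' : m'.narr 4 = g.tg := (ha.narr 4 (by decide)).trans htg
  refine (WP.of_safe hG hm' ?_ ?_).mono (T := 9) (by decide) fun _ h => h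
  · simp [block, Prog.Safe, Prog.den, Instr.Safe, Instr.exec, h5, h4']
    omega
  · have hd : ∀ c, c = (block [.instr (.load 10 4 5), .instr (.load 11 7 10),
        .instr (.store 8 5 11), .instr (.add 11 5 4), .instr (.store 7 10 11)]) →
        (c.den m').narr = setArr (setArr m'.narr 8 k (m'.narr 7 (g.tg k))) 7 (g.tg k) (k + 1) := by
      rintro c rfl
      simp [block, Prog.den, Instr.exec, h5, h4', htg']
    rw [hd _ rfl]
    intro t
    have hnew : ∀ t, Chain (Function.update (m'.narr 8) k (m'.narr 7 (g.tg k))) (m'.narr 7 t)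
        (g.inListBelow t k) := fun t => (hInv t).congr fun j hj =>
      Function.update_of_ne (by have := ((g.mem_inListBelow).1 hj).1; omega) _ _
    by_cases ht : g.tg k = t
    · subst ht
      simpa [setArr_apply, Inst.inListBelow, Chain] using hnew (g.tg k)
    · simpa [setArr_apply, Inst.inListBelow, ht, Function.update_of_ne (Ne.symm ht)] using hnew t

/-- Counting the choices of every state. -/
def countLoop : Prog :=
  forLoop 5 1 (block [.instr (.load 10 2 5), .instr (.load 11 9 10), .instr (.add 11 11 4),
    .instr (.store 9 10 11)])

theorem Inst.nchBelow_succ (k s : ℕ) :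
    g.nchBelow (k + 1) s = g.nchBelow k s + if g.src k = s then 1 else 0 := by
  unfold nchBelow
  rw [Finset.range_add_one, Finset.filter_insert]
  split_ifs
  · rw [Finset.card_insert_of_notMem (by simp)]
  · rfl

theorem Inst.nchBelow_le (k s : ℕ) : g.nchBelow k s ≤ k :=
  (Finset.card_filter_le _ _).trans (by simp)

theorem countLoop_spec (hG : G 0) {m : Store} (hm : m.Ok B G) (hnc : m.nreg 1 = g.nc)
    (h4 : m.nreg 4 = 1) (hsrc : m.narr 2 = g.src) (h9 : m.narr 9 = fun _ => 0)
    (hB : g.nc + 1 ≤ B) :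
    WP (Store.Ok B G) countLoop (g.nc * 10 + 3)
      (fun m' => (∀ s, m'.narr 9 s = g.nchBelow g.nc s) ∧ m'.Ok B G ∧
        Agree countLoop.writes m m') m := by
  refine WP.forLoop hG (T := 7) (N := g.nc)
    (Inv := fun k m' => ∀ s, m'.narr 9 s = g.nchBelow k s)
    hm hnc h4 hB (hreg := fun _ _ _ h => h) (h0 := by simp [h9, Inst.nchBelow])
    (hstep := ?_)
  intro k hk m' hm' ha h5 hInv
  have h4' : m'.nreg 4 = 1 := (ha.nreg 4 (by decide)).trans h4
  have hsrc' : m'.narr 2 = g.src := (ha.narr 2 (by decide)).trans hsrc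
  refine (WP.of_safe hG hm' ?_ ?_).mono (T := 7) (by decide) fun _ h => h
  · have := g.nchBelow_le k (g.src k)
    simp [block, Prog.Safe, Prog.den, Instr.Safe, Instr.exec, h5, h4', hInv, hsrc']
    omega
  · have hd : ∀ c, c = (block [.instr (.load 10 2 5), .instr (.load 11 9 10),
        .instr (.add 11 11 4), .instr (.store 9 10 11)]) →
        (c.den m').narr = setArr m'.narr 9 (g.src k) (m'.narr 9 (g.src k) + 1) := by
      rintro c rfl
      simp [block, Prog.den, Instr.exec, h5, h4', hsrc']
    rw [hd _ rfl]
    intro s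
    rw [Inst.nchBelow_succ]
    by_cases hs : g.src k = s
    · subst hs; simp [setArr_apply, hInv]
    · simp [setArr_apply, hInv, hs, Function.update_of_ne (Ne.symm hs)]

/-- Computation of the flag of `a ∧ ¬ b` and reward `0`. -/
def zeroFlag : Prog :=
  block [.instr (.const 10 0), .instr (.load 11 0 5), .ite (.eq 11 4)
    (block [.instr (.load 11 1 5), .ite (.eq 11 3)
      (block [.instr (.rload 1 0 5), .ite (.rle 1 3) (.instr (.const 10 1)) .skip]) .skip]) .skip]

/-- The initial computations. -/
def prep : Prog :=
  block [.instr (.const 4 1), .instr (.const 15 1),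
    fill 5 0 (.seq (.instr (.load 10 1 5)) (.instr (.sub 10 4 10))), fill 6 0 zeroFlag,
    linkLoop, countLoop]

/-- The last three conditions describe the start of the greedy algorithm: the tag says finite
exactly at the states with `b`, register 15 says that `R` is nonempty, and real register 0 holds its
minimum. -/
theorem prep_spec (hG : G 0) {m : Store} (hm : m.Ok B G) (hi : Initial g m)
    (hBn : g.n + 1 ≤ B) (hBc : g.nc + 1 ≤ B) (hBm : g.mm + 1 ≤ B) :
    WP (Store.Ok B G) prep (28 * g.n + 10 * g.nc + 12 * g.mm + 30)
      (fun m' => Static g m' ∧ (∀ s < g.n, m'.narr 5 s = 1 - g.lb s) ∧ m'.nreg 15 = 1 ∧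
        m'.rreg 0 = 0) m := by
  have e1 := hm.exec hG (i := .const 4 1) (show 1 ≤ B by omega)
  have e2 := e1.exec hG (i := .const 15 1) (show 1 ≤ B by omega)
  refine (WP.seq (T := 1) (T' := 1 + (g.n * 8 + 3 + (g.n * 20 + 3 + (g.mm * 12 + 3 +
    (g.nc * 10 + 3) + 1) + 1) + 1) + 1) hm
    (WP.instr hm e1 (WP.seq (T := 1) e1 (WP.instr e1 e2 (WP.seq e2 ?_))))).mono (by omega)
    fun _ h => h
  have i0 : ((Instr.const 15 1).exec ((Instr.const 4 1).exec m)).nreg 0 = g.n := by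
    simp [Instr.exec, hi.n]
  have i1 : ((Instr.const 15 1).exec ((Instr.const 4 1).exec m)).nreg 1 = g.nc := by
    simp [Instr.exec, hi.nc]
  have i2 : ((Instr.const 15 1).exec ((Instr.const 4 1).exec m)).nreg 2 = g.mm := by
    simp [Instr.exec, hi.mm]
  have i3 : ((Instr.const 15 1).exec ((Instr.const 4 1).exec m)).nreg 3 = 0 := by
    simp [Instr.exec, hi.zero]
  have i4 : ((Instr.const 15 1).exec ((Instr.const 4 1).exec m)).nreg 4 = 1 := by
    simp [Instr.exec]
  have i15 : ((Instr.const 15 1).exec ((Instr.const 4 1).exec m)).nreg 15 = 1 := by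
    simp [Instr.exec]
  have hA : ((Instr.const 15 1).exec ((Instr.const 4 1).exec m)).narr = m.narr := rfl
  have hR : ((Instr.const 15 1).exec ((Instr.const 4 1).exec m)).rarr = m.rarr := rfl
  have hr : ((Instr.const 15 1).exec ((Instr.const 4 1).exec m)).rreg = m.rreg := rfl
  set m1 := (Instr.const 15 1).exec ((Instr.const 4 1).exec m)
  clear_value m1
  refine (fill_spec hG (f := fun s => 1 - g.lb s) e2 i0 i4 hBn ?_).mono le_rfl ?_
  · intro k hk m' _ ha h5 _
    simp [Prog.Safe, Prog.den, Instr.Safe, Instr.exec, ha.nreg 4 (by decide), i4,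
      ha.narr 1 (by decide), hA, hi.lb, h5]
  rintro m2 ⟨h5, e3, a2⟩
  refine WP.seq e3 ((fill_spec hG (f := g.zf) e3 ((a2.nreg 0 (by decide)).trans i0)
    ((a2.nreg 4 (by decide)).trans i4) hBn ?_).mono (Nat.add_le_add_right (Nat.mul_le_mul_left _ (by decide)) _) ?_)
  · intro k hk m' _ ha h5 _
    have j0 : m'.narr 0 = g.la := by
      rw [ha.narr 0 (by decide), a2.narr 0 (by decide), hA, hi.la]
    have j1 : m'.narr 1 = g.lb := by
      rw [ha.narr 1 (by decide), a2.narr 1 (by decide), hA, hi.lb]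
    have j3 : m'.nreg 3 = 0 := by
      rw [ha.nreg 3 (by decide), a2.nreg 3 (by decide), i3]
    have j4 : m'.nreg 4 = 1 := by
      rw [ha.nreg 4 (by decide), a2.nreg 4 (by decide), i4]
    have jr : m'.rarr 0 = g.rew := by
      rw [ha.rarr 0 (by decide), a2.rarr 0 (by decide), hR, hi.rew]
    have jz : m'.rreg 3 = 0 := by
      rw [ha.rreg 3 (by decide), a2.rreg 3 (by decide), hr, hi.rreg]
    refine ⟨?_, ?_⟩
    · simp [zeroFlag, block, Prog.Safe, Prog.den, Instr.Safe]; omega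
    by_cases ha : g.la k = 1 <;> by_cases hb : g.lb k = 0 <;> by_cases hz : g.rew k ≤ 0 <;>
      simp [zeroFlag, block, Prog.den, Instr.exec, Test.holds, j0, j1, j3, j4, jr, jz, h5,
        Inst.zf, hk, ha, hb, hz]
  rintro m3 ⟨h6, e4, a3⟩
  have q : ∀ A, 6 < A → m3.narr A = fun _ => 0 := fun A hA' => by
    have w3 : A ∉ (fill 6 0 zeroFlag).writes.narr := by
      simp [fill, forLoop, zeroFlag, block, Prog.writes, Instr.writes, Writes.union]; omega
    have w2 : A ∉ (fill 5 0 (.seq (.instr (.load 10 1 5))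
        (.instr (.sub 10 4 10)))).writes.narr := by
      simp [fill, forLoop, Prog.writes, Instr.writes, Writes.union]; omega
    rw [a3.narr A w3, a2.narr A w2, hA, hi.narr A (by omega)]
  refine WP.seq e4 ((linkLoop_spec (g := g) hG e4 ?_ ?_ ?_ (q 7 (by omega)) hBm).mono le_rfl ?_)
  · rw [a3.nreg 2 (by decide), a2.nreg 2 (by decide), i2]
  · rw [a3.nreg 4 (by decide), a2.nreg 4 (by decide), i4]
  · rw [a3.narr 4 (by decide), a2.narr 4 (by decide), hA, hi.tg]
  rintro m4 ⟨hl, e5, a4⟩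
  refine (countLoop_spec (g := g) hG e5 ?_ ?_ ?_ ?_ hBc).mono le_rfl ?_
  · rw [a4.nreg 1 (by decide), a3.nreg 1 (by decide), a2.nreg 1 (by decide), i1]
  · rw [a4.nreg 4 (by decide), a3.nreg 4 (by decide), a2.nreg 4 (by decide), i4]
  · rw [a4.narr 2 (by decide), a3.narr 2 (by decide), a2.narr 2 (by decide), hA, hi.src]
  · rw [a4.narr 9 (by decide), q 9 (by omega)]
  rintro m5 ⟨h9, e6, a5⟩
  have nr : ∀ x < 5, m5.nreg x = m1.nreg x := fun x hx => by
    interval_cases x <;> rw [a5.nreg _ (by decide), a4.nreg _ (by decide), a3.nreg _ (by decide),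
      a2.nreg _ (by decide)]
  have na : ∀ x < 5, m5.narr x = m.narr x := fun x hx => by
    interval_cases x <;> rw [a5.narr _ (by decide), a4.narr _ (by decide), a3.narr _ (by decide),
      a2.narr _ (by decide), hA]
  refine ⟨⟨(nr 0 (by omega)).trans i0, (nr 1 (by omega)).trans i1, (nr 2 (by omega)).trans i2,
    (nr 3 (by omega)).trans i3, (nr 4 (by omega)).trans i4, (na 0 (by omega)).trans hi.la,
    (na 1 (by omega)).trans hi.lb, (na 2 (by omega)).trans hi.src, (na 3 (by omega)).trans hi.ch,
    (na 4 (by omega)).trans hi.tg, ?_, ?_, ?_, fun s _ => h9 s⟩, ?_, ?_, ?_⟩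
  · rw [a5.narr 6 (by decide), a4.narr 6 (by decide), h6]
    funext s
    split_ifs with hs
    · rfl
    · rw [a2.narr 6 (by decide), hA, hi.narr 6 (by omega)]
      simp [Inst.zf, hs]
  · rw [a5.rarr 0 (by decide), a4.rarr 0 (by decide), a3.rarr 0 (by decide),
      a2.rarr 0 (by decide), hR, hi.rew]
  · intro t _
    rw [a5.narr 8 (by decide), a5.narr 7 (by decide)]
    exact hl t
  · intro s hs
    rw [a5.narr 5 (by decide), a4.narr 5 (by decide), a3.narr 5 (by decide), h5]
    simp [hs]
  · rw [a5.nreg 15 (by decide), a4.nreg 15 (by decide), a3.nreg 15 (by decide),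
      a2.nreg 15 (by decide), i15]
  · rw [a5.rreg 0 (by decide), a4.rreg 0 (by decide), a3.rreg 0 (by decide),
      a2.rreg 0 (by decide), hr, hi.rreg]

end Preparation

/-! ### Attractors characterize the four quantifiers. -/

section AttractorSets

variable {S : Type u}

/-- `P` is the least set that contains `Sd` and is closed under adding the states in `Z` that
satisfy `Mk`. -/
structure IsAttr (Z : Set S) (Mk : Set S → S → Prop) (Sd P : Set S) : Prop where
  mem_iff : ∀ t, t ∈ P ↔ t ∈ Sd ∨ t ∈ Z ∧ Mk P t
  least : ∀ V, Sd ⊆ V → (∀ t ∈ Z, Mk V t → t ∈ V) → P ⊆ V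

variable {Act : Type v} {AP : Type w} {M : MDP S Act AP} {Z Y P : Set S}

theorem not_pre_exPos_iff (P : Set S) (s : S) : ¬ M.pre exPos P s ↔ M.pre allOne Pᶜ s := by
  simp only [MDP.pre, exPos, allOne, not_exists, not_and, Set.mem_compl_iff]

/-- A step into `V` is possible by a choice whose successors are in `W`. -/
def MDP.safeStep (M : MDP S Act AP) (W V : Set S) (t : S) : Prop :=
  ∃ α ∈ M.enabled t, (∀ t', 0 < M.δ t α t' → t' ∈ W) ∧ ∃ t', 0 < M.δ t α t' ∧ t' ∈ V

theorem MDP.safeStep_univ : M.safeStep Set.univ = M.pre exPos := by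
  funext V t
  simp [MDP.safeStep, MDP.pre, exPos]

/-- The states attracted to `Y` by choices whose successors are in `Y ∪ U`. -/
def MDP.safeAttr (M : MDP S Act AP) (Z Y U : Set S) : Set S :=
  {t | ∀ V, Y ⊆ V → (∀ t ∈ Z, M.safeStep (Y ∪ U) V t → t ∈ V) → t ∈ V}

theorem IsAttr.eq_safeAttr {U : Set S} (h : IsAttr Z (M.safeStep (Y ∪ U)) Y P) :
    P = M.safeAttr Z Y U :=
  Set.Subset.antisymm (fun _ ht V h1 h2 => h.least V h1 h2 ht)
    fun _ ht => ht P (fun t ht => (h.mem_iff t).2 (Or.inl ht))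
      fun t hz hm => (h.mem_iff t).2 (Or.inr ⟨hz, hm⟩)

theorem MDP.safeAttr_mono {U U' : Set S} (h : U ⊆ U') : M.safeAttr Z Y U ⊆ M.safeAttr Z Y U' :=
  fun _ ht V h1 h2 => ht V h1 fun t hz ⟨α, hα, h3, h4⟩ =>
    h2 t hz ⟨α, hα, fun t' ht' => (h3 t' ht').imp_right (h ·), h4⟩

/-- The iterated restriction of the candidates, starting from `Z`. -/
def MDP.candidates (M : MDP S Act AP) (Z Y : Set S) : ℕ → Set S
  | 0 => Z
  | k + 1 => Z ∩ M.safeAttr Z Y (candidates M Z Y k)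

theorem MDP.candidates_succ_subset (k : ℕ) :
    M.candidates Z Y (k + 1) ⊆ M.candidates Z Y k := by
  induction k with
  | zero => exact Set.inter_subset_left
  | succ k ih => exact Set.inter_subset_inter_right _ (MDP.safeAttr_mono ih)

variable [Fintype S]

/-- The candidates lose a state at every restriction until they are stable, and stability persists.
-/
theorem MDP.candidates_stable : M.candidates Z Y (Fintype.card S + 1) =
    M.candidates Z Y (Fintype.card S) := by
  have key : ∀ k, M.candidates Z Y (k + 1) = M.candidates Z Y k ∨
      (M.candidates Z Y k).ncard + k ≤ Fintype.card S := by
    intro k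
    induction k with
    | zero =>
      right
      have := Set.ncard_le_card (M.candidates Z Y 0)
      simpa [Nat.card_eq_fintype_card] using this
    | succ k ih =>
      rcases ih with h | h
      · left
        exact congrArg (fun U => Z ∩ M.safeAttr Z Y U) h
      · rcases (M.candidates_succ_subset (Z := Z) (Y := Y) k).eq_or_ssubset with h' | h'
        · left
          exact congrArg (fun U => Z ∩ M.safeAttr Z Y U) h'
        · right
          have := Set.ncard_lt_ncard h'
          omega
  rcases key (Fintype.card S) with h | h
  · exact h
  · have h0 : (M.candidates Z Y (Fintype.card S)).ncard = 0 := by omega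
    rw [Set.ncard_eq_zero] at h0
    exact Set.Subset.antisymm (M.candidates_succ_subset _) (by rw [h0]; exact Set.empty_subset _)

variable [MeasurableSpace S] [DiscreteMeasurableSpace S]

/-- The one-step expansion makes the satisfying states closed, and the leastness lemmas put them
into every closed set. -/
theorem IsAttr.eq_sat {Q : ProbQuant} (hQ : Q = exPos ∨ Q = allPos)
    (h : IsAttr Z (M.pre Q) Y P) : P = {t | M.sat Q t (untilSet Z Y)} := by
  have hB : Q.Basic := by rcases hQ with rfl | rfl <;> simp [ProbQuant.Basic]
  refine Set.Subset.antisymm (h.least _ (fun t ht => sat_until_of_mem hB ht) fun t hz hp => ?_) ?_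
  · by_cases hY : t ∈ Y
    · exact sat_until_of_mem hB hY
    · exact (sat_until_step hB hY hz).2 hp
  · have h1 : Y ⊆ P := fun t ht => (h.mem_iff t).2 (Or.inl ht)
    have h2 : ∀ t ∈ Z, M.pre Q P t → t ∈ P := fun t hz hp => (h.mem_iff t).2 (Or.inr ⟨hz, hp⟩)
    intro t ht
    rcases hQ with rfl | rfl
    · exact sat_exPos_until_least h1 h2 ht
    · exact sat_allPos_until_least h1 h2 ht

theorem IsAttr.pre_iff {Q : ProbQuant} (hQ : Q = exPos ∨ Q = allPos)
    (h : IsAttr Z (M.pre Q) Y P) (s : S) : M.pre Q P s ↔ M.sat Q s (nextUntil Z Y) := by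
  have hB : Q.Basic := by rcases hQ with rfl | rfl <;> simp [ProbQuant.Basic]
  rw [sat_nextUntil_iff hB, h.eq_sat hQ]

/-- The states from which almost sure reachability fails, for some scheduler. -/
theorem IsAttr.compl_eq_sat_allOne [Finite Act] {T : Set S} (hYZ : Disjoint Y Z)
    (hT : IsAttr Z (M.pre allPos) Zᶜ T)
    (h : IsAttr Z (M.pre exPos) ((Zᶜ \ Y) ∪ (Z \ T)) P) :
    Pᶜ = {t | M.sat allOne t (untilSet Z Y)} := by
  have hB : allOne.Basic := by simp [ProbQuant.Basic]
  have hB' : allPos.Basic := by simp [ProbQuant.Basic]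
  have hTe := hT.eq_sat (Or.inr rfl)
  have hnY : ∀ t ∈ Z, t ∉ Y := fun t hz hy => Set.disjoint_left.1 hYZ hy hz
  refine Set.Subset.antisymm (fun t ht => ?_) fun t ht hP => ?_
  -- The seeds of `P` are the states where the until property fails at once and the states of `Z`
  -- where some scheduler stays in `Z` almost surely. The complement of `P` is closed under all
  -- actions outside `Y`.
  · have hcl : ∀ t ∈ Pᶜ, t ∉ Y → ∀ α ∈ M.enabled t, ∀ t', 0 < M.δ t α t' → t' ∈ Pᶜ := by
      intro t ht hY α hα t' ht' hP
      refine ht ((h.mem_iff t).2 ?_)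
      by_cases hz : t ∈ Z
      · exact Or.inr ⟨hz, α, hα, t', ht', hP⟩
      · exact Or.inl (Or.inl ⟨hz, hY⟩)
    refine sat_allOne_until_of_closed hcl (fun t ht => ?_) ht
    have hTt : M.sat allPos t (untilSet Z Zᶜ) := by
      by_cases hz : t ∈ Z
      · by_contra hn
        refine ht ((h.mem_iff t).2 (Or.inl (Or.inr ⟨hz, ?_⟩)))
        rw [hTe]
        exact hn
      · exact sat_until_of_mem hB' hz
    -- Outside `P`, leaving `Z` means entering `Y`. The leastness principle for leaving `Z` is
    -- applied to an implication as the set `V`.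
    refine sat_allPos_until_least (V := {t | t ∈ Pᶜ → M.sat allPos t (untilSet Z Y)})
      (fun t hz ht => ?_) (fun t hz hp ht => ?_) hTt ht
    · refine sat_until_of_mem hB' ?_
      by_contra hY
      exact ht ((h.mem_iff t).2 (Or.inl (Or.inl ⟨hz, hY⟩)))
    · refine (sat_until_step hB' (hnY t hz) hz).2 fun α hα => ?_
      obtain ⟨t', h1, h2⟩ := hp α hα
      exact ⟨t', h1, h2 (hcl t ht (hnY t hz) α hα t' h1)⟩
  -- Conversely, the states without almost sure success under all schedulers contain the seeds and
  -- are closed under possible predecessors in `Z`.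
  · refine (h.least {t | ¬ M.sat allOne t (untilSet Z Y)} ?_ ?_ hP) ht
    · rintro t (⟨hz, hY⟩ | ⟨hz, hnT⟩) hs
      · exact hz (mem_of_sat_until hB hY hs)
      · rw [hTe] at hnT
        refine hnT fun σ => ?_
        have h1 : (1 : ℝ) ≤ (σ.pathMeasure t).real (untilSet Z Y) := hs σ
        have h2 : (σ.pathMeasure t).real (untilSet Z Y) ≤ (σ.pathMeasure t).real
            (untilSet Z Zᶜ) :=
          σ.pr_mono t (untilSet_mono hYZ.subset_compl_right)
        exact one_pos.trans_le (h1.trans h2)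
    · rintro t hz ⟨α, hα, t', ht', hn⟩ hs
      exact hn ((sat_until_step hB (hnY t hz) hz).1 hs α hα t' ht')

/-- Winning states survive every restriction. By stability, the attractor `P` equals `Y` together
with the final candidates, so the choices that build it do not leave it, and
`sat_exOne_until_of_least` makes all its states winning. -/
theorem MDP.sat_exOne_iff_candidates [Finite Act]
    (h : IsAttr Z (M.safeStep (Y ∪ M.candidates Z Y (Fintype.card S))) Y P) (s : S) :
    M.safeStep (Y ∪ M.candidates Z Y (Fintype.card S)) P s ↔ M.sat exOne s (nextUntil Z Y) := by
  have hB : exOne.Basic := by simp [ProbQuant.Basic]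
  have hsub : ∀ k t, M.sat exOne t (untilSet Z Y) → t ∈ Y ∪ M.candidates Z Y k := by
    intro k
    induction k with
    | zero =>
      intro t ht
      by_cases hY : t ∈ Y
      · exact Or.inl hY
      · exact Or.inr (mem_of_sat_until hB hY ht)
    | succ k ih =>
      intro t ht
      by_cases hY : t ∈ Y
      · exact Or.inl hY
      · refine Or.inr ⟨mem_of_sat_until hB hY ht, fun V h1 h2 => ?_⟩
        exact sat_exOne_until_least h1 (fun t hz α hα h3 h4 =>
          h2 t hz ⟨α, hα, fun t' ht' => ih t' (h3 t' ht'), h4⟩) ht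
  have hP : P = Y ∪ M.candidates Z Y (Fintype.card S) := by
    rw [← MDP.candidates_stable]
    ext t
    rw [h.mem_iff t, MDP.candidates, ← h.eq_safeAttr]
    constructor
    · rintro (h' | h')
      · exact Or.inl h'
      · exact Or.inr ⟨h'.1, (h.mem_iff t).2 (Or.inr h')⟩
    · rintro (h' | h')
      · exact Or.inl h'
      · exact (h.mem_iff t).1 h'.2
  have hsat : {t | M.sat exOne t (untilSet Z Y)} = P := by
    refine Set.Subset.antisymm (fun t ht => hP ▸ hsub _ t ht) fun t ht => ?_
    refine sat_exOne_until_of_least (W := P) (fun V h1 h2 => h.least V h1 ?_) ht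
    rintro t hz ⟨α, hα, h3, h4⟩
    exact h2 t hz α hα (by rwa [hP]) h4
  rw [sat_nextUntil_iff hB, hsat]
  constructor
  · rintro ⟨α, hα, h1, -⟩
    exact ⟨α, hα, by rwa [hP]⟩
  · rintro ⟨α, hα, h1⟩
    -- `safeStep` also asks for a successor in `P`; any successor will do.
    obtain ⟨t, ht⟩ := (M.δ s α).support_nonempty
    have ht' : 0 < M.δ s α t := pos_iff_ne_zero.2 ((M.δ s α).mem_support_iff t |>.1 ht)
    exact ⟨α, hα, hP ▸ h1, t, ht', h1 t ht'⟩

end AttractorSets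

/-! ### From indices to states, actions and transitions. -/

section Transfer

variable {S : Type u} {Act : Type v} {AP : Type w} [Fintype S] {M : MDP S Act AP}

namespace MDP.Listing

variable (E : M.Listing) (a b : AP)

/-- The number of a state. -/
def idx (t : S) : ℕ := E.states.symm t

/-- The number of a pair of a state and an enabled action. -/
def cidx {s : S} {α : Act} (h : α ∈ M.enabled s) : ℕ := E.choices.symm ⟨(s, α), h⟩

theorem idx_lt (t : S) : E.idx t < Fintype.card S := (E.states.symm t).2

theorem idx_inj {t t' : S} : E.idx t = E.idx t' ↔ t = t' := by
  rw [idx, idx, Fin.val_inj, EmbeddingLike.apply_eq_iff_eq]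

theorem exists_idx {i : ℕ} (hi : i < Fintype.card S) : ∃ t, E.idx t = i :=
  ⟨E.states ⟨i, hi⟩, by simp [idx]⟩

theorem idx_states (i : Fin (Fintype.card S)) : E.idx (E.states i) = i := by simp [idx]

/-- The input as an instance of the problems solved by the machine. -/
def inst : Inst where
  n := Fintype.card S
  nc := Nat.card M.Choice
  mm := M.numTrans
  la := (E.input a b).narr 0
  lb := (E.input a b).narr 1
  src := (E.input a b).narr 2
  ch := (E.input a b).narr 3
  tg := (E.input a b).narr 4
  rew := (E.input a b).rarr 0
  src_lt c hc := by simp [input, arrayOf, hc]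
  ch_lt j hj := by simp [input, arrayOf, hj]
  tg_lt j hj := by simp [input, arrayOf, hj]

theorem initial : Initial (E.inst a b) (E.input a b) := by
  refine ⟨rfl, rfl, rfl, rfl, rfl, rfl, rfl, rfl, rfl, rfl, fun A hA => ?_, fun x => rfl⟩
  obtain ⟨k, rfl⟩ : ∃ k, A = k + 5 := ⟨A - 5, by omega⟩
  rfl

open Classical in
theorem la_idx (t : S) : (E.inst a b).la (E.idx t) = if a ∈ M.label t then 1 else 0 := by
  simp [inst, input, arrayOf, idx]

open Classical in
theorem lb_idx (t : S) : (E.inst a b).lb (E.idx t) = if b ∈ M.label t then 1 else 0 := by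
  simp [inst, input, arrayOf, idx]

theorem rew_idx (t : S) : (E.inst a b).rew (E.idx t) = M.rew t := by
  simp [inst, input, arrayOf, idx]

open Classical in
theorem zf_idx (t : S) : (E.inst a b).zf (E.idx t) = if t ∈ M.zeroStates a b then 1 else 0 := by
  have h : E.idx t < (E.inst a b).n := E.idx_lt t
  have h' : (M.rew t : ℝ) ≤ 0 ↔ M.rew t = 0 := by
    rw [← NNReal.coe_zero, NNReal.coe_le_coe, nonpos_iff_eq_zero]
  simp only [Inst.zf, h, true_and, la_idx, lb_idx, rew_idx, zeroStates, h', Set.mem_ofPred_eq]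
  by_cases h1 : a ∈ M.label t <;> by_cases h2 : b ∈ M.label t <;> simp [h1, h2]

variable {a b}

theorem exists_choice_iff {s : S} {Φ : ℕ → Prop} :
    (∃ c < (E.inst a b).nc, (E.inst a b).src c = E.idx s ∧ Φ c) ↔
      ∃ α, ∃ h : α ∈ M.enabled s, Φ (E.cidx h) := by
  constructor
  · rintro ⟨c, hc, h1, h2⟩
    have hc' : c < Nat.card M.Choice := hc
    have h3 : (E.choices ⟨c, hc'⟩).1.1 = s := by
      rw [← E.idx_inj, ← h1]
      simp [inst, input, arrayOf, hc', idx]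
    obtain ⟨⟨⟨s', α⟩, hα⟩, hx⟩ : ∃ x, E.choices ⟨c, hc'⟩ = x := ⟨_, rfl⟩
    rw [hx] at h3
    obtain rfl : s' = s := h3
    refine ⟨α, hα, ?_⟩
    have : E.cidx hα = c := by
      change ((E.choices.symm ⟨(s', α), hα⟩ : Fin _) : ℕ) = c
      rw [← hx, Equiv.symm_apply_apply]
    rwa [this]
  · rintro ⟨α, h, hΦ⟩
    refine ⟨E.cidx h, (E.choices.symm ⟨(s, α), h⟩).2, ?_, hΦ⟩
    have hx : E.choices (E.choices.symm ⟨(s, α), h⟩) = ⟨(s, α), h⟩ := E.choices.apply_symm_apply _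
    simp [inst, input, arrayOf, cidx, idx, hx]

theorem forall_choice_iff {s : S} {Φ : ℕ → Prop} :
    (∀ c < (E.inst a b).nc, (E.inst a b).src c = E.idx s → Φ c) ↔
      ∀ α, ∀ h : α ∈ M.enabled s, Φ (E.cidx h) := by
  have := not_congr (E.exists_choice_iff (a := a) (b := b) (s := s) (Φ := fun c => ¬ Φ c))
  push Not at this
  exact this

theorem exists_trans_iff {s : S} {α : Act} (h : α ∈ M.enabled s) {Ψ : ℕ → Prop} :
    (∃ j < (E.inst a b).mm, (E.inst a b).ch j = E.cidx h ∧ Ψ ((E.inst a b).tg j)) ↔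
      ∃ t, 0 < M.δ s α t ∧ Ψ (E.idx t) := by
  constructor
  · rintro ⟨j, hj, h1, h2⟩
    have hj' : j < M.numTrans := hj
    obtain ⟨⟨⟨s', α', t⟩, hα⟩, hx⟩ : ∃ x, E.transitions ⟨j, hj'⟩ = x := ⟨_, rfl⟩
    have htg : (E.inst a b).tg j = E.idx t := by
      simp [inst, input, arrayOf, hj', hx, idx]
    have hch : (E.inst a b).ch j = E.cidx hα.1 := by
      simp [inst, input, arrayOf, hj', hx, cidx]
    rw [hch] at h1
    have h3 := congrArg (fun c : M.Choice => c.1) (E.choices.symm.injective (Fin.ext h1))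
    obtain ⟨rfl, rfl⟩ : s' = s ∧ α' = α := Prod.mk.inj h3
    exact ⟨t, hα.2, by rwa [← htg]⟩
  · rintro ⟨t, ht, hΨ⟩
    have hx := E.transitions.apply_symm_apply ⟨(s, α, t), h, ht⟩
    set j := E.transitions.symm ⟨(s, α, t), h, ht⟩
    refine ⟨j, j.2, ?_, ?_⟩
    · simp [inst, input, arrayOf, cidx, hx]
    · simpa [inst, input, arrayOf, idx, hx] using hΨ

theorem marked_one_iff {H : ℕ → Prop} {Sd : ℕ → Prop} {V : Set ℕ} {s : S} :
    AttrData.Marked ⟨fun _ => 1, H, Sd⟩ (E.inst a b) (fun j => (E.inst a b).tg j ∈ V) (E.idx s) ↔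
      ∃ α, ∃ h : α ∈ M.enabled s, ¬ H (E.cidx h) ∧ ∃ t, 0 < M.δ s α t ∧ E.idx t ∈ V := by
  classical
  rw [AttrData.Marked]
  simp only [Nat.one_pos, true_and, Nat.one_le_iff_ne_zero, Inst.cnt]
  rw [← Nat.pos_iff_ne_zero, Finset.card_pos, Finset.Nonempty]
  simp only [Finset.mem_filter, Finset.mem_range]
  rw [E.exists_choice_iff (Φ := fun c => ¬ H c ∧ ∃ j < (E.inst a b).mm,
    (E.inst a b).ch j = c ∧ (E.inst a b).tg j ∈ V)]
  refine exists_congr fun α => exists_congr fun h => and_congr_right fun _ => ?_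
  exact E.exists_trans_iff h (Ψ := (· ∈ V))

/-- The count reaches the number of all choices only if no choice is missing; the threshold is
positive because some action is enabled. -/
theorem marked_all_iff {Sd : ℕ → Prop} {V : Set ℕ} {s : S} :
    AttrData.Marked ⟨(E.inst a b).nchBelow (E.inst a b).nc, fun _ => False, Sd⟩ (E.inst a b)
      (fun j => (E.inst a b).tg j ∈ V) (E.idx s) ↔
      ∀ α ∈ M.enabled s, ∃ t, 0 < M.δ s α t ∧ E.idx t ∈ V := by
  classical
  have h0 : 0 < (E.inst a b).nchBelow (E.inst a b).nc (E.idx s) := by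
    obtain ⟨α, hα⟩ := M.enabled_nonempty s
    obtain ⟨c, hc, h, -⟩ := (E.exists_choice_iff (a := a) (b := b) (Φ := fun _ => True)).2
      ⟨α, hα, trivial⟩
    rw [Inst.nchBelow, Finset.card_pos]
    exact ⟨c, by simp [hc, h]⟩
  rw [AttrData.Marked, and_iff_right h0]
  simp only [true_and, Inst.nchBelow, Inst.cnt, not_false_eq_true]
  have h1 : (∀ α ∈ M.enabled s, ∃ t, 0 < M.δ s α t ∧ E.idx t ∈ V) ↔
      ∀ c < (E.inst a b).nc, (E.inst a b).src c = E.idx s → ∃ j < (E.inst a b).mm,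
        (E.inst a b).ch j = c ∧ (E.inst a b).tg j ∈ V := by
    rw [E.forall_choice_iff (Φ := fun c => ∃ j < (E.inst a b).mm, (E.inst a b).ch j = c ∧
      (E.inst a b).tg j ∈ V)]
    exact forall_congr' fun α => forall_congr' fun h =>
      (E.exists_trans_iff h (Ψ := (· ∈ V))).symm
  rw [h1]
  have hsub : ((Finset.range (E.inst a b).nc).filter fun c => (E.inst a b).src c = E.idx s ∧
      ∃ j < (E.inst a b).mm, (E.inst a b).ch j = c ∧ (E.inst a b).tg j ∈ V) ⊆
      (Finset.range (E.inst a b).nc).filter fun c => (E.inst a b).src c = E.idx s :=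
    Finset.monotone_filter_right _ fun c _ h => h.1
  constructor
  · intro h c hc hs
    have := Finset.eq_of_subset_of_card_le hsub h
    have hm : c ∈ (Finset.range (E.inst a b).nc).filter fun c => (E.inst a b).src c = E.idx s := by
      simp [hc, hs]
    rw [← this] at hm
    exact (Finset.mem_filter.1 hm).2.2
  · intro h
    refine Finset.card_le_card fun c hc => ?_
    simp only [Finset.mem_filter, Finset.mem_range] at hc ⊢
    exact ⟨hc.1, hc.2, h c hc.1 hc.2⟩

theorem isAttr_of_solves {p : AttrData} {P : Set ℕ} {Mk : Set S → S → Prop}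
    (h : p.Solves (E.inst a b) P)
    (hMk : ∀ (V : Set ℕ) s, p.Marked (E.inst a b) (fun j => (E.inst a b).tg j ∈ V) (E.idx s) ↔
      Mk {t | E.idx t ∈ V} s) :
    IsAttr (M.zeroStates a b) Mk {t | p.Sd (E.idx t)} {t | E.idx t ∈ P} := by
  have hz : ∀ t, (E.inst a b).zf (E.idx t) = 1 ↔ t ∈ M.zeroStates a b := fun t => by
    classical
    rw [zf_idx]; split_ifs with h <;> simp [h]
  refine ⟨fun t => ?_, fun V h1 h2 t ht => ?_⟩
  · have := h.1 (E.idx t)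
    rw [hz, hMk] at this
    rw [and_iff_right (show E.idx t < (E.inst a b).n from E.idx_lt t)] at this
    exact this
  · have hV : {t | E.idx t ∈ {i | ∃ t ∈ V, E.idx t = i}} = V := by
      ext t; simp [E.idx_inj]
    have hcl : p.Closed (E.inst a b) {i | ∃ t ∈ V, E.idx t = i} := by
      refine ⟨fun i hi hSd => ?_, fun i hi hzi hm => ?_⟩
      · obtain ⟨t, rfl⟩ := E.exists_idx hi
        exact ⟨t, h1 hSd, rfl⟩
      · obtain ⟨t, rfl⟩ := E.exists_idx hi
        rw [hMk, hV] at hm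
        exact ⟨t, h2 t ((hz t).1 hzi) hm, rfl⟩
    obtain ⟨t', ht', h3⟩ := h.2 _ hcl ht
    rw [E.idx_inj] at h3
    rwa [← h3]

end MDP.Listing

theorem MDP.finite_choice [Finite Act] : Finite M.Choice := by
  unfold MDP.Choice; infer_instance

theorem MDP.finite_transition [Finite Act] : Finite M.Transition := by
  unfold MDP.Transition; infer_instance

/-- Every state has an enabled action. With `card_choice_le_numTrans`, all sizes of the input are
bounded by `numTrans`. -/
theorem MDP.card_le_card_choice [Finite Act] : Fintype.card S ≤ Nat.card M.Choice := by
  have := M.finite_choice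
  choose f hf using M.enabled_nonempty
  rw [← Nat.card_eq_fintype_card]
  refine Nat.card_le_card_of_injective (fun s => (⟨(s, f s), hf s⟩ : M.Choice)) fun s s' h => ?_
  exact congrArg (fun c : M.Choice => c.1.1) h

theorem MDP.card_choice_le_numTrans [Finite Act] : Nat.card M.Choice ≤ M.numTrans := by
  have := M.finite_transition
  have : ∀ c : M.Choice, ∃ t, 0 < M.δ c.1.1 c.1.2 t := fun c => by
    obtain ⟨t, ht⟩ := (M.δ c.1.1 c.1.2).support_nonempty
    exact ⟨t, pos_iff_ne_zero.2 ((M.δ c.1.1 c.1.2).mem_support_iff t |>.1 ht)⟩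
  choose f hf using this
  refine Nat.card_le_card_of_injective
    (fun c => (⟨(c.1.1, c.1.2, f c), c.2, hf c⟩ : M.Transition)) fun c c' h => ?_
  have h1 := congrArg (fun τ : M.Transition => (τ.1.1, τ.1.2.1)) h
  exact Subtype.ext h1

end Transfer

/-! ### Next-until programs for three of the quantifiers. -/

section Subroutines

variable {S : Type u} {Act : Type v} {AP : Type w} [Fintype S] {M : MDP S Act AP}
  {E : M.Listing} {a b : AP} {B : ℕ} {G : ℝ → Prop} {m : Store}

open Classical in
/-- The array `A` holds the flags of the elements of `P`. -/
def MDP.Listing.Flags (E : M.Listing) (m : Store) (A : ℕ) (P : Set S) : Prop :=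
  ∀ t, m.narr A (E.idx t) = if t ∈ P then 1 else 0

theorem MDP.Listing.Flags.eq_one_iff {A : ℕ} {P : Set S} (h : E.Flags m A P) (t : S) :
    m.narr A (E.idx t) = 1 ↔ t ∈ P := by
  rw [h t]; split_ifs with h' <;> simp [h']

theorem MDP.Listing.Flags.of_agree {A : ℕ} {P : Set S} {w : Writes} {m' : Store}
    (h : E.Flags m A P) (ha : Agree w m m') (hA : A ∉ w.narr := by decide) : E.Flags m' A P := by
  intro t
  rw [ha.narr A hA]
  exact h t

open Classical in
theorem fillFlags_spec (hG : G 0) (hm : m.Ok B G) (hs : Static (E.inst a b) m)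
    (hB : M.numTrans + 1 ≤ B) {A : ℕ} {c : Prog} [Nonempty S] [Finite Act] (P : Set S)
    (hc : ∀ t m', Static (E.inst a b) m' → Agree (fill A 0 c).writes m m' → m'.nreg 5 = E.idx t →
      c.Safe B G m' ∧ (c.den m').nreg 10 = if t ∈ P then 1 else 0)
    (h5 : 5 ∉ c.writes.nreg := by decide) (hbi : 0 ∉ 5 :: c.writes.nreg := by decide)
    (h4 : 4 ∉ 5 :: c.writes.nreg := by decide) (hA : c.writes.narr = [] := by decide)
    (h1 : ∀ x ∈ (fill A 0 c).writes.nreg, 4 < x := by decide)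
    (h2 : ∀ A' ∈ (fill A 0 c).writes.narr, A' = 5 ∨ 9 < A' := by decide)
    (h3 : ∀ A' ∈ (fill A 0 c).writes.rarr, 0 < A' := by decide) :
    WP (Store.Ok B G) (fill A 0 c) ((c.cost + 8) * M.numTrans)
      (fun m' => E.Flags m' A P ∧ m'.Ok B G ∧ Agree (fill A 0 c).writes m m' ∧
        Static (E.inst a b) m') m := by
  have hn : Fintype.card S ≤ M.numTrans := M.card_le_card_choice.trans M.card_choice_le_numTrans
  have hpos : 0 < Fintype.card S := Fintype.card_pos
  refine (fill_spec hG (N := Fintype.card S)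
    (f := fun i => if ∃ t ∈ P, E.idx t = i then 1 else 0) hm hs.n hs.one (by omega)
    ?_ h5 hbi h4 hA).mono ?_ ?_
  · intro k hk m' hm' ha hk5 _
    obtain ⟨t, rfl⟩ := E.exists_idx hk
    obtain ⟨h, h'⟩ := hc t m' (hs.of_agree ha h1 h2 h3) ha hk5
    exact ⟨h, by rw [h']; simp [E.idx_inj]⟩
  · have : Fintype.card S * (c.cost + 5) ≤ M.numTrans * (c.cost + 5) := Nat.mul_le_mul_right _ hn
    have e : (c.cost + 8) * M.numTrans = M.numTrans * (c.cost + 5) + 3 * M.numTrans := by ring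
    omega
  · rintro m' ⟨h, hm', ha⟩
    refine ⟨fun t => ?_, hm', ha, hs.of_agree ha h1 h2 h3⟩
    rw [h]
    simp [E.idx_lt, E.idx_inj]

/-- Marking all choices as usable. -/
def clearHit : Prog := fill 11 1 (.instr (.const 10 0))

theorem clearHit_spec (hG : G 0) (hm : m.Ok B G) (hs : Static (E.inst a b) m)
    (hB : M.numTrans + 1 ≤ B) [Nonempty S] [Finite Act] :
    WP (Store.Ok B G) clearHit (9 * M.numTrans)
      (fun m' => (∀ c < (E.inst a b).nc, m'.narr 11 c = 0) ∧ m'.Ok B G ∧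
        Agree clearHit.writes m m' ∧ Static (E.inst a b) m') m := by
  have hn := M.card_le_card_choice
  have hn' := M.card_choice_le_numTrans
  have hpos : 0 < Fintype.card S := Fintype.card_pos
  refine (fill_spec hG (N := Nat.card M.Choice) (f := fun _ => 0) hm hs.nc hs.one (by omega)
    ?_).mono ?_ ?_
  · intro k hk m' hm' ha hk5 _
    simp [Prog.Safe, Instr.Safe, Prog.den, Instr.exec]
  · change Nat.card M.Choice * 6 + 3 ≤ _
    omega
  · rintro m' ⟨h, hm', ha⟩
    refine ⟨fun c hc => ?_, hm', ha, hs.of_agree ha⟩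
    rw [h]
    exact if_pos hc

theorem attr_time [Nonempty S] [Finite Act] :
    (attrStep.cost + 22) * ((E.inst a b).n + (E.inst a b).mm + 1) ≤ 180 * M.numTrans := by
  have hn := M.card_le_card_choice
  have hn' := M.card_choice_le_numTrans
  have hpos : 0 < Fintype.card S := Fintype.card_pos
  have h1 : attrStep.cost + 22 ≤ 60 := by decide
  calc _ ≤ 60 * (3 * M.numTrans) := Nat.mul_le_mul h1
        (by change Fintype.card S + M.numTrans + 1 ≤ _; omega)
    _ = _ := by ring

/-- The attractor for one good choice. -/
def attrOne : Prog := .seq (fill 10 0 (.instr (.const 10 1))) attr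

/-- With need 1, one choice with flag 0 in array 11 marks a state; by `hW`, such a choice has all
its successors in `W`. -/
theorem attrOne_spec (hG : G 0) (hm : m.Ok B G) (hs : Static (E.inst a b) m)
    (hB : M.numTrans + 1 ≤ B) [Nonempty S] [Finite Act] {Sd W : Set S} (hSd : E.Flags m 14 Sd)
    (hW : ∀ s α (h : α ∈ M.enabled s), m.narr 11 (E.cidx h) = 0 ↔
      ∀ t, 0 < M.δ s α t → t ∈ W) :
    WP (Store.Ok B G) attrOne (190 * M.numTrans)
      (fun m' => ∃ P, IsAttr (M.zeroStates a b) (M.safeStep W) Sd P ∧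
        E.Flags m' 12 {s | M.safeStep W P s}) m := by
  classical
  have hn := M.card_le_card_choice
  have hn' := M.card_choice_le_numTrans
  have hpos : 0 < Fintype.card S := Fintype.card_pos
  refine (WP.seq (T := 9 * M.numTrans) (T' := 180 * M.numTrans) hm
    ((fillFlags_spec hG hm hs hB (A := 10) (c := .instr (.const 10 1)) Set.univ ?_).mono le_rfl
      ?_)).mono (by omega) fun _ h => h
  · intro t m' _ _ _
    simp [Prog.Safe, Instr.Safe, Prog.den, Instr.exec]
    omega
  rintro m1 ⟨h10, hm1, ha1, hs1⟩
  set p : AttrData := ⟨fun _ => 1, fun c => m.narr 11 c ≠ 0, fun i => m.narr 14 i = 1⟩ with hp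
  refine (attr_spec (p := p) hG (show Fintype.card S + 1 ≤ B by omega) hm1 hs1 ?_ ?_ ?_).mono
    attr_time ?_
  · intro i hi
    obtain ⟨t, rfl⟩ := E.exists_idx hi
    rw [h10 t]; simp [hp]
  · intro c _
    rw [ha1.narr 11 (by decide)]; simp [hp]
  · intro i _
    rw [ha1.narr 14 (by decide)]
  rintro m2 ⟨P, hP, hmark⟩
  have hMk : ∀ (V : Set ℕ) s, p.Marked (E.inst a b) (fun j => (E.inst a b).tg j ∈ V) (E.idx s) ↔
      M.safeStep W {t | E.idx t ∈ V} s := by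
    intro V s
    rw [hp, E.marked_one_iff]
    simp only [not_not, hW, MDP.safeStep, Set.mem_ofPred_eq, exists_prop]
  have hA := E.isAttr_of_solves hP hMk
  have hSd' : {t | p.Sd (E.idx t)} = Sd := by
    ext t; exact hSd.eq_one_iff t
  rw [hSd'] at hA
  refine ⟨_, hA, fun t => ?_⟩
  rw [hmark _ (E.idx_lt t)]
  simp only [hMk, Set.mem_ofPred_eq]

/-- The attractor where all choices have to be good. -/
def attrAll : Prog := .seq (fill 10 0 (.instr (.load 10 9 5))) attr

theorem attrAll_spec (hG : G 0) (hm : m.Ok B G) (hs : Static (E.inst a b) m)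
    (hB : M.numTrans + 1 ≤ B) [Nonempty S] [Finite Act] {Sd : Set S} (hSd : E.Flags m 14 Sd)
    (h11 : ∀ c < (E.inst a b).nc, m.narr 11 c = 0) :
    WP (Store.Ok B G) attrAll (190 * M.numTrans)
      (fun m' => ∃ P, IsAttr (M.zeroStates a b) (M.pre allPos) Sd P ∧
        E.Flags m' 12 {s | M.pre allPos P s}) m := by
  classical
  have hn := M.card_le_card_choice
  have hn' := M.card_choice_le_numTrans
  have hpos : 0 < Fintype.card S := Fintype.card_pos
  refine (WP.seq (T := Fintype.card S * 6 + 3) (T' := 180 * M.numTrans) hm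
    ((fill_spec hG (A := 10) (c := .instr (.load 10 9 5)) (N := Fintype.card S)
      (f := (E.inst a b).nchBelow (E.inst a b).nc) hm hs.n hs.one (by omega) ?_).mono le_rfl
      ?_)).mono (by omega) fun _ h => h
  · intro k hk m' _ ha h5 _
    simp [Prog.Safe, Instr.Safe, Prog.den, Instr.exec, h5, (hs.of_agree ha).nch k hk]
  rintro m1 ⟨h10, hm1, ha1⟩
  have hs1 := hs.of_agree ha1
  set p : AttrData := ⟨(E.inst a b).nchBelow (E.inst a b).nc, fun c => False,
    fun i => m.narr 14 i = 1⟩ with hp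
  refine (attr_spec (p := p) hG (show Fintype.card S + 1 ≤ B by omega) hm1 hs1 ?_ ?_ ?_).mono
    attr_time ?_
  · intro i hi
    rw [h10]; exact if_pos hi
  · intro c hc
    rw [ha1.narr 11 (by decide), h11 c hc]; simp [hp]
  · intro i _
    rw [ha1.narr 14 (by decide)]
  rintro m2 ⟨P, hP, hmark⟩
  have hMk : ∀ (V : Set ℕ) s, p.Marked (E.inst a b) (fun j => (E.inst a b).tg j ∈ V) (E.idx s) ↔
      M.pre allPos {t | E.idx t ∈ V} s := fun V s => E.marked_all_iff
  have hA := E.isAttr_of_solves hP hMk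
  have hSd' : {t | p.Sd (E.idx t)} = Sd := by
    ext t; exact hSd.eq_one_iff t
  rw [hSd'] at hA
  refine ⟨_, hA, fun t => ?_⟩
  rw [hmark _ (E.idx_lt t)]
  simp only [hMk, Set.mem_ofPred_eq]

theorem cidx_lt {s : S} {α : Act} (h : α ∈ M.enabled s) : E.cidx h < (E.inst a b).nc :=
  (E.choices.symm ⟨(s, α), h⟩).2

/-- `attrOne_spec` if all choices may be used. -/
theorem attrOne_spec_univ (hG : G 0) (hm : m.Ok B G) (hs : Static (E.inst a b) m)
    (hB : M.numTrans + 1 ≤ B) [Nonempty S] [Finite Act] {Sd : Set S} (hSd : E.Flags m 14 Sd)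
    (h11 : ∀ c < (E.inst a b).nc, m.narr 11 c = 0) :
    WP (Store.Ok B G) attrOne (190 * M.numTrans)
      (fun m' => ∃ P, IsAttr (M.zeroStates a b) (M.pre exPos) Sd P ∧
        E.Flags m' 12 {s | M.pre exPos P s}) m := by
  have := attrOne_spec hG hm hs hB hSd (W := Set.univ) fun s α h => by
    simp [h11 _ (cidx_lt h)]
  rwa [MDP.safeStep_univ] at this

/-- Copying an array of flags. -/
def copyFlags (A' A : ℕ) : Prog := fill A' 0 (.instr (.load 10 A 5))

theorem copyFlags_spec (hG : G 0) (hm : m.Ok B G) (hs : Static (E.inst a b) m)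
    (hB : M.numTrans + 1 ≤ B) [Nonempty S] [Finite Act] {A A' : ℕ} {P : Set S}
    (hP : E.Flags m A P) (hA' : 9 < A') (hne : A ≠ A') :
    WP (Store.Ok B G) (copyFlags A' A) (9 * M.numTrans)
      (fun m' => E.Flags m' A' P ∧ m'.Ok B G ∧ Agree (copyFlags A' A).writes m m' ∧
        Static (E.inst a b) m') m := by
  have hw : (fill A' 0 (.instr (.load 10 A 5))).writes = ⟨[5, 10, 5], [A'], [], []⟩ := by
    simp [fill, forLoop, Prog.writes, Instr.writes, Writes.union]
  refine fillFlags_spec hG hm hs hB P ?_ (by simp [Prog.writes, Instr.writes])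
    (by simp [Prog.writes, Instr.writes]) (by simp [Prog.writes, Instr.writes]) rfl
    (by rw [hw]; simp) (by rw [hw]; simp [hA']) (by rw [hw]; simp)
  intro t m' _ ha h5
  refine ⟨trivial, ?_⟩
  simp only [Prog.den, Instr.exec, h5, Function.update_self]
  rw [ha.narr A (by rw [hw]; simp [hne]), hP t]

section

variable [MeasurableSpace S] [DiscreteMeasurableSpace S]

/-- The program `c` computes the states that satisfy `Q X (Z U Y)` within `T` steps, where `Y` is
given by the array `18`, and the result is in the array `17`. -/
def Computes (Q : ProbQuant) (E : M.Listing) (a b : AP) (B : ℕ) (G : ℝ → Prop) (c : Prog)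
    (T : ℕ) : Prop :=
  ∀ (m : Store) (Y : Set S), m.Ok B G → Static (E.inst a b) m → E.Flags m 18 Y →
    Disjoint Y (M.zeroStates a b) →
    WP (Store.Ok B G) c T
      (fun m' => E.Flags m' 17 {s | M.sat Q s (nextUntil (M.zeroStates a b) Y)}) m

def satExPos : Prog := block [clearHit, copyFlags 14 18, attrOne, copyFlags 17 12]

theorem satExPos_computes (hG : G 0) (hB : M.numTrans + 1 ≤ B) [Nonempty S] [Finite Act] :
    Computes exPos E a b B G satExPos (220 * M.numTrans) := by
  intro m Y hm hs hY hYZ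
  have hn := M.card_le_card_choice
  have hn' := M.card_choice_le_numTrans
  have hpos : 0 < Fintype.card S := Fintype.card_pos
  refine (WP.seq (T := 9 * M.numTrans) (T' := 9 * M.numTrans + (190 * M.numTrans +
    9 * M.numTrans + 1) + 1) hm ((clearHit_spec hG hm hs hB).mono le_rfl ?_)).mono (by omega)
    fun _ h => h
  rintro m1 ⟨h11, hm1, ha1, hs1⟩
  refine WP.seq hm1 ((copyFlags_spec hG hm1 hs1 hB (hY.of_agree ha1) (by decide)
    (by decide)).mono le_rfl ?_)
  rintro m2 ⟨h14, hm2, ha2, hs2⟩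
  refine WP.seq hm2 ((attrOne_spec_univ hG hm2 hs2 hB h14
    (by rw [ha2.narr 11 (by decide)]; exact h11)).frame.mono le_rfl ?_)
  rintro m3 ⟨⟨P, hP, h12⟩, hm3, ha3⟩
  simp only [hP.pre_iff (Or.inl rfl)] at h12
  exact (copyFlags_spec hG hm3 (hs2.of_agree ha3) hB h12 (by decide) (by decide)).mono le_rfl
    fun _ h => h.1

def satAllPos : Prog := block [clearHit, copyFlags 14 18, attrAll, copyFlags 17 12]

theorem satAllPos_computes (hG : G 0) (hB : M.numTrans + 1 ≤ B) [Nonempty S] [Finite Act] :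
    Computes allPos E a b B G satAllPos (220 * M.numTrans) := by
  intro m Y hm hs hY hYZ
  have hn := M.card_le_card_choice
  have hn' := M.card_choice_le_numTrans
  have hpos : 0 < Fintype.card S := Fintype.card_pos
  refine (WP.seq (T := 9 * M.numTrans) (T' := 9 * M.numTrans + (190 * M.numTrans +
    9 * M.numTrans + 1) + 1) hm ((clearHit_spec hG hm hs hB).mono le_rfl ?_)).mono (by omega)
    fun _ h => h
  rintro m1 ⟨h11, hm1, ha1, hs1⟩
  refine WP.seq hm1 ((copyFlags_spec hG hm1 hs1 hB (hY.of_agree ha1) (by decide)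
    (by decide)).mono le_rfl ?_)
  rintro m2 ⟨h14, hm2, ha2, hs2⟩
  refine WP.seq hm2 ((attrAll_spec hG hm2 hs2 hB h14
    (by rw [ha2.narr 11 (by decide)]; exact h11)).frame.mono le_rfl ?_)
  rintro m3 ⟨⟨P, hP, h12⟩, hm3, ha3⟩
  simp only [hP.pre_iff (Or.inr rfl)] at h12
  exact (copyFlags_spec hG hm3 (hs2.of_agree ha3) hB h12 (by decide) (by decide)).mono le_rfl
    fun _ h => h.1

/-- The states that are not in `Z`. -/
def seedExit : Prog := fill 14 0 (.seq (.instr (.load 10 6 5)) (.instr (.sub 10 4 10)))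

/-- The states from which the target can be missed with positive probability at once. -/
def seedBad : Prog :=
  fill 14 0 (block [.instr (.load 11 6 5),
    .ite (.eq 11 4) (.instr (.load 10 15 5)) (.instr (.load 10 18 5)), .instr (.sub 10 4 10)])

/-- The complement of the marks. -/
def notMarked : Prog := fill 17 0 (.seq (.instr (.load 10 12 5)) (.instr (.sub 10 4 10)))

/-- The first attractor finds the states of `Z` that every scheduler leaves with positive
probability; its marks are kept in array 15. The second one collects the states from which failure
is possible; its marks are complemented. -/
def satAllOne : Prog :=
  block [clearHit, seedExit, attrAll, copyFlags 15 12, clearHit, seedBad, attrOne, notMarked]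

theorem satAllOne_computes (hG : G 0) (hB : M.numTrans + 1 ≤ B) [Nonempty S] [Finite Act] :
    Computes allOne E a b B G satAllOne (460 * M.numTrans) := by
  classical
  intro m Y hm hs hY hYZ
  have hn := M.card_le_card_choice
  have hn' := M.card_choice_le_numTrans
  have hpos : 0 < Fintype.card S := Fintype.card_pos
  refine (WP.seq (T := 9 * M.numTrans) (T' := 11 * M.numTrans + (190 * M.numTrans +
    (9 * M.numTrans + (9 * M.numTrans + (14 * M.numTrans + (190 * M.numTrans + 11 * M.numTrans + 1)
    + 1) + 1) + 1) + 1) + 1) hm ((clearHit_spec hG hm hs hB).mono le_rfl ?_)).mono (by omega)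
    fun _ h => h
  rintro m1 ⟨h11, hm1, ha1, hs1⟩
  refine WP.seq hm1 ((fillFlags_spec hG hm1 hs1 hB (M.zeroStates a b)ᶜ ?_).mono le_rfl ?_)
  · intro t m' hs' _ h5
    refine ⟨by simp [Prog.Safe, Instr.Safe], ?_⟩
    simp only [Prog.den, Instr.exec, h5, hs'.zf, E.zf_idx]
    by_cases h : t ∈ M.zeroStates a b <;> simp [h, hs'.one]
  rintro m2 ⟨h14, hm2, ha2, hs2⟩
  refine WP.seq hm2 ((attrAll_spec hG hm2 hs2 hB h14
    (by rw [ha2.narr 11 (by decide)]; exact h11)).frame.mono le_rfl ?_)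
  rintro m3 ⟨⟨T, hT, h12⟩, hm3, ha3⟩
  refine WP.seq hm3 ((copyFlags_spec hG hm3 (hs2.of_agree ha3) hB h12 (by decide)
    (by decide)).mono le_rfl ?_)
  rintro m4 ⟨h15, hm4, ha4, hs4⟩
  refine WP.seq hm4 ((clearHit_spec hG hm4 hs4 hB).mono le_rfl ?_)
  rintro m5 ⟨h11', hm5, ha5, hs5⟩
  have hY5 : E.Flags m5 18 Y :=
    ((((hY.of_agree ha1).of_agree ha2).of_agree ha3).of_agree ha4).of_agree ha5
  refine WP.seq hm5 ((fillFlags_spec hG hm5 hs5 hB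
    (((M.zeroStates a b)ᶜ \ Y) ∪ (M.zeroStates a b \ T)) ?_).mono le_rfl ?_)
  · intro t m' hs' ha' h5
    refine ⟨by simp [block, Prog.Safe, Prog.den, Instr.Safe], ?_⟩
    have h18 := hY5.of_agree ha' (by decide) t
    have h15' := (h15.of_agree ha5).of_agree ha' (by decide) t
    have hz : m'.narr 6 (E.idx t) = if t ∈ M.zeroStates a b then 1 else 0 := by
      rw [hs'.zf, E.zf_idx]
    by_cases h : t ∈ M.zeroStates a b
    -- The seeds of `T` lie outside `Z`, so for states of `Z` the marks coincide with membership in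
    -- `T`.
    · have hTt : t ∈ T ↔ M.pre allPos T t := by
        rw [hT.mem_iff t]; simp [h]
      by_cases h' : t ∈ T
      · simp [block, Prog.den, Instr.exec, Test.holds, h5, hz, h, hs'.one, h15', hTt.1 h', h']
      · have : ¬ M.pre allPos T t := fun hh => h' (hTt.2 hh)
        simp [block, Prog.den, Instr.exec, Test.holds, h5, hz, h, hs'.one, h15', this, h']
    · by_cases h' : t ∈ Y <;>
        simp [block, Prog.den, Instr.exec, Test.holds, h5, hz, h, hs'.one, h18, h']
  rintro m6 ⟨h14', hm6, ha6, hs6⟩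
  refine WP.seq hm6 ((attrOne_spec_univ hG hm6 hs6 hB h14'
    (by rw [ha6.narr 11 (by decide)]; exact h11')).frame.mono le_rfl ?_)
  rintro m7 ⟨⟨P, hP, h12'⟩, hm7, ha7⟩
  refine (fillFlags_spec hG hm7 (hs6.of_agree ha7) hB _ ?_).mono le_rfl fun _ h => h.1
  intro t m' hs' ha' h5
  refine ⟨by simp [Prog.Safe, Instr.Safe], ?_⟩
  have hD : M.sat allOne t (nextUntil (M.zeroStates a b) Y) ↔ ¬ M.pre exPos P t := by
    rw [not_pre_exPos_iff, sat_nextUntil_iff (by simp [ProbQuant.Basic]),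
      IsAttr.compl_eq_sat_allOne hYZ hT hP]
  have h12'' := h12'.of_agree ha' (by decide) t
  simp only [Prog.den, Instr.exec, h5, Set.mem_ofPred_eq, hD]
  by_cases h : M.pre exPos P t <;> simp [h, hs'.one, h12'']

end

end Subroutines

/-! ### The program for almost sure success under some scheduler. -/

section AlmostSure

variable {S : Type u} {Act : Type v} {AP : Type w} [Fintype S] {M : MDP S Act AP}
  {E : M.Listing} {a b : AP} {B : ℕ} {G : ℝ → Prop} {m : Store}

def hitBody : Prog :=
  block [.instr (.load 10 4 5), .instr (.load 11 18 10), .ite (.eq 11 4) .skip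
    (block [.instr (.load 11 16 10), .ite (.eq 11 4) .skip
      (block [.instr (.load 10 3 5), .instr (.store 11 10 4)])])]

/-- Marking the choices that have a successor outside of the sets given by the arrays `18` and
`16`. -/
def hitLoop : Prog := forLoop 5 2 hitBody

theorem hitLoop_spec (hG : G 0) (hm : m.Ok B G) (hs : Static (E.inst a b) m)
    (hB : M.numTrans + 1 ≤ B) [Nonempty S] [Finite Act] {Y U : Set S} (hY : E.Flags m 18 Y)
    (hU : E.Flags m 16 U) (h11 : ∀ c < (E.inst a b).nc, m.narr 11 c = 0) :
    WP (Store.Ok B G) hitLoop (25 * M.numTrans)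
      (fun m' => (∀ s α (h : α ∈ M.enabled s), m'.narr 11 (E.cidx h) = 0 ↔
        ∀ t, 0 < M.δ s α t → t ∈ Y ∪ U) ∧ m'.Ok B G ∧ Agree hitLoop.writes m m') m := by
  have hn := M.card_le_card_choice
  have hn' := M.card_choice_le_numTrans
  have hpos : 0 < Fintype.card S := Fintype.card_pos
  have hcost : hitBody.cost ≤ 19 := by decide
  refine (WP.forLoop hG (T := hitBody.cost) (N := M.numTrans)
    (Inv := fun k m' => ∀ c < (E.inst a b).nc, m'.narr 11 c = 0 ↔ ∀ j < k, (E.inst a b).ch j = c →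
      m.narr 18 ((E.inst a b).tg j) = 1 ∨ m.narr 16 ((E.inst a b).tg j) = 1)
    hm hs.mm hs.one hB (hreg := fun _ _ _ h => h)
    (h0 := fun c hc => by simp [h11 c hc]) (hstep := ?_)).mono ?_ ?_
  · intro k hk m' hm' ha h5 hInv
    have hs' := hs.of_agree ha
    have h18 : m'.narr 18 = m.narr 18 := ha.narr 18 (by decide)
    have h16 : m'.narr 16 = m.narr 16 := ha.narr 16 (by decide)
    refine WP.of_safe hG hm' ?_ ?_
    · simp [hitBody, block, Prog.Safe, Instr.Safe]
    · have hstep : ∀ f : ℕ → ℕ, (∀ c < (E.inst a b).nc, f c = 0 ↔ m'.narr 11 c = 0 ∧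
          ((E.inst a b).ch k = c → m.narr 18 ((E.inst a b).tg k) = 1 ∨
            m.narr 16 ((E.inst a b).tg k) = 1)) →
          ∀ c < (E.inst a b).nc, f c = 0 ↔ ∀ j < k + 1, (E.inst a b).ch j = c →
            m.narr 18 ((E.inst a b).tg j) = 1 ∨ m.narr 16 ((E.inst a b).tg j) = 1 := by
        intro f hf c hc
        rw [hf c hc, hInv c hc]
        constructor
        · rintro ⟨h1, h2⟩ j hj
          rcases Nat.lt_succ_iff_lt_or_eq.1 hj with h | rfl
          · exact h1 j h
          · exact h2
        · exact fun h => ⟨fun j hj => h j (by omega), h k (by omega)⟩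
      refine hstep _ fun c hc => ?_
      by_cases h1 : m.narr 18 ((E.inst a b).tg k) = 1
      · simp [hitBody, block, Prog.den, Instr.exec, Test.holds, h5, hs'.one, hs'.tg, h18, h1]
      by_cases h2 : m.narr 16 ((E.inst a b).tg k) = 1
      · simp [hitBody, block, Prog.den, Instr.exec, Test.holds, h5, hs'.one, hs'.tg, h18, h1, h16,
          h2]
      · by_cases hck : (E.inst a b).ch k = c
        · simp [hitBody, block, Prog.den, Instr.exec, Test.holds, h5, hs'.one, hs'.tg, hs'.ch, h18,
            h1, h16, h2, setArr_apply, hck]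
        · simp [hitBody, block, Prog.den, Instr.exec, Test.holds, h5, hs'.one, hs'.tg, hs'.ch, h18,
            h1, h16, h2, setArr_apply, hck, Function.update_of_ne (Ne.symm hck)]
  · have : M.numTrans * (hitBody.cost + 3) ≤ M.numTrans * 22 := Nat.mul_le_mul_left _ (by omega)
    omega
  · rintro m' ⟨h, hm', ha⟩
    refine ⟨fun s α hα => ?_, hm', ha⟩
    rw [h _ (cidx_lt hα), ← not_iff_not]
    push Not
    refine (E.exists_trans_iff hα (a := a) (b := b)
      (Ψ := fun i => m.narr 18 i ≠ 1 ∧ m.narr 16 i ≠ 1)).trans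
      (exists_congr fun t => and_congr_right fun _ => ?_)
    rw [Ne, Ne, hY.eq_one_iff, hU.eq_one_iff, Set.mem_union, not_or]

/-- Restricting the array `16` of candidates to the states of `Z` that have been marked. -/
def restrict : Prog :=
  fill 16 0 (block [.instr (.load 11 6 5),
    .ite (.eq 11 4) (.instr (.load 10 12 5)) (.instr (.const 10 0))])

def exOneBody : Prog := block [clearHit, hitLoop, copyFlags 14 18, attrOne, restrict]

theorem exOneBody_spec (hG : G 0) (hm : m.Ok B G) (hs : Static (E.inst a b) m)
    (hB : M.numTrans + 1 ≤ B) [Nonempty S] [Finite Act] {Y U : Set S} (hY : E.Flags m 18 Y)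
    (hU : E.Flags m 16 U) (hYZ : Disjoint Y (M.zeroStates a b)) :
    WP (Store.Ok B G) exOneBody (250 * M.numTrans)
      (fun m' => E.Flags m' 16 (M.zeroStates a b ∩ M.safeAttr (M.zeroStates a b) Y U) ∧
        ∃ P, IsAttr (M.zeroStates a b) (M.safeStep (Y ∪ U)) Y P ∧
          E.Flags m' 12 {s | M.safeStep (Y ∪ U) P s}) m := by
  classical
  have hn := M.card_le_card_choice
  have hn' := M.card_choice_le_numTrans
  have hpos : 0 < Fintype.card S := Fintype.card_pos
  refine (WP.seq (T := 9 * M.numTrans) (T' := 25 * M.numTrans + (9 * M.numTrans +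
    (190 * M.numTrans + 12 * M.numTrans + 1) + 1) + 1) hm
    ((clearHit_spec hG hm hs hB).mono le_rfl ?_)).mono (by omega) fun _ h => h
  rintro m1 ⟨h11, hm1, ha1, hs1⟩
  refine WP.seq hm1 ((hitLoop_spec hG hm1 hs1 hB (hY.of_agree ha1) (hU.of_agree ha1)
    h11).mono le_rfl ?_)
  rintro m2 ⟨hhit, hm2, ha2⟩
  refine WP.seq hm2 ((copyFlags_spec hG hm2 (hs1.of_agree ha2) hB
    ((hY.of_agree ha1).of_agree ha2) (by decide) (by decide)).mono le_rfl ?_)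
  rintro m3 ⟨h14, hm3, ha3, hs3⟩
  refine WP.seq hm3 ((attrOne_spec hG hm3 hs3 hB h14 (W := Y ∪ U)
    (by rw [ha3.narr 11 (by decide)]; exact hhit)).frame.mono le_rfl ?_)
  rintro m4 ⟨⟨P, hP, h12⟩, hm4, ha4⟩
  refine (fillFlags_spec hG hm4 (hs3.of_agree ha4) hB _ ?_).mono le_rfl
    fun m' h => ⟨h.1, P, hP, h12.of_agree h.2.2.1⟩
  intro t m' hs' ha' h5
  refine ⟨by simp [block, Prog.Safe, Instr.Safe], ?_⟩
  have h12' := h12.of_agree ha' (by decide) t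
  have hz : m'.narr 6 (E.idx t) = if t ∈ M.zeroStates a b then 1 else 0 := by
    rw [hs'.zf, E.zf_idx]
  rw [← hP.eq_safeAttr]
  by_cases h : t ∈ M.zeroStates a b
  · have hTt : t ∈ P ↔ M.safeStep (Y ∪ U) P t := by
      have hnY : t ∉ Y := fun h' => Set.disjoint_left.1 hYZ h' h
      rw [hP.mem_iff t]
      simp [h, hnY]
    simp [block, Prog.den, Instr.exec, Test.holds, h5, hz, h, hs'.one, h12', hTt]
  · simp [block, Prog.den, Instr.exec, Test.holds, h5, hz, h, hs'.one]

variable [MeasurableSpace S] [DiscreteMeasurableSpace S]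

/-- One refinement per state makes the candidates stable, starting from `Z`, whose flags are in
array 6. One more pass computes the marks for the stable set. -/
def satExOne : Prog :=
  block [copyFlags 16 6, forLoop 6 0 exOneBody, exOneBody, copyFlags 17 12]

theorem satExOne_computes (hG : G 0) (hB : M.numTrans + 1 ≤ B) [Nonempty S] [Finite Act] :
    Computes exOne E a b B G satExOne (600 * (Fintype.card S * M.numTrans)) := by
  intro m Y hm hs hY hYZ
  have hn := M.card_le_card_choice
  have hn' := M.card_choice_le_numTrans
  have hpos : 0 < Fintype.card S := Fintype.card_pos
  refine (WP.seq (T := 9 * M.numTrans) (T' := (Fintype.card S * (250 * M.numTrans + 3) + 3) +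
    (250 * M.numTrans + 9 * M.numTrans + 1) + 1) hm ((copyFlags_spec (A := 6) (A' := 16)
    (P := M.zeroStates a b) hG hm hs hB ?_ (by decide) (by decide)).mono le_rfl ?_)).mono ?_
    fun _ h => h
  · intro t
    rw [hs.zf, E.zf_idx]
  · rintro m1 ⟨h16, hm1, ha1, hs1⟩
    refine WP.seq hm1 ((WP.forLoop hG (T := 250 * M.numTrans) (N := Fintype.card S)
      (Inv := fun k m' => E.Flags m' 16 (M.candidates (M.zeroStates a b) Y k))
      hm1 hs1.n hs1.one (by omega) (hreg := fun _ _ _ h => h)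
      (h0 := h16) (hstep := ?_)).mono le_rfl ?_)
    · intro k _ m' hm' ha' _ hU
      exact (exOneBody_spec hG hm' (hs1.of_agree ha') hB ((hY.of_agree ha1).of_agree ha')
        hU hYZ).mono le_rfl fun _ h => h.1
    rintro m2 ⟨hU, hm2, ha2⟩
    have hs2 := hs1.of_agree ha2
    refine WP.seq hm2 ((exOneBody_spec hG hm2 hs2 hB ((hY.of_agree ha1).of_agree ha2)
        hU hYZ).frame.mono le_rfl ?_)
    rintro m3 ⟨⟨-, P, hP, h12⟩, hm3, ha3⟩
    simp only [MDP.sat_exOne_iff_candidates hP] at h12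
    exact (copyFlags_spec hG hm3 (hs2.of_agree ha3) hB h12 (by decide) (by decide)).mono le_rfl
      fun _ h => h.1
  · have e1 : Fintype.card S * (250 * M.numTrans + 3) =
      250 * (Fintype.card S * M.numTrans) + 3 * Fintype.card S := by ring
    have e2 : M.numTrans ≤ Fintype.card S * M.numTrans := Nat.le_mul_of_pos_left _ hpos
    omega

end AlmostSure

/-! ### Programs for one round of the greedy algorithm. -/

section RoundPrograms

variable {g : Inst} {B : ℕ} {G : ℝ → Prop} {m : Store}

/-- The flag of the states with a finite value, at most the current one, that are not in `Z`. -/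
def targetFlag : Prog :=
  block [.instr (.const 10 0), .instr (.load 11 5 5), .ite (.eq 11 3)
    (block [.instr (.load 11 6 5), .ite (.eq 11 3)
      (block [.instr (.rload 1 2 5), .ite (.rle 1 0) (.instr (.const 10 1)) .skip]) .skip]) .skip]

open Classical in
theorem targetFlag_den (hs : Static g m) :
    (targetFlag.den m).nreg 10 = if m.narr 5 (m.nreg 5) = 0 ∧ g.zf (m.nreg 5) = 0 ∧
      m.rarr 2 (m.nreg 5) ≤ m.rreg 0 then 1 else 0 := by
  by_cases h1 : m.narr 5 (m.nreg 5) = 0 <;> by_cases h2 : g.zf (m.nreg 5) = 0 <;>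
    by_cases h3 : m.rarr 2 (m.nreg 5) ≤ m.rreg 0 <;>
    simp [targetFlag, block, Prog.den, Instr.exec, Test.holds, h1, h2, h3, hs.zero, hs.zf]

def updateBody : Prog :=
  block [.instr (.load 10 5 5), .ite (.eq 10 4)
    (block [.instr (.load 10 0 5), .ite (.eq 10 4)
      (block [.instr (.load 10 17 5), .ite (.eq 10 4)
        (block [.instr (.store 5 5 3), .instr (.rload 1 0 5), .instr (.radd 1 0 1),
          .instr (.rstore 2 5 1)]) .skip]) .skip]) .skip]

/-- Setting the values of the states that are discovered. -/
def update : Prog := forLoop 5 0 updateBody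

open Classical in
theorem update_spec (hG : G 0) (hm : m.Ok B G) (hs : Static g m) (hB : g.n + 1 ≤ B)
    (hadd : ∀ i < g.n, G (m.rreg 0 + g.rew i)) :
    WP (Store.Ok B G) update (30 * g.n + 3)
      (fun m' => (∀ i < g.n, m'.narr 5 i = (if m.narr 5 i = 1 ∧ g.la i = 1 ∧ m.narr 17 i = 1
          then 0 else m.narr 5 i) ∧
        m'.rarr 2 i = if m.narr 5 i = 1 ∧ g.la i = 1 ∧ m.narr 17 i = 1
          then m.rreg 0 + g.rew i else m.rarr 2 i) ∧ m'.Ok B G ∧ Agree update.writes m m') m := by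
  set C : ℕ → Prop := fun i => m.narr 5 i = 1 ∧ g.la i = 1 ∧ m.narr 17 i = 1 with hC
  have hcost : updateBody.cost ≤ 27 := by decide
  refine (WP.forLoop hG (T := updateBody.cost) (N := g.n)
    (Inv := fun k m' => (m'.narr 5 = fun i => if i < k ∧ C i then 0 else m.narr 5 i) ∧
      m'.rarr 2 = fun i => if i < k ∧ C i then m.rreg 0 + g.rew i else m.rarr 2 i)
    hm hs.n hs.one hB (hreg := fun _ _ _ h => h) (h0 := by simp) (hstep := ?_)).mono ?_ ?_
  · intro k hk m' hm' ha h5 hInv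
    have hs' := hs.of_agree ha
    have h17 : m'.narr 17 = m.narr 17 := ha.narr 17 (by decide)
    have hr : m'.rreg 0 = m.rreg 0 := ha.rreg 0 (by decide)
    have hk5 : m'.narr 5 k = m.narr 5 k := by rw [hInv.1]; simp
    have hlt : ∀ i, i < k + 1 ↔ i < k ∨ i = k := fun i => Nat.lt_succ_iff_lt_or_eq
    by_cases hc : C k
    · obtain ⟨c1, c2, c3⟩ := hc
      have hd : (updateBody.den m').narr = setArr m'.narr 5 k 0 ∧
          (updateBody.den m').rarr = setArr m'.rarr 2 k (m.rreg 0 + g.rew k) := by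
        simp [updateBody, block, Prog.den, Instr.exec, Test.holds, h5, hk5, hs'.one, hs'.zero,
          hs'.la, h17, c1, c2, c3, hr, hs'.rew]
      refine WP.of_safe hG hm' ?_ ?_
      · simp [updateBody, block, Prog.Safe, Prog.den, Instr.Safe, Instr.exec, Test.holds, h5,
          hs'.rew, hr, hadd k hk]
      · rw [hd.1, hd.2]
        simp only [setArr_apply, if_true, hInv.1, hInv.2]
        constructor
        · funext i
          by_cases hi : i = k
          · subst hi; simp [hC, c1, c2, c3]
          · simp [hlt, hi]
        · funext i
          by_cases hi : i = k
          · subst hi; simp [hC, c1, c2, c3]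
          · simp [hlt, hi]
    · have hd : (updateBody.den m').narr = m'.narr ∧ (updateBody.den m').rarr = m'.rarr := by
        by_cases c1 : m.narr 5 k = 1 <;> by_cases c2 : g.la k = 1
        · have c3 : m.narr 17 k ≠ 1 := fun c3 => hc ⟨c1, c2, c3⟩
          simp [updateBody, block, Prog.den, Instr.exec, Test.holds, h5, hk5, hs'.one,
            hs'.la, h17, c1, c2, c3]
        all_goals
          simp [updateBody, block, Prog.den, Instr.exec, Test.holds, h5, hk5, hs'.one,
            hs'.la, c1, c2]
      refine WP.of_safe hG hm' ?_ ?_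
      · simp [updateBody, block, Prog.Safe, Prog.den, Instr.Safe, Instr.exec, Test.holds, h5,
          hs'.rew, hr, hadd k hk]
      · rw [hd.1, hd.2, hInv.1, hInv.2]
        constructor <;>
        · funext i
          by_cases hi : i = k
          · subst hi; simp [hc]
          · simp [hlt, hi]
  · have : g.n * (updateBody.cost + 3) ≤ g.n * 30 := Nat.mul_le_mul_left _ (by omega)
    omega
  · rintro m' ⟨⟨h1, h2⟩, h3⟩
    refine ⟨fun i hi => ?_, h3⟩
    rw [h1, h2]
    simp only [hi, true_and]
    exact ⟨rfl, rfl⟩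

def findBody : Prog :=
  block [.instr (.load 10 5 5), .ite (.eq 10 3)
    (block [.instr (.rload 1 2 5), .ite (.rle 1 0) .skip
      (.ite (.eq 15 3) (block [.instr (.rcopy 2 1), .instr (.const 15 1)])
        (.ite (.rle 2 1) .skip (.instr (.rcopy 2 1))))]) .skip]

/-- Search for the least finite value above the current one. -/
def find : Prog := .seq (.instr (.const 15 0)) (forLoop 5 0 findBody)

/-- The result of the search among the first `k` states. -/
def Found (m m' : Store) (k : ℕ) : Prop :=
  (m'.nreg 15 = 0 ∧ ∀ i < k, m.narr 5 i = 0 → m.rarr 2 i ≤ m.rreg 0) ∨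
    (m'.nreg 15 = 1 ∧ (∃ i < k, m.narr 5 i = 0 ∧ m.rreg 0 < m.rarr 2 i ∧
      m'.rreg 2 = m.rarr 2 i) ∧
      ∀ i < k, m.narr 5 i = 0 → m.rreg 0 < m.rarr 2 i → m'.rreg 2 ≤ m.rarr 2 i)

theorem Found.skip {m m' m'' : Store} {k : ℕ} (h : Found m m' k) (h15 : m''.nreg 15 = m'.nreg 15)
    (h2 : m''.rreg 2 = m'.rreg 2)
    (hk : m.narr 5 k = 0 → m.rreg 0 < m.rarr 2 k → m'.nreg 15 = 1 ∧ m'.rreg 2 ≤ m.rarr 2 k) :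
    Found m m'' (k + 1) := by
  rcases h with ⟨h, h'⟩ | ⟨h, ⟨i, hi, h1⟩, h'⟩
  · refine Or.inl ⟨h15.trans h, fun i hi ht => ?_⟩
    rcases Nat.lt_succ_iff_lt_or_eq.1 hi with hlt | rfl
    · exact h' i hlt ht
    · by_contra hlt
      have := (hk ht (not_le.1 hlt)).1
      omega
  · refine Or.inr ⟨h15.trans h, ⟨i, by omega, by rwa [h2]⟩, fun i hi ht hlt => ?_⟩
    rw [h2]
    rcases Nat.lt_succ_iff_lt_or_eq.1 hi with hi' | rfl
    · exact h' i hi' ht hlt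
    · exact (hk ht hlt).2

theorem Found.take {m m' m'' : Store} {k : ℕ} (h : Found m m' k) (h15 : m''.nreg 15 = 1)
    (h2 : m''.rreg 2 = m.rarr 2 k) (ht : m.narr 5 k = 0) (hlt : m.rreg 0 < m.rarr 2 k)
    (hle : m'.nreg 15 = 1 → m.rarr 2 k ≤ m'.rreg 2) : Found m m'' (k + 1) := by
  refine Or.inr ⟨h15, ⟨k, by omega, ht, hlt, h2⟩, fun i hi ht' hlt' => ?_⟩
  rw [h2]
  rcases Nat.lt_succ_iff_lt_or_eq.1 hi with hi' | rfl
  · rcases h with ⟨h, h'⟩ | ⟨h, -, h'⟩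
    · exact absurd (h' i hi' ht') (not_le.2 hlt')
    · exact (hle h).trans (h' i hi' ht' hlt')
  · exact le_rfl

theorem find_spec (hG : G 0) (hm : m.Ok B G) (hs : Static g m) (hB : g.n + 1 ≤ B) :
    WP (Store.Ok B G) find (25 * g.n + 5) (fun m' => Found m m' g.n) m := by
  have hcost : findBody.cost ≤ 22 := by decide
  have e1 := hm.exec hG (i := .const 15 0) (Nat.zero_le _)
  have hs1 := hs.of_agree (Instr.agree_exec (.const 15 0) m)
  have h15 : ((Instr.const 15 0).exec m).nreg 15 = 0 := by simp [Instr.exec]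
  have hA : ((Instr.const 15 0).exec m).narr = m.narr := rfl
  have hR : ((Instr.const 15 0).exec m).rarr = m.rarr := rfl
  have hr : ((Instr.const 15 0).exec m).rreg = m.rreg := rfl
  refine (WP.seq (T := 1) (T' := g.n * (findBody.cost + 3) + 3) hm (WP.instr hm e1 ?_)).mono ?_
    fun _ h => h
  swap
  · have : g.n * (findBody.cost + 3) ≤ g.n * 25 := Nat.mul_le_mul_left _ (by omega)
    omega
  set m1 := (Instr.const 15 0).exec m
  clear_value m1
  refine (WP.forLoop hG (T := findBody.cost) (N := g.n) (Inv := fun k m' => Found m m' k)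
    e1 hs1.n hs1.one hB (hreg := ?_) (h0 := Or.inl ⟨h15, by simp⟩) (hstep := ?_)).mono le_rfl
    fun _ h => h.1
  · intro k m' x h
    simpa [Found] using h
  · intro k hk m' hm' ha h5 hInv
    have hs' := hs1.of_agree ha
    have h5' : m'.narr 5 = m.narr 5 := (ha.narr 5 (by decide)).trans (by rw [hA])
    have hr0 : m'.rreg 0 = m.rreg 0 := (ha.rreg 0 (by decide)).trans (by rw [hr])
    have hr2 : m'.rarr 2 = m.rarr 2 := (ha.rarr 2 (by decide)).trans (by rw [hR])
    refine WP.of_safe hG hm' ?_ ?_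
    · simp [findBody, block, Prog.Safe, Instr.Safe]
      omega
    by_cases ht : m.narr 5 k = 0
    swap
    · exact hInv.skip (by simp [findBody, block, Prog.den, Instr.exec, Test.holds, h5, h5', ht,
        hs'.zero]) (by simp [findBody, block, Prog.den, Instr.exec, Test.holds, h5, h5', ht,
        hs'.zero]) fun h => absurd h ht
    by_cases hle : m.rarr 2 k ≤ m.rreg 0
    · exact hInv.skip (by simp [findBody, block, Prog.den, Instr.exec, Test.holds, h5, h5', ht,
        hs'.zero, hr0, hr2, hle]) (by simp [findBody, block, Prog.den, Instr.exec, Test.holds, h5,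
        h5', ht, hs'.zero, hr0, hr2, hle]) fun _ h => absurd hle (not_le.2 h)
    by_cases h0 : m'.nreg 15 = 0
    · exact hInv.take (by simp [findBody, block, Prog.den, Instr.exec, Test.holds, h5, h5', ht,
        hs'.zero, hr0, hr2, hle, h0]) (by simp [findBody, block, Prog.den, Instr.exec, Test.holds,
        h5, h5', ht, hs'.zero, hr0, hr2, hle, h0]) ht (not_le.1 hle) (by omega)
    have h1 : m'.nreg 15 = 1 := by
      rcases hInv with h | h
      · exact absurd h.1 h0
      · exact h.1
    by_cases hc : m'.rreg 2 ≤ m.rarr 2 k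
    · exact hInv.skip (by simp [findBody, block, Prog.den, Instr.exec, Test.holds, h5, h5', ht,
        hs'.zero, hr0, hr2, hle, h1, hc]) (by simp [findBody, block, Prog.den, Instr.exec,
        Test.holds, h5, h5', ht, hs'.zero, hr0, hr2, hle, h1, hc]) fun _ _ => ⟨h1, hc⟩
    · exact hInv.take (by simp [findBody, block, Prog.den, Instr.exec, Test.holds, h5, h5', ht,
        hs'.zero, hr0, hr2, hle, h1, hc]) (by simp [findBody, block, Prog.den, Instr.exec,
        Test.holds, h5, h5', ht, hs'.zero, hr0, hr2, hle, h1, hc]) ht (not_le.1 hle)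
        fun _ => (not_le.1 hc).le

end RoundPrograms

/-! ### The main loop simulates the greedy algorithm. -/

section MainLoop

variable {S : Type u} {Act : Type v} {AP : Type w} [Fintype S] {M : MDP S Act AP}

/-- The sums of rewards in which every state occurs at most `k` times. -/
def MDP.rewSums (M : MDP S Act AP) (k : ℕ) : Set ℝ :=
  {x | ∃ c : S → ℕ, (∀ s, c s ≤ k) ∧ x = ∑ s, (c s : ℝ) * M.rew s}

theorem MDP.zero_mem_rewSums (k : ℕ) : 0 ∈ M.rewSums k := ⟨fun _ => 0, by simp, by simp⟩

theorem MDP.rewSums_mono {k l : ℕ} (h : k ≤ l) : M.rewSums k ⊆ M.rewSums l :=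
  fun _ ⟨c, hc, hx⟩ => ⟨c, fun s => (hc s).trans h, hx⟩

/-- A round adds one reward to the current value, so after `k` rounds every reward has been used at
most `k` times. -/
theorem MDP.add_rew_mem_rewSums {k : ℕ} {x : ℝ} (h : x ∈ M.rewSums k) (s : S) :
    x + M.rew s ∈ M.rewSums (k + 1) := by
  classical
  obtain ⟨c, hc, rfl⟩ := h
  refine ⟨fun t => c t + if t = s then 1 else 0, fun t => ?_, ?_⟩
  · have := hc t
    dsimp only
    split_ifs <;> omega
  · simp only [Nat.cast_add, add_mul, Finset.sum_add_distrib, Nat.cast_ite, Nat.cast_one,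
      Nat.cast_zero, ite_mul, one_mul, zero_mul, Finset.sum_ite_eq', Finset.mem_univ, if_true]

variable [MeasurableSpace S] [DiscreteMeasurableSpace S] {Q : ProbQuant} {E : M.Listing}
  {a b : AP} {B : ℕ} {G : ℝ → Prop} {m : Store}

/-- The values waiting in `R` are the attained values above the processed one. The machine therefore
does not store `R`, but finds its minimum by scanning the states. -/
theorem mem_greedyIter_R_succ (hQ : Q.Basic) {k : ℕ} (hR : (M.greedyIter Q a b k).R.Nonempty)
    {x : ℝ} : x ∈ (M.greedyIter Q a b (k + 1)).R ↔
      (∃ s ∈ (M.greedyIter Q a b (k + 1)).X, (M.greedyIter Q a b (k + 1)).v s = x) ∧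
        (M.greedyIter Q a b k).R.min' hR < x := by
  obtain ⟨r, H, -⟩ := greedyIter_inv (M := M) (a := a) (b := b) hQ k
  have H' := H.round hQ hR
  rw [← MDP.greedyIter_succ] at H'
  refine ⟨fun hx => ⟨?_, H'.lt_of_mem_R x hx⟩, fun ⟨⟨s, hs, hv⟩, hlt⟩ => H'.mem_R s hs x hv hlt⟩
  rcases H'.R_sub with ⟨hX, hsub⟩ | h
  · have hlt := H'.lt_of_mem_R x hx
    have hx0 : x = 0 := Finset.mem_singleton.1 (hsub hx)
    have hX' : (M.greedyIter Q a b k).X = ∅ := by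
      have := greedyRound_X_subset (M := M) (Q := Q) (a := a) (b := b) (M.greedyIter Q a b k)
      rw [← MDP.greedyIter_succ, hX] at this
      exact Set.subset_empty_iff.1 this
    have hmin := (M.greedyIter Q a b k).R.min'_mem hR
    rcases H.R_sub with ⟨-, hs⟩ | h
    · have := Finset.mem_singleton.1 (hs hmin)
      rw [this, hx0] at hlt
      exact absurd hlt (lt_irrefl _)
    · obtain ⟨s, hs, -⟩ := h _ hmin
      rw [hX'] at hs
      exact hs.elim
  · exact h x hx

open Classical in
/-- The memory holds the state of the greedy algorithm after `k` rounds. -/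
structure Represents (Q : ProbQuant) (E : M.Listing) (a b : AP) (k : ℕ) (m : Store) : Prop where
  static : Static (E.inst a b) m
  tag : ∀ t, m.narr 5 (E.idx t) = if t ∈ (M.greedyIter Q a b k).X then 0 else 1
  v : ∀ t ∈ (M.greedyIter Q a b k).X, (M.greedyIter Q a b k).v t = (m.rarr 2 (E.idx t) : EReal)
  sums : ∀ t ∈ (M.greedyIter Q a b k).X, m.rarr 2 (E.idx t) ∈ M.rewSums k
  go : m.nreg 15 = if (M.greedyIter Q a b k).R.Nonempty then 1 else 0
  r_eq : ∀ h : (M.greedyIter Q a b k).R.Nonempty, m.rreg 0 = (M.greedyIter Q a b k).R.min' h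
  r_mem : (M.greedyIter Q a b k).R.Nonempty → m.rreg 0 ∈ M.rewSums k

/-- The program changes only registers and arrays for intermediate results. -/
def Prog.Tame (c : Prog) : Prop :=
  (∀ x ∈ c.writes.nreg, 4 < x ∧ x ≠ 15) ∧ (∀ A ∈ c.writes.narr, 9 < A) ∧ c.writes.rreg = [] ∧
    c.writes.rarr = []

/-- One round of the greedy algorithm, where `c` computes the states that are discovered. -/
def roundProg (c : Prog) : Prog :=
  block [fill 18 0 targetFlag, c, update, find, .instr (.rcopy 0 2)]

/-- The program imitates the round, except that `R` is recovered from the values by `find`. `Tame`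
ensures that `c` leaves the representation intact. -/
theorem Represents.round (hQ : Q.Basic) [Nonempty S] [Finite Act] {c : Prog} {T k : ℕ}
    (hG : ∀ k ≤ Fintype.card S, ∀ x ∈ M.rewSums k, G x) (hB : M.numTrans + 1 ≤ B)
    (hc : Computes Q E a b B G c T) (htame : c.Tame) (hm : m.Ok B G)
    (h : Represents Q E a b k m) (hR : (M.greedyIter Q a b k).R.Nonempty) :
    WP (Store.Ok B G) (roundProg c) (T + 100 * M.numTrans) (Represents Q E a b (k + 1)) m := by
  classical
  have hn := M.card_le_card_choice
  have hn' := M.card_choice_le_numTrans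
  have hpos : 0 < Fintype.card S := Fintype.card_pos
  have hG0 : G 0 := hG 0 (Nat.zero_le _) 0 (M.zero_mem_rewSums 0)
  have hk : k < Fintype.card S := lt_card_of_greedyIter_nonempty hQ hR
  set r := (M.greedyIter Q a b k).R.min' hR with hr
  set X := (M.greedyIter Q a b k).X with hX
  set Y : Set S := {t | t ∈ X ∧ (M.greedyIter Q a b k).v t ≤ (r : EReal)} \ M.zeroStates a b
    with hYdef
  have htagX : ∀ t, m.narr 5 (E.idx t) = 0 ↔ t ∈ X := fun t => by
    rw [h.tag t]; split_ifs with h' <;> simp [X, h']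
  have hcost : targetFlag.cost + 8 ≤ 25 := by decide
  refine (WP.seq (T := 25 * M.numTrans) (T' := T + (30 * Fintype.card S + 3 +
    (25 * Fintype.card S + 5 + 1 + 1) + 1) + 1) hm
    ((fillFlags_spec hG0 hm h.static hB Y ?_).mono (Nat.mul_le_mul_right _ hcost) ?_)).mono
    (by omega) fun _ h => h
  · intro t m' hs' ha' h5
    refine ⟨by simp [targetFlag, block, Prog.Safe, Instr.Safe]; omega, ?_⟩
    rw [targetFlag_den hs', h5, ha'.narr 5 (by decide), ha'.rarr 2 (by decide),
      ha'.rreg 0 (by decide), E.zf_idx, h.r_eq hR]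
    have key : (m.narr 5 (E.idx t) = 0 ∧ (if t ∈ M.zeroStates a b then 1 else 0) = 0 ∧
        m.rarr 2 (E.idx t) ≤ r) ↔ t ∈ Y := by
      rw [htagX, hYdef, Set.mem_sdiff, Set.mem_ofPred_eq]
      by_cases ht : t ∈ X
      · rw [h.v t ht, EReal.coe_le_coe_iff]
        by_cases hz : t ∈ M.zeroStates a b <;> simp [ht, hz]
      · simp [ht]
    by_cases hy : t ∈ Y
    · rw [if_pos (key.2 hy), if_pos hy]
    · rw [if_neg fun h' => hy (key.1 h'), if_neg hy]
  rintro m1 ⟨h18, hm1, ha1, hs1⟩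
  refine WP.seq hm1 ((hc m1 Y hm1 hs1 h18 Set.disjoint_sdiff_left).frame.mono le_rfl ?_)
  rintro m2 ⟨h17, hm2, ha2⟩
  have hs2 : Static (E.inst a b) m2 := hs1.of_agree ha2 (fun x hx => (htame.1 x hx).1)
    (fun A hA => Or.inr (htame.2.1 A hA)) (by simp [htame.2.2.2])
  have h5 : m2.narr 5 = m.narr 5 := by
    rw [ha2.narr 5 fun h' => by have := htame.2.1 5 h'; omega, ha1.narr 5 (by decide)]
  have hr2 : m2.rarr 2 = m.rarr 2 := by
    rw [ha2.rarr 2 (by simp [htame.2.2.2]), ha1.rarr 2 (by decide)]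
  have hr0 : m2.rreg 0 = r := by
    rw [ha2.rreg 0 (by simp [htame.2.2.1]), ha1.rreg 0 (by decide), h.r_eq hR]
  have hrm : r ∈ M.rewSums k := by
    have := h.r_mem hR
    rwa [h.r_eq hR] at this
  refine WP.seq hm2 ((update_spec hG0 hm2 hs2 (show Fintype.card S + 1 ≤ B by omega) ?_).mono
    le_rfl ?_)
  · intro i hi
    obtain ⟨t, rfl⟩ := E.exists_idx hi
    rw [hr0, E.rew_idx]
    -- `hk` keeps the sum within the multiplicities for which `G` is assumed.
    exact hG (k + 1) hk _ (M.add_rew_mem_rewSums hrm t)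
  rintro m3 ⟨hup, hm3, ha3⟩
  have hs3 := hs2.of_agree ha3
  set N := M.discovered Q a b (M.greedyIter Q a b k) r with hN
  have hCN : ∀ t, (m2.narr 5 (E.idx t) = 1 ∧ (E.inst a b).la (E.idx t) = 1 ∧
      m2.narr 17 (E.idx t) = 1) ↔ t ∈ N := by
    intro t
    rw [h17.eq_one_iff, E.la_idx, h5, h.tag]
    change _ ↔ t ∉ X ∧ a ∈ M.label t ∧ _
    refine and_congr ?_ (and_congr ?_ Iff.rfl)
    · split_ifs with h' <;> simp [X, h']
    · split_ifs with h' <;> simp [h']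
  have hX' : (M.greedyIter Q a b (k + 1)).X = X ∪ N := by
    rw [MDP.greedyIter_succ, MDP.greedyRound_of_nonempty hR]
  have hv' : ∀ t, (M.greedyIter Q a b (k + 1)).v t =
      if t ∈ N then ((r + M.rew t : ℝ) : EReal) else (M.greedyIter Q a b k).v t := by
    intro t
    rw [MDP.greedyIter_succ, MDP.greedyRound_of_nonempty hR]
  have hval : ∀ t, m3.narr 5 (E.idx t) = (if t ∈ X ∪ N then 0 else 1) ∧
      m3.rarr 2 (E.idx t) = if t ∈ N then r + M.rew t else m.rarr 2 (E.idx t) := by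
    intro t
    obtain ⟨u1, u2⟩ := hup _ (E.idx_lt t)
    simp only [hCN] at u1 u2
    rw [u1, u2, hr0, E.rew_idx, hr2, h5, h.tag]
    by_cases h1 : t ∈ N
    · simp [h1]
    · by_cases h2 : t ∈ (M.greedyIter Q a b k).X <;> simp [X, h1, h2]
  have hvX : ∀ t ∈ X ∪ N, (M.greedyIter Q a b (k + 1)).v t = (m3.rarr 2 (E.idx t) : EReal) := by
    intro t ht
    rw [hv', (hval t).2]
    split_ifs with h1
    · rfl
    · exact h.v t (ht.resolve_right h1)
  have hsX : ∀ t ∈ X ∪ N, m3.rarr 2 (E.idx t) ∈ M.rewSums (k + 1) := by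
    intro t ht
    rw [(hval t).2]
    split_ifs with h1
    · exact M.add_rew_mem_rewSums hrm t
    · exact M.rewSums_mono (Nat.le_succ k) (h.sums t (ht.resolve_right h1))
  have hRmem : ∀ x, x ∈ (M.greedyIter Q a b (k + 1)).R ↔
      (∃ t ∈ X ∪ N, m3.rarr 2 (E.idx t) = x) ∧ r < x := by
    intro x
    rw [mem_greedyIter_R_succ hQ hR, hX']
    refine and_congr_left fun _ => exists_congr fun t => and_congr_right fun ht => ?_
    rw [hvX t ht, EReal.coe_eq_coe_iff]
  have htag3 : ∀ t, m3.narr 5 (E.idx t) = 0 ↔ t ∈ X ∪ N := fun t => by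
    rw [(hval t).1]; split_ifs with h' <;> simp [h']
  have hr3 : m3.rreg 0 = r := (ha3.rreg 0 (by decide)).trans hr0
  refine WP.seq (T := 25 * Fintype.card S + 5) (T' := 1) hm3 ((find_spec hG0 hm3 hs3 (show Fintype.card S + 1 ≤ B by omega)).frame.mono
    le_rfl ?_)
  rintro m4 ⟨hf, hm4, ha4⟩
  refine WP.instr hm4 (hm4.exec hG0 trivial) ?_
  have hs5 := (hs3.of_agree ha4).of_agree (Instr.agree_exec (.rcopy 0 2) m4)
  have q5 : ((Instr.rcopy 0 2).exec m4).narr 5 = m3.narr 5 := ha4.narr 5 (by decide)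
  have q2 : ((Instr.rcopy 0 2).exec m4).rarr 2 = m3.rarr 2 := ha4.rarr 2 (by decide)
  have q15 : ((Instr.rcopy 0 2).exec m4).nreg 15 = m4.nreg 15 := rfl
  have q0 : ((Instr.rcopy 0 2).exec m4).rreg 0 = m4.rreg 2 := by simp [Instr.exec]
  set m5 := (Instr.rcopy 0 2).exec m4
  have hbase : ∀ t, m5.narr 5 (E.idx t) =
      if t ∈ (M.greedyIter Q a b (k + 1)).X then 0 else 1 := fun t => by
    rw [q5, (hval t).1, hX']
    split_ifs <;> rfl
  have hbv : ∀ t ∈ (M.greedyIter Q a b (k + 1)).X,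
      (M.greedyIter Q a b (k + 1)).v t = (m5.rarr 2 (E.idx t) : EReal) := fun t ht => by
    rw [q2]; exact hvX t (hX' ▸ ht)
  have hbs : ∀ t ∈ (M.greedyIter Q a b (k + 1)).X,
      m5.rarr 2 (E.idx t) ∈ M.rewSums (k + 1) := fun t ht => by
    rw [q2]; exact hsX t (hX' ▸ ht)
  rcases hf with ⟨h15, hall⟩ | ⟨h15, ⟨i, hi, hti, hlt, h2⟩, hmin⟩
  -- Nothing was found, so `R` is empty. The number copied to real register 0 is meaningless, but
  -- the conditions on it are vacuous.
  · have hempty : ¬ (M.greedyIter Q a b (k + 1)).R.Nonempty := by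
      rintro ⟨x, hx⟩
      obtain ⟨⟨t, ht, rfl⟩, hlt⟩ := (hRmem x).1 hx
      have := hall _ (E.idx_lt t) ((htag3 t).2 ht)
      rw [hr3] at this
      exact absurd hlt (not_lt.2 this)
    exact ⟨hs5, hbase, hbv, hbs, by rw [q15, h15, if_neg hempty], fun h => absurd h hempty,
      fun h => absurd h hempty⟩
  · obtain ⟨t, rfl⟩ := E.exists_idx hi
    rw [hr3] at hlt
    have ht := (htag3 t).1 hti
    have hmem : m4.rreg 2 ∈ (M.greedyIter Q a b (k + 1)).R :=
      (hRmem _).2 ⟨⟨t, ht, h2.symm⟩, by rwa [h2]⟩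
    refine ⟨hs5, hbase, hbv, hbs, by rw [q15, h15, if_pos ⟨_, hmem⟩], fun hne => ?_, fun _ => ?_⟩
    · rw [q0]
      refine le_antisymm ?_ (Finset.min'_le _ _ hmem)
      obtain ⟨⟨t', ht', heq⟩, hlt'⟩ := (hRmem _).1 (Finset.min'_mem _ hne)
      have := hmin _ (E.idx_lt t') ((htag3 t').2 ht') (by rw [hr3, heq]; exact hlt')
      rwa [heq] at this
    · rw [q0, h2]
      exact hsX t ht

/-- The program that evaluates the query, where `c` computes the states that are discovered in a
round. -/
def evalProg (c : Prog) : Prog := .seq prep (.loop (.lt 3 15) (roundProg c))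

/-- `i` bounds the remaining rounds; for `i = 0`, `lt_card_of_greedyIter_nonempty` forces `R` to be
empty. -/
theorem Represents.loop (hQ : Q.Basic) [Nonempty S] [Finite Act] {c : Prog} {T : ℕ}
    (hG : ∀ k ≤ Fintype.card S, ∀ x ∈ M.rewSums k, G x) (hB : M.numTrans + 1 ≤ B)
    (hc : Computes Q E a b B G c T) (htame : c.Tame) (i : ℕ) :
    ∀ (m : Store) (k : ℕ), m.Ok B G → Represents Q E a b k m → k + i = Fintype.card S →
    WP (Store.Ok B G) (.loop (.lt 3 15) (roundProg c)) (i * (T + 100 * M.numTrans + 1) + 1)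
      (fun m' => ∃ l, Represents Q E a b l m' ∧ (M.greedyIter Q a b l).R = ∅) m := by
  induction i with
  | zero =>
    intro m k hm h hk
    have hR : ¬ (M.greedyIter Q a b k).R.Nonempty := fun hne => by
      have := lt_card_of_greedyIter_nonempty hQ hne
      omega
    refine (WP.loop_false hm ?_ ⟨k, h, Finset.not_nonempty_iff_eq_empty.1 hR⟩).mono (by omega)
      fun _ h => h
    simp [Test.holds, h.static.zero, h.go, hR]
  | succ i ih =>
    intro m k hm h hk
    by_cases hR : (M.greedyIter Q a b k).R.Nonempty
    · refine (WP.loop_true hm ?_ ((h.round hQ hG hB hc htame hm hR).inv.mono le_rfl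
        fun m' h' => ih m' (k + 1) h'.2 h'.1 (by omega))).mono ?_ fun _ h => h
      · simp [Test.holds, h.static.zero, h.go, hR]
      · rw [Nat.add_one_mul i]; omega
    · refine (WP.loop_false hm ?_ ⟨k, h, Finset.not_nonempty_iff_eq_empty.1 hR⟩).mono (by omega)
        fun _ h => h
      simp [Test.holds, h.static.zero, h.go, hR]

theorem evalProg_spec (hQ : Q.Basic) [Nonempty S] [Finite Act] {c : Prog} {T : ℕ}
    (hG : ∀ k ≤ Fintype.card S, ∀ x ∈ M.rewSums k, G x) (hB : M.numTrans + 1 ≤ B)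
    (hc : Computes Q E a b B G c T) (htame : c.Tame) (hm : (E.input a b).Ok B G) :
    WP (Store.Ok B G) (evalProg c) (Fintype.card S * (T + 200 * M.numTrans))
      (fun m' => ∀ i : Fin (Fintype.card S), m'.output i = M.val Q a b (E.states i))
      (E.input a b) := by
  classical
  have hn := M.card_le_card_choice
  have hn' := M.card_choice_le_numTrans
  have hpos : 0 < Fintype.card S := Fintype.card_pos
  have hG0 : G 0 := hG 0 (Nat.zero_le _) 0 (M.zero_mem_rewSums 0)
  refine (WP.seq hm ((prep_spec hG0 hm (E.initial a b) (show Fintype.card S + 1 ≤ B by omega)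
    (show Nat.card M.Choice + 1 ≤ B by omega) hB).frame.mono le_rfl ?_)).mono
    (T := 28 * Fintype.card S + 10 * Nat.card M.Choice + 12 * M.numTrans + 30 +
      (Fintype.card S * (T + 100 * M.numTrans + 1) + 1) + 1) ?_ fun _ h => h
  · rintro m1 ⟨⟨hs1, h5, h15, h0⟩, hm1, ha1⟩
    have hrep : Represents Q E a b 0 m1 := by
      have hR : (M.greedyIter Q a b 0).R = {0} := rfl
      have hXb : ∀ t, t ∈ (M.greedyIter Q a b 0).X ↔ b ∈ M.label t := fun t => Iff.rfl
      have hr2 : ∀ i, m1.rarr 2 i = 0 := fun i => by rw [ha1.rarr 2 (by decide)]; rfl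
      refine ⟨hs1, fun t => ?_, fun t ht => ?_, fun t ht => ?_, ?_, fun h => ?_, fun _ => ?_⟩
      · rw [h5 _ (E.idx_lt t), E.lb_idx]
        by_cases hb : b ∈ M.label t <;> simp [hXb, hb]
      · rw [hr2]
        exact if_pos ht
      · rw [hr2]; exact M.zero_mem_rewSums 0
      · rw [h15, hR]; simp
      · rw [h0]; simp [hR]
      · rw [h0]; exact M.zero_mem_rewSums 0
    refine (Represents.loop hQ hG hB hc htame (Fintype.card S) m1 0 hm1 hrep (by omega)).mono
      le_rfl ?_
    rintro m2 ⟨l, h, hR⟩ i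
    have hv := greedyIter_v_eq_val hQ hR (E.states i)
    rw [← hv, Store.output, ← E.idx_states i, h.tag]
    obtain ⟨r, H, -⟩ := greedyIter_inv (M := M) (a := a) (b := b) hQ l
    by_cases hX : E.states i ∈ (M.greedyIter Q a b l).X
    · rw [if_pos hX, h.v _ hX]
      rfl
    · rw [if_neg hX, H.v_top _ hX]
      rfl
  · have e1 : Fintype.card S * (T + 100 * M.numTrans + 1) = Fintype.card S * T +
      100 * (Fintype.card S * M.numTrans) + Fintype.card S := by ring
    have e2 : Fintype.card S * (T + 200 * M.numTrans) = Fintype.card S * T +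
      200 * (Fintype.card S * M.numTrans) := by ring
    have e3 : M.numTrans ≤ Fintype.card S * M.numTrans := Nat.le_mul_of_pos_left _ hpos
    omega

end MainLoop

/-! ### Binary lengths of sums of rewards. -/

section BitLength

theorem den_sum_dvd {ι : Type*} (s : Finset ι) (c : ι → ℕ) (ρ : ι → ℚ) :
    (∑ i ∈ s, (c i : ℚ) * ρ i).den ∣ ∏ i ∈ s, (ρ i).den := by
  classical
  induction s using Finset.induction_on with
  | empty => simp
  | insert i s hi ih =>
    rw [Finset.sum_insert hi, Finset.prod_insert hi]
    refine (Rat.add_den_dvd _ _).trans (mul_dvd_mul ?_ ih)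
    simpa using Rat.mul_den_dvd (c i : ℚ) (ρ i)

/-- The product of the denominators is a common denominator of size at most `2 ^ L`. Number of
terms, multiplicities and rewards are at most `2 ^ L` each, so the sum is at most `2 ^ (3 * L)` and
its numerator at most `2 ^ (4 * L)`. The sizes `4 * L + 1` and `L + 1` add up. -/
theorem bitLen_sum_le {ι : Type*} [Fintype ι] {ρ : ι → ℚ} (hρ : ∀ i, 0 ≤ ρ i) {c : ι → ℕ} {k L : ℕ}
    (hc : ∀ i, c i ≤ k) (hk : k ≤ L) (hn : Fintype.card ι ≤ L) (hL : ∑ i, bitLen (ρ i) ≤ L) :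
    bitLen (∑ i, (c i : ℚ) * ρ i) ≤ 5 * L + 2 := by
  set q := ∑ i, (c i : ℚ) * ρ i with hq
  have hden : q.den ≤ 2 ^ L := by
    calc q.den ≤ ∏ i, (ρ i).den :=
          Nat.le_of_dvd (Finset.prod_pos fun i _ => (ρ i).den_pos) (den_sum_dvd _ _ _)
      _ ≤ ∏ i, 2 ^ (bitLen (ρ i)) := by
          refine Finset.prod_le_prod' fun i _ => (Nat.lt_size_self _).le.trans ?_
          exact Nat.pow_le_pow_right (by omega) (Nat.le_add_left _ _)
      _ = 2 ^ ∑ i, bitLen (ρ i) := Finset.prod_pow_eq_pow_sum _ _ _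
      _ ≤ 2 ^ L := Nat.pow_le_pow_right (by omega) hL
  have hle : ∀ i, ρ i ≤ 2 ^ L := by
    intro i
    have h1 : ρ i ≤ ((ρ i).num.natAbs : ℚ) := by
      have h2 : ((ρ i).num.natAbs : ℚ) = (ρ i).num := by
        rw [Nat.cast_natAbs, abs_of_nonneg (Rat.num_nonneg.2 (hρ i))]
      rw [h2, ← Rat.mul_den_eq_num]
      exact le_mul_of_one_le_right (hρ i) (by exact_mod_cast (ρ i).den_pos)
    have h3 : bitLen (ρ i) ≤ L :=
      (Finset.single_le_sum (f := fun i => bitLen (ρ i)) (fun _ _ => Nat.zero_le _)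
        (Finset.mem_univ i)).trans hL
    have h4 : (ρ i).num.natAbs ≤ 2 ^ L := (Nat.lt_size_self _).le.trans
      (Nat.pow_le_pow_right (by omega) ((Nat.le_add_right _ _).trans h3))
    exact h1.trans (by exact_mod_cast h4)
  have hL2 : (L : ℚ) ≤ 2 ^ L := by exact_mod_cast Nat.lt_two_pow_self.le
  have hq0 : 0 ≤ q := Finset.sum_nonneg fun i _ => mul_nonneg (Nat.cast_nonneg _) (hρ i)
  have hqle : q ≤ 2 ^ L * (2 ^ L * 2 ^ L) := by
    calc q ≤ ∑ _i : ι, (2 ^ L * 2 ^ L : ℚ) := by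
          refine Finset.sum_le_sum fun i _ => mul_le_mul ?_ (hle i) (hρ i) (by positivity)
          exact le_trans (by exact_mod_cast (hc i).trans hk) hL2
      _ = (Fintype.card ι : ℚ) * (2 ^ L * 2 ^ L) := by simp
      _ ≤ 2 ^ L * (2 ^ L * 2 ^ L) := by
          refine mul_le_mul_of_nonneg_right (le_trans ?_ hL2) (by positivity)
          exact_mod_cast hn
  have hnum : q.num.natAbs ≤ 2 ^ (4 * L) := by
    have h1 : (q.num.natAbs : ℚ) = q * q.den := by
      rw [Rat.mul_den_eq_num, Nat.cast_natAbs, abs_of_nonneg (Rat.num_nonneg.2 hq0)]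
    have h2 : (q.num.natAbs : ℚ) ≤ 2 ^ (4 * L) := by
      rw [h1]
      calc q * q.den ≤ 2 ^ L * (2 ^ L * 2 ^ L) * 2 ^ L :=
            mul_le_mul hqle (by exact_mod_cast hden) (Nat.cast_nonneg _) (by positivity)
        _ = 2 ^ (4 * L) := by ring
    exact_mod_cast h2
  have s1 : q.num.natAbs.size ≤ 4 * L + 1 :=
    Nat.size_le.2 (hnum.trans_lt (Nat.pow_lt_pow_right (by omega) (by omega)))
  have s2 : q.den.size ≤ L + 1 :=
    Nat.size_le.2 (hden.trans_lt (Nat.pow_lt_pow_right (by omega) (by omega)))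
  unfold bitLen
  omega

end BitLength

/-! ### From the program logic to runs of the machine. -/

section Halting

theorem iterate_step_nil (m : Store) (i : ℕ) : step^[i] ([], m) = ([], m) := by
  induction i with
  | zero => rfl
  | succ i ih => rw [Function.iterate_succ_apply]; exact ih

/-- A halted configuration no longer changes, so the invariant of the terminating run holds at all
times. -/
theorem WP.run {I : Store → Prop} {P : Prog} {T : ℕ} {R : Store → Prop} {m : Store}
    (h : WP I P T R m) :
    (∃ t ≤ T, (P.run m t).1 = [] ∧ R (P.run m t).2) ∧ ∀ i, I (P.run m i).2 := by
  obtain ⟨t, ht, m', h1, h2⟩ := h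
  obtain ⟨h3, h4⟩ := h1 []
  refine ⟨⟨t, ht, ?_, ?_⟩, fun i => ?_⟩
  · rw [Prog.run, h3]
  · rwa [Prog.run, h3]
  · rcases le_or_gt i t with hi | hi
    · exact h4 i hi
    · obtain ⟨j, rfl⟩ := Nat.exists_eq_add_of_lt hi
      have h5 := h4 t le_rfl
      rw [h3] at h5
      rw [Prog.run, show t + j + 1 = (j + 1) + t by omega, Function.iterate_add_apply, h3,
        iterate_step_nil]
      exact h5

end Halting

/-! ### Evaluation of all qualitative queries. -/

section Evaluation

theorem MDP.nonempty_scheduler {S : Type u} {Act : Type v} {AP : Type w}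
    (M : MDP S Act AP) : Nonempty M.Scheduler := by
  choose f hf using M.enabled_nonempty
  exact ⟨M.memoryless f hf⟩

variable {S : Type u} {Act : Type v} {AP : Type w} [Fintype S] {M : MDP S Act AP}
  {E : M.Listing} {a b : AP} {B : ℕ} {G : ℝ → Prop}

theorem arrayOf_prop {α : Type} [Zero α] {n : ℕ} {f : Fin n → α} {p : α → Prop} (h0 : p 0)
    (h : ∀ i, p (f i)) (i : ℕ) : p (arrayOf f i) := by
  unfold arrayOf
  split_ifs
  · exact h _
  · exact h0

theorem MDP.Listing.input_ok [Nonempty S] [Finite Act] (hB : M.numTrans ≤ B) (h0 : G 0)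
    (hrew : ∀ s, G (M.rew s)) (hprob : ∀ j, G (E.prob j)) : (E.input a b).Ok B G := by
  have hn := M.card_le_card_choice
  have hn' := M.card_choice_le_numTrans
  have hpos : 0 < Fintype.card S := Fintype.card_pos
  refine ⟨fun x => ?_, fun A => ?_, fun x => h0, fun A => ?_⟩
  · match x with
    | 0 => exact (hn.trans hn').trans hB
    | 1 => exact hn'.trans hB
    | 2 => exact hB
    | x + 3 => exact Nat.zero_le _
  · match A with
    | 0 =>
      simp only [input]
      refine arrayOf_prop (p := (· ≤ B)) (Nat.zero_le _) fun i => ?_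
      split_ifs <;> omega
    | 1 =>
      simp only [input]
      refine arrayOf_prop (p := (· ≤ B)) (Nat.zero_le _) fun i => ?_
      split_ifs <;> omega
    | 2 =>
      simp only [input]
      refine arrayOf_prop (p := (· ≤ B)) (Nat.zero_le _) fun i => ?_
      exact (Fin.is_lt _).le.trans ((hn.trans hn').trans hB)
    | 3 =>
      simp only [input]
      refine arrayOf_prop (p := (· ≤ B)) (Nat.zero_le _) fun i => ?_
      exact (Fin.is_lt _).le.trans (hn'.trans hB)
    | 4 =>
      simp only [input]
      refine arrayOf_prop (p := (· ≤ B)) (Nat.zero_le _) fun i => ?_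
      exact (Fin.is_lt _).le.trans ((hn.trans hn').trans hB)
    | A + 5 => exact fun i => Nat.zero_le _
  · match A with
    | 0 => exact arrayOf_prop h0 fun i => hrew _
    | 1 => exact arrayOf_prop h0 hprob
    | A + 2 => exact fun i => h0

variable [MeasurableSpace S] [DiscreteMeasurableSpace S] {Q : ProbQuant}

/-- The program `P` evaluates the query within `T` steps and keeps all numbers within the bounds
that are given by the input. -/
def Evaluates (Q : ProbQuant) (E : M.Listing) (a b : AP) (P : Prog) (T : ℕ) : Prop :=
  ∀ (B : ℕ) (G : ℝ → Prop), (∀ k ≤ Fintype.card S, ∀ x ∈ M.rewSums k, G x) →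
    M.numTrans + 1 ≤ B → (E.input a b).Ok B G →
    WP (Store.Ok B G) P T
      (fun m' => ∀ i : Fin (Fintype.card S), m'.output i = M.val Q a b (E.states i)) (E.input a b)

/-- The invariant is used twice: without a condition on reals, and, for rational inputs, with
rationals of bounded length. The constant 7 covers `5 * L + 2`, as `L` is positive, and the bound on
natural numbers. -/
theorem Evaluates.bounds [Nonempty S] [Finite Act] {P : Prog} {T C : ℕ} (hC : 7 ≤ C)
    (h : Evaluates Q E a b P T) :
    (∃ t ≤ T, (P.run (E.input a b) t).1 = [] ∧ ∀ i : Fin (Fintype.card S),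
      (P.run (E.input a b) t).2.output i = M.val Q a b (E.states i)) ∧
    (∀ i : ℕ, (P.run (E.input a b) i).2.NatBounded (C * M.numTrans)) ∧
    (∀ (ρ : S → ℚ) (π : Fin M.numTrans → ℚ),
      (∀ s, (M.rew s : ℝ) = ρ s) → (∀ j, E.prob j = π j) →
      ∀ i : ℕ, (P.run (E.input a b) i).2.RatBounded (C * M.inputSize ρ π ^ 1)) := by
  have hn := M.card_le_card_choice
  have hn' := M.card_choice_le_numTrans
  have hpos : 0 < Fintype.card S := Fintype.card_pos
  have hB : M.numTrans + 1 ≤ C * M.numTrans := by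
    have : 7 * M.numTrans ≤ C * M.numTrans := Nat.mul_le_mul_right _ hC
    omega
  have h1 := (h (C * M.numTrans) (fun _ => True) (fun _ _ _ _ => trivial) hB
    (E.input_ok (by omega) trivial (fun _ => trivial) fun _ => trivial)).run
  refine ⟨h1.1, fun i => ⟨(h1.2 i).nreg, (h1.2 i).narr⟩, fun ρ π hρ hπ i => ?_⟩
  set L := M.inputSize ρ π with hL
  have hLn : Fintype.card S ≤ L := by rw [hL, MDP.inputSize]; omega
  have hLρ : ∑ s, bitLen (ρ s) ≤ L := by rw [hL, MDP.inputSize]; omega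
  have hLπ : ∑ j, bitLen (π j) ≤ L := by rw [hL, MDP.inputSize]; omega
  have hCL : 7 * L ≤ C * L ^ 1 := by rw [pow_one]; exact Nat.mul_le_mul_right _ hC
  have hρ0 : ∀ s, 0 ≤ ρ s := fun s => by
    have : (0 : ℝ) ≤ ρ s := by rw [← hρ s]; exact (M.rew s).2
    exact_mod_cast this
  have hG : ∀ k ≤ Fintype.card S, ∀ x ∈ M.rewSums k,
      ∃ q : ℚ, x = q ∧ bitLen q ≤ C * L ^ 1 := by
    rintro k hk x ⟨c, hc, rfl⟩
    refine ⟨∑ s, (c s : ℚ) * ρ s, ?_, ?_⟩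
    · push_cast
      exact Finset.sum_congr rfl fun s _ => by rw [hρ s]
    · have := bitLen_sum_le hρ0 hc (hk.trans hLn) hLn hLρ
      omega
  have h2 := (h (C * M.numTrans) _ hG hB (E.input_ok (by omega)
    (hG 0 (Nat.zero_le _) 0 (M.zero_mem_rewSums 0)) (fun s => ⟨ρ s, hρ s, ?_⟩)
    fun j => ⟨π j, hπ j, ?_⟩)).run
  · exact ⟨(h2.2 i).rreg, (h2.2 i).rarr⟩
  · have := (Finset.single_le_sum (f := fun s => bitLen (ρ s)) (fun _ _ => Nat.zero_le _)
      (Finset.mem_univ s)).trans hLρ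
    omega
  · have := (Finset.single_le_sum (f := fun j => bitLen (π j)) (fun _ _ => Nat.zero_le _)
      (Finset.mem_univ j)).trans hLπ
    omega

/-- The program that tags all states with `k`. -/
def tagProg (k : ℕ) : Prog := .seq (.instr (.const 4 1)) (fill 5 0 (.instr (.const 10 k)))

theorem tagProg_evaluates [Nonempty S] [Finite Act] {x : EReal} {k : ℕ}
    (hk : k = 1 ∧ x = ⊤ ∨ k = 2 ∧ x = ⊥) (h : ∀ s, M.val Q a b s = x) :
    Evaluates Q E a b (tagProg k) (11 * Fintype.card S) := by
  intro B G hG hB hm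
  have hn := M.card_le_card_choice
  have hn' := M.card_choice_le_numTrans
  have hpos : 0 < Fintype.card S := Fintype.card_pos
  have hG0 : G 0 := hG 0 (Nat.zero_le _) 0 (M.zero_mem_rewSums 0)
  have e1 := hm.exec hG0 (i := .const 4 1) (show 1 ≤ B by omega)
  have i4 : ((Instr.const 4 1).exec (E.input a b)).nreg 4 = 1 := by simp [Instr.exec]
  have i0 : ((Instr.const 4 1).exec (E.input a b)).nreg 0 = Fintype.card S := by
    simp [Instr.exec]; rfl
  have hkB : k ≤ B := by rcases hk with ⟨rfl, -⟩ | ⟨rfl, -⟩ <;> omega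
  refine (WP.seq (T := 1) (T' := Fintype.card S * 6 + 3) hm (WP.instr hm e1
    ((fill_spec hG0 (f := fun _ => k) e1 i0 i4 (by omega) ?_ (by simp [Prog.writes, Instr.writes])
      (by simp [Prog.writes, Instr.writes]) (by simp [Prog.writes, Instr.writes]) rfl).mono le_rfl
      ?_))).mono (by omega) fun _ h => h
  · intro _ _ m' _ _ _ _
    exact ⟨hkB, by simp [Prog.den, Instr.exec]⟩
  · rintro m' ⟨h5, -, -⟩ i
    rw [h, Store.output, h5]
    rcases hk with ⟨rfl, rfl⟩ | ⟨rfl, rfl⟩ <;> simp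

theorem sInf_range_coe_real : sInf (Set.range fun r : ℝ => (r : EReal)) = ⊥ := by
  rw [sInf_eq_bot]
  intro y hy
  obtain ⟨x, -, hx⟩ := EReal.lt_iff_exists_real_btwn.1 hy
  exact ⟨x, ⟨x, rfl⟩, hx⟩

theorem sSup_range_coe_real : sSup (Set.range fun r : ℝ => (r : EReal)) = ⊤ := by
  rw [sSup_eq_top]
  intro y hy
  obtain ⟨x, hx, -⟩ := EReal.lt_iff_exists_real_btwn.1 hy
  exact ⟨x, ⟨x, rfl⟩, hx⟩

theorem MDP.sat_of_forall {s : S} {A : Set (ℕ → S)}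
    (h : ∀ σ : M.Scheduler, Q.cmp.holds (σ.pr s A) Q.bound) : M.sat Q s A := by
  obtain ⟨σ⟩ := M.nonempty_scheduler
  unfold MDP.sat
  split
  · exact h
  · exact ⟨σ, h σ⟩

theorem MDP.not_sat_of_forall {s : S} {A : Set (ℕ → S)}
    (h : ∀ σ : M.Scheduler, ¬ Q.cmp.holds (σ.pr s A) Q.bound) : ¬ M.sat Q s A := by
  obtain ⟨σ⟩ := M.nonempty_scheduler
  unfold MDP.sat
  split
  · exact fun h' => h σ (h' σ)
  · exact fun ⟨σ', h'⟩ => h σ' h'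

/-- Probabilities lie between 0 and 1, so this comparison and the next three hold always or never.
The value is then the infimum or supremum of the empty set or of all reals. -/
theorem MDP.val_ge_zero (q : Mode) (s : S) : M.val ⟨q, .ge, 0⟩ a b s = ⊥ := by
  have : {r | M.sat ⟨q, .ge, 0⟩ s (M.untilLE a b r)} = Set.univ :=
    Set.eq_univ_of_forall fun r => MDP.sat_of_forall fun σ => σ.pr_nonneg _ _
  rw [MDP.val, this, Set.image_univ, sInf_range_coe_real]

theorem MDP.val_lt_zero (q : Mode) (s : S) : M.val ⟨q, .lt, 0⟩ a b s = ⊥ := by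
  have : {r | M.sat ⟨q, .lt, 0⟩ s (M.untilLE a b r)} = ∅ :=
    Set.eq_empty_of_forall_notMem fun r => MDP.not_sat_of_forall fun σ =>
      not_lt.2 (σ.pr_nonneg _ _)
  rw [MDP.val, this, Set.image_empty, sSup_empty]

theorem MDP.val_gt_one (q : Mode) (s : S) : M.val ⟨q, .gt, 1⟩ a b s = ⊤ := by
  have : {r | M.sat ⟨q, .gt, 1⟩ s (M.untilLE a b r)} = ∅ :=
    Set.eq_empty_of_forall_notMem fun r => MDP.not_sat_of_forall fun σ =>
      not_lt.2 (σ.pr_le_one _ _)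
  rw [MDP.val, this, Set.image_empty, sInf_empty]

theorem MDP.val_le_one (q : Mode) (s : S) : M.val ⟨q, .le, 1⟩ a b s = ⊤ := by
  have : {r | M.sat ⟨q, .le, 1⟩ s (M.untilLE a b r)} = Set.univ :=
    Set.eq_univ_of_forall fun r => MDP.sat_of_forall fun σ => σ.pr_le_one _ _
  rw [MDP.val, this, Set.image_univ, sSup_range_coe_real]

theorem Evaluates.dual {P : Prog} {T : ℕ} (hQ : Q.Basic) (h : Evaluates Q E a b P T) :
    Evaluates Q.dual E a b P T := by
  intro B G hG hB hm
  exact (h B G hG hB hm).mono le_rfl fun m' h' i => by rw [h' i, M.val_dual hQ]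

theorem evalProg_evaluates (hQ : Q.Basic) [Nonempty S] [Finite Act] {c : Prog} {T : ℕ}
    (hc : ∀ (B : ℕ) (G : ℝ → Prop), G 0 → M.numTrans + 1 ≤ B → Computes Q E a b B G c T)
    (htame : c.Tame) :
    Evaluates Q E a b (evalProg c) (Fintype.card S * (T + 200 * M.numTrans)) :=
  fun B G hG hB hm => evalProg_spec hQ hG hB
    (hc B G (hG 0 (Nat.zero_le _) 0 (M.zero_mem_rewSums 0)) hB) htame hm

theorem Evaluates.of_le {P : Prog} {T T' : ℕ} (h : Evaluates Q E a b P T) (hT : T ≤ T') :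
    Evaluates Q E a b P T' :=
  fun B G hG hB hm => (h B G hG hB hm).mono hT fun _ h => h

theorem evaluates_exPos [Nonempty S] [Finite Act] :
    Evaluates exPos E a b (evalProg satExPos) (1000 * (Fintype.card S * M.numTrans)) :=
  (evalProg_evaluates (by simp [ProbQuant.Basic]) (fun _ _ h0 hB => satExPos_computes h0 hB)
    (by unfold Prog.Tame; decide)).of_le (by nlinarith)

theorem evaluates_allPos [Nonempty S] [Finite Act] :
    Evaluates allPos E a b (evalProg satAllPos) (1000 * (Fintype.card S * M.numTrans)) :=
  (evalProg_evaluates (by simp [ProbQuant.Basic]) (fun _ _ h0 hB => satAllPos_computes h0 hB)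
    (by unfold Prog.Tame; decide)).of_le (by nlinarith)

theorem evaluates_allOne [Nonempty S] [Finite Act] :
    Evaluates allOne E a b (evalProg satAllOne) (1000 * (Fintype.card S * M.numTrans)) :=
  (evalProg_evaluates (by simp [ProbQuant.Basic]) (fun _ _ h0 hB => satAllOne_computes h0 hB)
    (by unfold Prog.Tame; decide)).of_le (by nlinarith)

theorem evaluates_exOne [Nonempty S] [Finite Act] :
    Evaluates exOne E a b (evalProg satExOne) (1000 * (Fintype.card S ^ 2 * M.numTrans)) := by
  refine (evalProg_evaluates (by simp [ProbQuant.Basic])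
    (fun _ _ h0 hB => satExOne_computes h0 hB) (by unfold Prog.Tame; decide)).of_le ?_
  have hpos : 0 < Fintype.card S := Fintype.card_pos
  have e : Fintype.card S * M.numTrans ≤ Fintype.card S * (Fintype.card S * M.numTrans) :=
    Nat.le_mul_of_pos_left _ hpos
  nlinarith

end Evaluation

/-! ### Assembling the main theorem. -/

theorem Evaluates.exists_time_le {S : Type u} [Fintype S] [Nonempty S] [MeasurableSpace S]
    [DiscreteMeasurableSpace S] {Act : Type v} [Fintype Act] {AP : Type w} {M : MDP S Act AP}
    {a b : AP} {E : M.Listing} {Q : ProbQuant} {P : Prog}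
    (h : Evaluates Q E a b P (1000 * (Fintype.card S * M.numTrans))) :
    ∃ T ≤ 1000 * (Fintype.card S ^ 2 * M.numTrans),
      (Q ≠ exOne ∧ Q ≠ exOne.dual → T ≤ 1000 * (Fintype.card S * M.numTrans)) ∧
      Evaluates Q E a b P T :=
  ⟨_, Nat.mul_le_mul_left _ (Nat.mul_le_mul_right _ (Nat.le_self_pow (by norm_num) _)),
    fun _ => le_rfl, h⟩

/-- A program that evaluates the query within the time bound satisfies all the bounds. -/
theorem exists_program_of_evaluates {Q : ProbQuant} (P : Prog)
    (h : ∀ (S : Type u) [Fintype S] [Nonempty S] [MeasurableSpace S] [DiscreteMeasurableSpace S]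
      (Act : Type v) [Fintype Act] (AP : Type w) (M : MDP S Act AP) (a b : AP) (E : M.Listing),
      ∃ T ≤ 1000 * (Fintype.card S ^ 2 * M.numTrans),
        (Q ≠ exOne ∧ Q ≠ exOne.dual → T ≤ 1000 * (Fintype.card S * M.numTrans)) ∧
        Evaluates Q E a b P T) :
    ∃ (P : Prog) (C d : ℕ),
      ∀ (S : Type u) [Fintype S] [Nonempty S] [MeasurableSpace S] [DiscreteMeasurableSpace S]
        (Act : Type v) [Fintype Act] (AP : Type w)
        (M : MDP S Act AP) (a b : AP) (E : M.Listing),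
        (∃ T : ℕ,
          T ≤ C * (Fintype.card S ^ 2 * M.numTrans) ∧
          (Q ≠ exOne ∧ Q ≠ exOne.dual → T ≤ C * (Fintype.card S * M.numTrans)) ∧
          (P.run (E.input a b) T).1 = [] ∧
          ∀ i : Fin (Fintype.card S),
            (P.run (E.input a b) T).2.output i = M.val Q a b (E.states i)) ∧
        (∀ i : ℕ, (P.run (E.input a b) i).2.NatBounded (C * M.numTrans)) ∧
        (∀ (ρ : S → ℚ) (π : Fin M.numTrans → ℚ),
          (∀ s, (M.rew s : ℝ) = ρ s) → (∀ j, E.prob j = π j) →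
          ∀ i : ℕ, (P.run (E.input a b) i).2.RatBounded (C * M.inputSize ρ π ^ d)) := by
  refine ⟨P, 1000, 1, fun S _ _ _ _ Act _ AP M a b E => ?_⟩
  obtain ⟨T, hT, hT', hE⟩ := h S Act AP M a b E
  obtain ⟨⟨t, ht, h1, h2⟩, h3⟩ := hE.bounds (C := 1000) (by norm_num)
  exact ⟨⟨t, ht.trans hT, fun hQ => ht.trans (hT' hQ), h1, h2⟩, h3⟩

end QuantileMDP

end

theorem mainTheorem1 :
    (∀ Q : ProbQuant, Q.Qualitative →
      ∃ (P : Prog) (C d : ℕ),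
        ∀ (S : Type u) [Fintype S] [Nonempty S] [MeasurableSpace S] [DiscreteMeasurableSpace S]
          (Act : Type v) [Fintype Act] (AP : Type w)
          (M : MDP S Act AP) (a b : AP) (E : M.Listing),
          (∃ T : ℕ,
            T ≤ C * (Fintype.card S ^ 2 * M.numTrans) ∧
            (Q ≠ exOne ∧ Q ≠ exOne.dual → T ≤ C * (Fintype.card S * M.numTrans)) ∧
            (P.run (E.input a b) T).1 = [] ∧
            ∀ i : Fin (Fintype.card S),
              (P.run (E.input a b) T).2.output i = M.val Q a b (E.states i)) ∧
          (∀ i : ℕ, (P.run (E.input a b) i).2.NatBounded (C * M.numTrans)) ∧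
          (∀ (ρ : S → ℚ) (π : Fin M.numTrans → ℚ),
            (∀ s, (M.rew s : ℝ) = ρ s) → (∀ j, E.prob j = π j) →
            ∀ i : ℕ, (P.run (E.input a b) i).2.RatBounded (C * M.inputSize ρ π ^ d))) ∧
    (∀ Q : ProbQuant, Q = allPos ∨ Q = exPos ∨ Q = allOne ∨ Q = exOne →
      ∀ (S : Type u) [Fintype S] [Nonempty S] [MeasurableSpace S] [DiscreteMeasurableSpace S]
        (Act : Type v) [Fintype Act] (AP : Type w) (M : MDP S Act AP) (a b : AP),
        ∃ N ≤ Fintype.card S,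
          ((M.greedyRound Q a b)^[N] (M.greedyStart b)).R = ∅ ∧
          ∀ s, ((M.greedyRound Q a b)^[N] (M.greedyStart b)).v s = M.val Q a b s ∧
            ((M.greedyRound Q a b)^[N] (M.greedyStart b)).v s = M.val Q.dual a b s) := by
  refine ⟨?_, fun Q hQ S _ _ _ _ Act _ AP M a b => greedy_correct hQ⟩
  -- Of the 16 qualitative quantifiers, eight hold always or never, four are basic, and four are
  -- duals of basic ones, evaluated by the same programs.
  rintro ⟨q, c, p⟩ hp
  have trivial_bound : ∀ (S : Type u) [Fintype S] [Nonempty S] (Act : Type v) [Fintype Act]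
      (AP : Type w) (M : MDP S Act AP),
      11 * Fintype.card S ≤ 1000 * (Fintype.card S * M.numTrans) := by
    intro S _ _ Act _ AP M
    have h1 := M.card_le_card_choice.trans M.card_choice_le_numTrans
    have h2 : 0 < Fintype.card S := Fintype.card_pos
    have h3 : Fintype.card S ≤ Fintype.card S * M.numTrans :=
      Nat.le_mul_of_pos_right _ (by omega)
    omega
  have hp' : p = 0 ∨ p = 1 := hp
  rcases hp' with rfl | rfl
  · cases c with
    | lt => exact exists_program_of_evaluates (tagProg 2) fun S _ _ _ _ Act _ AP M a b E =>
        ((tagProg_evaluates (Or.inr ⟨rfl, rfl⟩) (M.val_lt_zero q)).of_le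
          (trivial_bound S Act AP M)).exists_time_le
    | ge => exact exists_program_of_evaluates (tagProg 2) fun S _ _ _ _ Act _ AP M a b E =>
        ((tagProg_evaluates (Or.inr ⟨rfl, rfl⟩) (M.val_ge_zero q)).of_le
          (trivial_bound S Act AP M)).exists_time_le
    | gt => cases q with
      | all =>
        exact exists_program_of_evaluates (Q := allPos) (evalProg satAllPos)
          fun S _ _ _ _ Act _ AP M a b E =>
            evaluates_allPos.exists_time_le
      | ex =>
        exact exists_program_of_evaluates (Q := exPos) (evalProg satExPos)
          fun S _ _ _ _ Act _ AP M a b E =>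
            evaluates_exPos.exists_time_le
    | le => cases q with
      | all =>
        exact exists_program_of_evaluates (Q := exPos.dual) (evalProg satExPos)
          fun S _ _ _ _ Act _ AP M a b E =>
            (evaluates_exPos.dual (by simp [ProbQuant.Basic])).exists_time_le
      | ex =>
        exact exists_program_of_evaluates (Q := allPos.dual) (evalProg satAllPos)
          fun S _ _ _ _ Act _ AP M a b E =>
            (evaluates_allPos.dual (by simp [ProbQuant.Basic])).exists_time_le
  · cases c with
    | gt => exact exists_program_of_evaluates (tagProg 1) fun S _ _ _ _ Act _ AP M a b E =>
        ((tagProg_evaluates (Or.inl ⟨rfl, rfl⟩) (M.val_gt_one q)).of_le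
          (trivial_bound S Act AP M)).exists_time_le
    | le => exact exists_program_of_evaluates (tagProg 1) fun S _ _ _ _ Act _ AP M a b E =>
        ((tagProg_evaluates (Or.inl ⟨rfl, rfl⟩) (M.val_le_one q)).of_le
          (trivial_bound S Act AP M)).exists_time_le
    | ge => cases q with
      | all =>
        exact exists_program_of_evaluates (Q := allOne) (evalProg satAllOne)
          fun S _ _ _ _ Act _ AP M a b E =>
            evaluates_allOne.exists_time_le
      | ex =>
        exact exists_program_of_evaluates (Q := exOne) (evalProg satExOne)
          fun S _ _ _ _ Act _ AP M a b E =>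
            ⟨_, le_rfl, fun h => (h.1 rfl).elim, evaluates_exOne⟩
    | lt => cases q with
      | all =>
        exact exists_program_of_evaluates (Q := exOne.dual) (evalProg satExOne)
          fun S _ _ _ _ Act _ AP M a b E =>
            ⟨_, le_rfl, fun h => (h.2 rfl).elim, evaluates_exOne.dual (by simp [ProbQuant.Basic])⟩
      | ex =>
        exact exists_program_of_evaluates (Q := allOne.dual) (evalProg satAllOne)
          fun S _ _ _ _ Act _ AP M a b E =>
            (evaluates_allOne.dual (by simp [ProbQuant.Basic])).exists_time_le
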